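/- **Setting.** Let $k\ge 2$, let $I=[a,b]$ with $a<b$, and let $w_1,\dots,w_k$ be positive functions (weights) on $I$ with $w_i\in C^{k-i+1}(I)$; put $w_{k+1}:=1$. Let $n\ge k-1$ and let $$\Delta:\quad a=t_0=\dots=t_{k-1}<t_k<\dots<t_n<t_{n+1}=\dots=t_{n+k}=b$$ be a knot sequence with mesh size $|\Delta|=\max_{0\le i\le n}(t_{i+1}-t_i)$. Write $\langle f,g\rangle=\int_a^b f(x)g(x)\,dx$. All derivatives are taken within $I$ (one-sided at $a$ and $b$). *B-splines.* Let $Tf(x)=\int_a^x f$, $T_yf(x)=\int_y^x f$, and let $m_gf=gf$. The dual system is $u_i^*=(T m_{w_k})(T m_{w_{k-1}})\cdots(T m_{w_{k-i+2}})\,1$ for $1\le i\le k+1$ (so $u_1^*=1$). Put $L_0^*f=f$ and $L_i^*=D_{k-i+1}^*\cdots D_k^*$, where $D_j^*f=f'/w_j$. For points $p_0\le\dots\le p_k$ in $I$, let $d_r$ be the number of $l<r$ with $p_l=p_r$, and let $$[p_0,\dots,p_k]f=\frac{\det\big(L^*_{d_r}F_c(p_r)\big)_{r,c=0}^k}{\det\big(L^*_{d_r}u^*_{c+1}(p_r)\big)_{r,c=0}^k},\qquad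 F_c=u^*_{c+1}\ (c<k),\quad F_k=f.$$ (When the weights are smooth enough, $L^*_{d}$ may be replaced here by the ordinary derivative of order $d$.) With $g_k(x,y)=\mathbf 1_{x\ge y}\,(m_{w_1}T_y)\cdots(m_{w_{k-1}}T_y)w_k(x)$, the B-splines are $$M_j(x)=(-1)^k[t_j,\dots,t_{j+k}]\,g_k(x,\cdot),\qquad a<x<b,\quad 0\le j\le n,$$ extended continuously to $a$ and $b$. *The splines $\sigma$ and $\varphi$.* Let $D_jf=(f/w_j)'$ for $2\le j\le k+1$. Put $S_0f=f$, $S_i=D_{k+2-i}\cdots D_{k+1}$ for $1\le i\le k$, and $S_i=D_{i-k+1}\cdots D_2D_2\cdots D_{k+1}$ for $k+1\le i\le 2k-1$. Consider functions $\sigma$ on $I$ for which $\sigma,S_1\sigma,\dots,S_{2k-3}\sigma$ exist and are continuous on $I$, for which $S_{2k-1}\sigma$ exists and vanishes on each interval $(t_j,t_{j+1})$, $k-1\le j\le n$, and which satisfy 1. $D_3\cdots D_{k+1}\sigma(a)=1$; 2. $D_i\cdots D_{k+1}\sigma(a)=D_i\cdots D_{k+1}\sigma(b)=0$ for $i=4,\dots,k+1$;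 3. $\sigma(t_j)=0$ for $j=k-1,\dots,n+1$. **Theorem.** There are $\varepsilon,c>0$, depending only on the weights $w_1,\dots,w_k$ (and hence on $k$ and on their domain $[a,b]$), such that for every $n$ and every knot sequence $\Delta$ as above the following holds. There is exactly one function $\sigma$ on $I$ as described, and if $|\Delta|\le\varepsilon$, then the Chebyshev spline $\varphi=\frac{w_1}{w_2}S_{k-1}\sigma$ satisfies 1. the sign of $\langle\varphi,M_j\rangle$ alternates in $j$, i.e. $\langle\varphi,M_j\rangle\,\langle\varphi,M_{j+1}\rangle<0$ for $0\le j<n$; 2. $|\langle\varphi,M_j\rangle|\ge c$ for all $0\le j\le n$. -/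

import Mathlib

open Set Filter Topology MeasureTheory

noncomputable section

namespace ChebSpline

/-- Admissible weights `w 1, …, w k` on `[a, b]`: positive, with `w i` of class `C^(k-i+1)`.
Only the values `w i x` with `1 ≤ i ≤ k` and `x ∈ [a, b]` matter. -/
structure IsWeights (k : ℕ) (a b : ℝ) (w : ℕ → ℝ → ℝ) : Prop where
  pos : ∀ i, 1 ≤ i → i ≤ k → ∀ x ∈ Icc a b, 0 < w i x
  smooth : ∀ i, 1 ≤ i → i ≤ k → ContDiffOn ℝ ((k - i + 1 : ℕ)) (w i) (Icc a b)

/-- A knot sequence `a = t 0 = ⋯ = t (k-1) < t k < ⋯ < t n < t (n+1) = ⋯ = t (n+k) = b`. -/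
structure IsKnots (k n : ℕ) (a b : ℝ) (t : ℕ → ℝ) : Prop where
  le : k ≤ n + 1
  left : ∀ i, i < k → t i = a
  strict : ∀ i, k ≤ i + 1 → i ≤ n → t i < t (i + 1)
  right : ∀ i, n + 1 ≤ i → i ≤ n + k → t i = b

/-- The maximal grid size `|Δ| = max_{0 ≤ i ≤ n} (t (i+1) - t i)`. -/
def mesh (n : ℕ) (t : ℕ → ℝ) : ℝ :=
  (Finset.range (n + 1)).sup' Finset.nonempty_range_add_one fun i => t (i + 1) - t i

/-! ### The dual system, divided differences and B-splines -/

/-- `dualInt w a p i = (T m_{w_p}) (T m_{w_{p-1}}) ⋯ (T m_{w_{p-i+1}}) 1` (`i` factors), where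
`T f x = ∫ s in a..x, f s`. -/
def dualInt (w : ℕ → ℝ → ℝ) (a : ℝ) : ℕ → ℕ → ℝ → ℝ
  | _, 0 => fun _ => 1
  | p, i + 1 => fun x => ∫ s in a..x, w p s * dualInt w a (p - 1) i s

/-- The dual canonical system `u*_i = (∏_{l=1}^{i-1} T m_{w_{k-l+1}}) 1`, `1 ≤ i ≤ k+1`. -/
def uStar (k : ℕ) (w : ℕ → ℝ → ℝ) (a : ℝ) (i : ℕ) : ℝ → ℝ :=
  dualInt w a k (i - 1)

/-- The operators `L*_0 f = f`, `L*_i = D*_{k-i+1} ⋯ D*_k` with `D*_j f = (D f) / w_j`, where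
derivatives are taken within `[a, b]` (one-sided at the end points). -/
def LStar (k : ℕ) (w : ℕ → ℝ → ℝ) (a b : ℝ) : ℕ → (ℝ → ℝ) → ℝ → ℝ
  | 0, f => f
  | i + 1, f => fun x => derivWithin (LStar k w a b i f) (Icc a b) x / w (k - i) x

/-- `hInt w y p j x = ((m_{w_p} T_y) ⋯ (m_{w_{p+j-1}} T_y) w_{p+j}) x`, with
`T_y f x = ∫ s in y..x, f s`. -/
def hInt (w : ℕ → ℝ → ℝ) (y : ℝ) : ℕ → ℕ → ℝ → ℝ
  | p, 0 => fun x => w p x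
  | p, j + 1 => fun x => w p x * ∫ s in y..x, hInt w y (p + 1) j s

/-- `g_j(x, y) = 1_{x ≥ y} h_j(x, y)` with `h_j(x, y) = (∏_{l=1}^{j-1} m_{w_l} T_y) w_j (x)`. -/
def gKer (w : ℕ → ℝ → ℝ) (j : ℕ) (x y : ℝ) : ℝ :=
  if y ≤ x then hInt w y 1 (j - 1) x else 0

/-- For a nondecreasing sequence `p 0 ≤ p 1 ≤ ⋯`, the number of earlier members equal to `p r`,
i.e. `max {j : p r = p (r-1) = ⋯ = p (r-j)}`. -/
def mult (p : ℕ → ℝ) (r : ℕ) : ℕ :=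
  ((Finset.range r).filter fun l => p l = p r).card

/-- The (confluent) collocation determinant `det (L*_{d_r} F_c (p_r))_{r,c = 0,…,k}`. -/
def colloc (k : ℕ) (w : ℕ → ℝ → ℝ) (a b : ℝ) (p : ℕ → ℝ) (F : ℕ → ℝ → ℝ) : ℝ :=
  Matrix.det (Matrix.of fun r c : Fin (k + 1) => LStar k w a b (mult p r) (F c) (p r))

/-- The divided difference `[p 0, …, p k]_{u*(w)} f`: the quotient of the determinants for
`u*_1, …, u*_k, f` and for `u*_1, …, u*_k, u*_{k+1}`. At coinciding points the derivatives are the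
`L*_d`; for weights smooth enough that ordinary derivatives of order `d` exist, using these
instead multiplies both determinants by the same nonzero factor. -/
def divDiff (k : ℕ) (w : ℕ → ℝ → ℝ) (a b : ℝ) (p : ℕ → ℝ) (f : ℝ → ℝ) : ℝ :=
  colloc k w a b p (fun c => if c = k then f else uStar k w a (c + 1)) /
    colloc k w a b p (fun c => uStar k w a (c + 1))

/-- The formula `(-1)^k [t_i, …, t_{i+k}]_{u*(w)} g_k(x, ·)`. -/
def bsplineRaw (k : ℕ) (w : ℕ → ℝ → ℝ) (a b : ℝ) (t : ℕ → ℝ) (i : ℕ) (x : ℝ) : ℝ :=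
  (-1) ^ k * divDiff k w a b (fun r => t (i + r)) (gKer w k x)

open Classical in
/-- The Chebyshevian B-spline `M_i`: given by the divided difference inside `(a, b)` and extended
continuously to the end points. -/
def bspline (k : ℕ) (w : ℕ → ℝ → ℝ) (a b : ℝ) (t : ℕ → ℝ) (i : ℕ) (x : ℝ) : ℝ :=
  if x ∈ Ioo a b then bsplineRaw k w a b t i x
  else extendFrom (Ioo a b) (bsplineRaw k w a b t i) x

/-! ### The splines `σ` and `φ` -/

/-- The weight divided out by the `i`-th operator, `1 ≤ i ≤ 2k-1`, of the chain
`D_{k+1}, D_k, …, D_2, D_2, …, D_k` (in the order of application), where `D_j f = D (f / w_j)` and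
`w_{k+1} = 1`: that is `1, w_k, …, w_2, w_2, …, w_k`. -/
def chainWeight (k : ℕ) (w : ℕ → ℝ → ℝ) (i : ℕ) : ℝ → ℝ :=
  if i ≤ 1 then fun _ => 1
  else if i ≤ k then w (k + 2 - i)
  else w (i - k + 1)

/-- `S_0 f = f`, `S_i = D_{k+2-i} ⋯ D_{k+1}` for `i ≤ k` and
`S_i = D_{i-k+1} ⋯ D_2 D_2 ⋯ D_{k+1}` for `k+1 ≤ i ≤ 2k-1`, with derivatives taken within
`[a, b]` (one-sided at the end points). -/
def SOp (k : ℕ) (w : ℕ → ℝ → ℝ) (a b : ℝ) : ℕ → (ℝ → ℝ) → ℝ → ℝ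
  | 0, f => f
  | i + 1, f => fun x =>
      derivWithin (fun y => SOp k w a b i f y / chainWeight k w (i + 1) y) (Icc a b) x

/-- `σ` is the Chebyshev spline on `[a, b]` with knots `t` for the operator
`S_{2k-1} = D_k ⋯ D_2 D_2 ⋯ D_{k+1}` that satisfies the boundary and interpolation conditions. -/
structure IsSigma (k n : ℕ) (w : ℕ → ℝ → ℝ) (a b : ℝ) (t : ℕ → ℝ) (σ : ℝ → ℝ) : Prop where
  /-- All the derivatives that enter `S_{2k-1} σ` exist inside the grid intervals. -/
  diff : ∀ j, k ≤ j + 1 → j ≤ n → ∀ i, i < 2 * k - 1 →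
    DifferentiableOn ℝ (fun y => SOp k w a b i σ y / chainWeight k w (i + 1) y)
      (Ioo (t j) (t (j + 1)))
  /-- `σ` lies in the kernel of `S_{2k-1}` inside the grid intervals. -/
  ker : ∀ j, k ≤ j + 1 → j ≤ n → ∀ x ∈ Ioo (t j) (t (j + 1)), SOp k w a b (2 * k - 1) σ x = 0
  /-- `σ, S_1 σ, …, S_{2k-3} σ` exist as functions on all of `[a, b]`. -/
  diff_glob : ∀ i, i < 2 * k - 3 →
    DifferentiableOn ℝ (fun y => SOp k w a b i σ y / chainWeight k w (i + 1) y) (Icc a b)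
  /-- `σ, S_1 σ, …, S_{2k-3} σ` are continuous on `[a, b]`. -/
  cont : ∀ i, i ≤ 2 * k - 3 → ContinuousOn (SOp k w a b i σ) (Icc a b)
  /-- `D_3 ⋯ D_{k+1} σ (a) = 1`. -/
  normalized : SOp k w a b (k - 1) σ a = 1
  /-- `D_i ⋯ D_{k+1} σ` vanishes at `a` and `b` for `i = 4, …, k+1`. -/
  boundary : ∀ i, 4 ≤ i → i ≤ k + 1 →
    SOp k w a b (k + 2 - i) σ a = 0 ∧ SOp k w a b (k + 2 - i) σ b = 0
  /-- `σ` vanishes at the grid points. -/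
  zero : ∀ j, k ≤ j + 1 → j ≤ n + 1 → σ (t j) = 0

/-- `φ = (w_1 / w_2) S_{k-1} σ`. -/
def phi (k : ℕ) (w : ℕ → ℝ → ℝ) (a b : ℝ) (σ : ℝ → ℝ) (x : ℝ) : ℝ :=
  w 1 x / w 2 x * SOp k w a b (k - 1) σ x

/-- The inner product of `L²[a, b]`. -/
def ip (a b : ℝ) (f g : ℝ → ℝ) : ℝ := ∫ x in a..b, f x * g x

end ChebSpline

end

/-!
The proof replaces repeated derivatives by chains of primitives. With `v i = S_i σ` divided by its
weight, `σ` is the bottom `v 0` of a chain in which `v i` is a primitive of `q i * v (i + 1)`, the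
top `v (2 k - 2)` being a step function; the integral form (`IsPrimitive`, `IsChain`) copes with
the jumps at the knots. The conditions on `σ` say that the chain is a null spline
(`IsNullSpline`) with a prescribed value of `v (k - 1)` at `a`.

*Zeros.* Rolle's theorem applied up the chain bounds the number of alternations of `v 1` in terms of
the number of pieces of the top member. The zeros at the knots enforce as many alternations as this
bound permits, so that a null spline which vanishes on no knot interval has one sign on each of
them, and this sign alternates (`IsNullSpline.exists_sign`). If moreover `v (k - 1)` vanished at
`a`, the bound would drop by one; hence such a null spline vanishes on some knot interval, and by
induction on the number of intervals everywhere (`IsNullSpline.eq_zero`). There are as many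
parameters as conditions, and existence follows from uniqueness by linear algebra
(`IsNullSpline.exists_of_value`).

*Size.* The weights `q` are symmetric, so that `∑ (-1) ^ i * v i * v (2 k - 2 - i)` has derivative
zero between the knots; at the knots `v 0` vanishes, and therefore the jumps of the top member do
not matter. This invariant equals `± v (k - 1) (a) ^ 2`, while a Markov inequality
(`IsChain.markov`) bounds it on each knot interval by the square of the integral of `|σ|`, up to a
power of the length `h`. So the integral of `|σ|` over a knot interval is at least a constant
times `h ^ k` (`exists_le_integral`), uniformly in the knots.

*B-splines.* The divided differences satisfy a recursion that mirrors the recursion of B-splines as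
differences of distribution functions, and `M_j` is `w 1 * bsp (k - 1) j` divided by its mass
(`bspline_eq`). The derivative of order `k - 1` of `bsp (k - 1) j` is a step function of
alternating sign. If the support has length at most `K`, then up to constants this derivative is at
least `K ^ (1 - k)`, and it dominates the lower derivatives by factors `K` (`bder_bounds`).

*Conclusion.* Integration by parts, `k - 1` times, turns `⟨φ, M_j⟩` into the integral of `σ` against
`w 1 ^ 2` times the derivative of order `k - 1`, plus terms with lower derivatives
(`exists_coeff_integral`). For fine knots these are negligible, so that the integrand, a product of
two functions with alternating signs on the same intervals, has one sign, which depends on the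
parity of `j` only. The longest knot interval in the support alone contributes a fixed amount: the
powers of the length cancel (`exists_le_ip`).
-/

open Set Filter Topology MeasureTheory

noncomputable section

namespace ChebSpline

/-! ### Primitives of integrable functions -/

/-- `f` is an absolutely continuous primitive of `g` on `[a, b]`. The integral form is used because
the top derivative of a spline is a step function, so that no pointwise derivative is available at
the knots. -/
structure IsPrimitive (a b : ℝ) (f g : ℝ → ℝ) : Prop where
  integrable : IntervalIntegrable g volume a b
  eq : ∀ x ∈ Icc a b, f x = f a + ∫ s in a..x, g s

namespace IsPrimitive

variable {a b c d : ℝ} {f g f' g' : ℝ → ℝ}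

theorem intervalIntegrable_sub (h : IsPrimitive a b f g) {x y : ℝ} (hx : x ∈ Icc a b)
    (hy : y ∈ Icc a b) : IntervalIntegrable g volume x y :=
  h.integrable.mono_set (uIcc_subset_uIcc (Icc_subset_uIcc hx) (Icc_subset_uIcc hy))

theorem integral_eq (h : IsPrimitive a b f g) {x y : ℝ} (hx : x ∈ Icc a b) (hy : y ∈ Icc a b) :
    ∫ s in x..y, g s = f y - f x := by
  have ha : a ∈ Icc a b := left_mem_Icc.2 (hx.1.trans hx.2)
  rw [h.eq x hx, h.eq y hy, ← intervalIntegral.integral_add_adjacent_intervals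
    (h.intervalIntegrable_sub ha hx) (h.intervalIntegrable_sub hx hy)]
  ring

theorem mono (h : IsPrimitive a b f g) (hac : a ≤ c) (hcd : c ≤ d) (hdb : d ≤ b) :
    IsPrimitive c d f g := by
  have hc : c ∈ Icc a b := ⟨hac, hcd.trans hdb⟩
  refine ⟨h.intervalIntegrable_sub hc ⟨hac.trans hcd, hdb⟩, fun x hx => ?_⟩
  rw [h.integral_eq hc ⟨hac.trans hx.1, hx.2.trans hdb⟩]
  ring

theorem continuousOn (h : IsPrimitive a b f g) : ContinuousOn f (Icc a b) := by
  rcases le_or_gt a b with hab | hab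
  · have := (intervalIntegral.continuousOn_primitive_interval' h.integrable left_mem_uIcc)
    rw [uIcc_of_le hab] at this
    exact (continuousOn_const.add this).congr h.eq
  · simp [Icc_eq_empty hab.not_ge]

theorem congr (h : IsPrimitive a b f g) (hab : a ≤ b) (hf : EqOn f' f (Icc a b))
    (hg : EqOn g' g (Ioo a b)) : IsPrimitive a b f' g' := by
  have key : ∀ x ∈ Icc a b, ∀ᵐ s, s ∈ uIoc a x → g s = g' s := by
    intro x hx
    have : ∀ᵐ s : ℝ, s ≠ b := by simp [ae_iff, measure_singleton]
    filter_upwards [this] with s hs hs'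
    rw [uIoc_of_le hx.1] at hs'
    exact (hg ⟨hs'.1, lt_of_le_of_ne (hs'.2.trans hx.2) hs⟩).symm
  refine ⟨h.integrable.congr_ae ?_, fun x hx => ?_⟩
  · exact (ae_restrict_iff' measurableSet_uIoc).2 (key b (right_mem_Icc.2 hab))
  · rw [hf hx, hf (left_mem_Icc.2 hab), h.eq x hx, intervalIntegral.integral_congr_ae (key x hx)]

theorem const_mul (h : IsPrimitive a b f g) (r : ℝ) :
    IsPrimitive a b (fun x => r * f x) (fun x => r * g x) := by
  refine ⟨h.integrable.const_mul r, fun x hx => ?_⟩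
  rw [intervalIntegral.integral_const_mul, h.eq x hx]
  ring

theorem add (h : IsPrimitive a b f g) (h' : IsPrimitive a b f' g') :
    IsPrimitive a b (fun x => f x + f' x) (fun x => g x + g' x) := by
  refine ⟨h.integrable.add h'.integrable, fun x hx => ?_⟩
  have ha : a ∈ Icc a b := left_mem_Icc.2 (hx.1.trans hx.2)
  rw [intervalIntegral.integral_add (h.intervalIntegrable_sub ha hx)
    (h'.intervalIntegrable_sub ha hx), h.eq x hx, h'.eq x hx]
  ring

theorem sub (h : IsPrimitive a b f g) (h' : IsPrimitive a b f' g') :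
    IsPrimitive a b (fun x => f x - f' x) (fun x => g x - g' x) := by
  have := h.add (h'.const_mul (-1))
  simpa [sub_eq_add_neg] using this

theorem zero : IsPrimitive a b (fun _ => 0) (fun _ => 0) := ⟨by simp, by simp⟩

theorem const (r : ℝ) : IsPrimitive a b (fun _ => r) (fun _ => 0) := ⟨by simp, by simp⟩

theorem sum {ι : Type*} {s : Finset ι} {F G : ι → ℝ → ℝ}
    (h : ∀ i ∈ s, IsPrimitive a b (F i) (G i)) :
    IsPrimitive a b (fun x => ∑ i ∈ s, F i x) (fun x => ∑ i ∈ s, G i x) := by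
  classical
  induction s using Finset.induction_on with
  | empty => simpa using zero
  | insert i s his ih =>
    simp only [Finset.sum_insert his]
    exact (h i (Finset.mem_insert_self i s)).add
      (ih fun j hj => h j (Finset.mem_insert_of_mem hj))

theorem integral (hg : IntervalIntegrable g volume a b) (α : ℝ) :
    IsPrimitive a b (fun x => α + ∫ s in a..x, g s) g :=
  ⟨hg, fun x _ => by simp⟩

theorem of_hasDerivAt (hf : ContinuousOn f (Icc a b))
    (hd : ∀ x ∈ Ioo a b, HasDerivAt f (g x) x) (hg : IntervalIntegrable g volume a b) :
    IsPrimitive a b f g := by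
  refine ⟨hg, fun x hx => ?_⟩
  rw [intervalIntegral.integral_eq_sub_of_hasDerivAt_of_le hx.1
    (hf.mono (Icc_subset_Icc_right hx.2)) (fun y hy => hd y ⟨hy.1, hy.2.trans_le hx.2⟩)
    (hg.mono_set ?_)]
  · ring
  · exact uIcc_subset_uIcc left_mem_uIcc (Icc_subset_uIcc hx)

theorem of_differentiableOn (hab : a < b) (hf : DifferentiableOn ℝ f (Icc a b))
    (hg : ContinuousOn (derivWithin f (Icc a b)) (Icc a b)) :
    IsPrimitive a b f (derivWithin f (Icc a b)) := by
  refine of_hasDerivAt hf.continuousOn (fun x hx => ?_) (hg.intervalIntegrable_of_Icc hab.le)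
  exact (hf x (Ioo_subset_Icc_self hx)).hasDerivWithinAt.hasDerivAt (Icc_mem_nhds hx.1 hx.2)

theorem hasDerivWithinAt (h : IsPrimitive a b f g) (hg : ContinuousOn g (Icc a b)) {x : ℝ}
    (hx : x ∈ Icc a b) : HasDerivWithinAt f (g x) (Icc a b) x := by
  have : Fact (x ∈ Icc a b) := ⟨hx⟩
  have ha : a ∈ Icc a b := left_mem_Icc.2 (hx.1.trans hx.2)
  have h1 : HasDerivWithinAt (fun u => ∫ s in a..u, g s) (g x) (Icc a b) x :=
    intervalIntegral.integral_hasDerivWithinAt_right (h.intervalIntegrable_sub ha hx)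
      (hg.stronglyMeasurableAtFilter_nhdsWithin measurableSet_Icc x) (hg x hx)
  exact (h1.const_add (f a)).congr h.eq (h.eq x hx)

theorem hasDerivAt (h : IsPrimitive a b f g) (hg : ContinuousOn g (Ioo a b)) {x : ℝ}
    (hx : x ∈ Ioo a b) : HasDerivAt f (g x) x := by
  obtain ⟨c, hc, hcx⟩ := exists_between hx.1
  obtain ⟨d, hxd, hd⟩ := exists_between hx.2
  exact ((h.mono hc.le (hcx.trans hxd).le hd.le).hasDerivWithinAt
    (hg.mono fun y hy => ⟨hc.trans_le hy.1, hy.2.trans_lt hd⟩) ⟨hcx.le, hxd.le⟩).hasDerivAt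
    (Icc_mem_nhds hcx hxd)

/-- The product rule for absolutely continuous functions; the factors `g` and `g'` need only be
integrable. -/
theorem mul (h : IsPrimitive a b f g) (h' : IsPrimitive a b f' g') (hab : a ≤ b) :
    IsPrimitive a b (fun x => f x * f' x) (fun x => g x * f' x + f x * g' x) := by
  have huIcc : uIcc a b = Icc a b := uIcc_of_le hab
  have ha : a ∈ Icc a b := left_mem_Icc.2 hab
  refine ⟨(h.integrable.mul_continuousOn (huIcc ▸ h'.continuousOn)).add
    (h'.integrable.continuousOn_mul (huIcc ▸ h.continuousOn)), fun x hx => ?_⟩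
  have hux : uIcc a x = Icc a x := uIcc_of_le hx.1
  have hsub : ∀ y ∈ Icc a x, y ∈ Icc a b := fun y hy => ⟨hy.1, hy.2.trans hx.2⟩
  have i1 := h.intervalIntegrable_sub ha hx
  have i2 := h'.intervalIntegrable_sub ha hx
  set F : ℝ → ℝ := fun x => f a + ∫ s in a..x, g s with hF
  set F' : ℝ → ℝ := fun x => f' a + ∫ s in a..x, g' s with hF'
  have acF : AbsolutelyContinuousOnInterval F a x :=
    (LipschitzOnWith.absolutelyContinuousOnInterval (K := 0)
      (LipschitzOnWith.of_dist_le_mul (by simp))).fun_add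
      (i1.absolutelyContinuousOnInterval_intervalIntegral left_mem_uIcc)
  have acF' : AbsolutelyContinuousOnInterval F' a x :=
    (LipschitzOnWith.absolutelyContinuousOnInterval (K := 0)
      (LipschitzOnWith.of_dist_le_mul (by simp))).fun_add
      (i2.absolutelyContinuousOnInterval_intervalIntegral left_mem_uIcc)
  have key := acF.integral_deriv_mul_eq_sub acF'
  have e : ∫ s in a..x, (deriv F s * F' s + F s * deriv F' s)
      = ∫ s in a..x, (g s * f' s + f s * g' s) := by
    apply intervalIntegral.integral_congr_ae
    filter_upwards [i1.ae_hasDerivAt_integral, i2.ae_hasDerivAt_integral] with s h1 h2 hs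
    have hs' : s ∈ uIcc a x := uIoc_subset_uIcc hs
    have e1 : deriv F s = g s := ((h1 hs' a left_mem_uIcc).const_add _).deriv
    have e2 : deriv F' s = g' s := ((h2 hs' a left_mem_uIcc).const_add _).deriv
    rw [hux] at hs'
    have e3 : F s = f s := (h.eq s (hsub s hs')).symm
    have e4 : F' s = f' s := (h'.eq s (hsub s hs')).symm
    rw [e1, e2, e3, e4]
  rw [← e, key]
  simp only [hF, hF', ← h.eq x hx, ← h'.eq x hx, intervalIntegral.integral_same]
  ring

end IsPrimitive

section

/-! ### Alternating values and Rolle's theorem -/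

/-- `Alt g a M c s`: there are `M` points in `(a, c)` at which `g` takes values of alternating
strict sign, the sign at the last point being that of `s`. -/
def Alt (g : ℝ → ℝ) (a : ℝ) : ℕ → ℝ → ℝ → Prop
  | 0, c, _ => a < c
  | M + 1, c, s => ∃ x < c, 0 < s * g x ∧ Alt g a M x (-s)

namespace Alt

variable {f g q : ℝ → ℝ} {a b c d s : ℝ} {M : ℕ}

theorem lt : ∀ {M : ℕ} {c s : ℝ}, Alt g a M c s → a < c
  | 0, _, _, h => h
  | _ + 1, _, _, ⟨_, hx, _, h⟩ => h.lt.trans hx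

theorem mono (h : Alt g a M c s) (hcd : c ≤ d) : Alt g a M d s := by
  cases M with
  | zero => exact lt_of_lt_of_le h hcd
  | succ M =>
    obtain ⟨x, hx, h1, h2⟩ := h
    exact ⟨x, hx.trans_le hcd, h1, h2⟩

theorem drop : ∀ {M : ℕ} {c s : ℝ}, Alt g a (M + 1) c s → Alt g a M c s
  | 0, _, _, h => h.lt
  | _ + 1, _, _, ⟨x, hx, h1, h2⟩ => ⟨x, hx, h1, h2.drop⟩

end Alt

variable {f g q : ℝ → ℝ} {a b c s : ℝ} {M : ℕ}

/-- A primitive that increases strictly has a positive derivative somewhere; no continuity of the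
derivative is needed. -/
theorem IsPrimitive.exists_pos (h : IsPrimitive a b f (fun x => q x * g x)) (hq : ∀ x, 0 < q x)
    {x y : ℝ} (hx : a ≤ x) (hxy : x < y) (hy : y ≤ b) (hs : 0 < s * (f y - f x)) :
    ∃ z ∈ Ioo x y, 0 < s * g z := by
  by_contra! hcon
  have hx' : x ∈ Icc a b := ⟨hx, hxy.le.trans hy⟩
  have hy' : y ∈ Icc a b := ⟨hx.trans hxy.le, hy⟩
  rw [← h.integral_eq hx' hy'] at hs
  have : ∫ z in x..y, s * (q z * g z) ≤ ∫ z in x..y, (0 : ℝ) := by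
    refine intervalIntegral.integral_mono_on_of_le_Ioo hxy.le
      ((h.intervalIntegrable_sub hx' hy').const_mul s) (by simp) fun z hz => ?_
    nlinarith [hcon z hz, hq z]
  rw [intervalIntegral.integral_const_mul] at this
  simp at this
  linarith

namespace Alt

/-- Rolle's theorem for alternating values. The number `z` is `1` only if `f` vanishes at the left
end point, which saves one alternation. -/
theorem rolle_aux (h : IsPrimitive a b f (fun x => q x * g x)) (hq : ∀ x, 0 < q x) {z : ℕ}
    (hz : z = 0 ∨ z = 1 ∧ f a = 0) : ∀ {M : ℕ} {x s : ℝ}, x ≤ b → 0 < s * f x →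
    Alt f a M x (-s) → Alt g a (M + z) x s
  | 0, x, s, hxb, hs, hA => by
    rcases hz with rfl | ⟨rfl, hfa⟩
    · exact hA
    · obtain ⟨y, hy, hy'⟩ := h.exists_pos hq le_rfl hA.lt hxb (s := s) (by simpa [hfa] using hs)
      exact ⟨y, hy.2, hy', hy.1⟩
  | M + 1, x, s, hxb, hs, ⟨x', hx', hs', hA⟩ => by
    have ih := rolle_aux h hq hz (hx'.le.trans hxb) hs' hA
    obtain ⟨y, hy, hy'⟩ := h.exists_pos hq hA.lt.le hx' hxb (s := s) (by linarith)
    rw [show M + 1 + z = (M + z) + 1 by ring]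
    exact ⟨y, hy.2, hy', ih.mono hy.1.le⟩

theorem rolle (h : IsPrimitive a b f (fun x => q x * g x)) (hq : ∀ x, 0 < q x) {z : ℕ}
    (hz : z = 0 ∨ z = 1 ∧ f a = 0) (hA : Alt f a (M + 1) b s) : Alt g a (M + z) b s := by
  obtain ⟨x, hx, hs, hA⟩ := hA
  exact (rolle_aux h hq hz hx.le hs hA).mono hx.le

/-- Rolle's theorem for alternating values of a function that vanishes at the right end point. -/
theorem rolle_right (h : IsPrimitive a b f (fun x => q x * g x)) (hq : ∀ x, 0 < q x) {z : ℕ}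
    (hz : z = 0 ∨ z = 1 ∧ f a = 0) (hb : f b = 0) (hA : Alt f a (M + 1) b s) :
    Alt g a (M + z + 1) b (-s) := by
  obtain ⟨x, hx, hs, hA⟩ := hA
  obtain ⟨y, hy, hy'⟩ := h.exists_pos hq hA.lt.le hx le_rfl (s := -s) (by rw [hb]; linarith)
  exact ⟨y, hy.2, hy', by simpa using (rolle_aux h hq hz hx.le hs hA).mono hy.1.le⟩

/-- If `g` has weakly constant sign on each of the intervals `[t m, t (m + 1))`, `lo ≤ m ≤ hi`, and
vanishes elsewhere, then successive alternation points lie in different intervals. -/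
theorem exists_index {t : ℕ → ℝ} {lo hi : ℕ}
    (ht : ∀ i j, lo ≤ i → i ≤ j → j ≤ hi + 1 → t i ≤ t j)
    (hcov : ∀ x, a < x → x < b → g x ≠ 0 → ∃ m, lo ≤ m ∧ m ≤ hi ∧ x ∈ Ico (t m) (t (m + 1)))
    (hsgn : ∀ m, lo ≤ m → m ≤ hi → ∀ x ∈ Ico (t m) (t (m + 1)), ∀ y ∈ Ico (t m) (t (m + 1)),
      a < x → y < b → 0 ≤ g x * g y) :
    ∀ {M : ℕ} {c s : ℝ}, c ≤ b → Alt g a (M + 1) c s →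
      ∃ m, lo + M ≤ m ∧ m ≤ hi ∧ ∃ x ∈ Ico (t m) (t (m + 1)), a < x ∧ x < c ∧ 0 < s * g x
  | 0, c, s, hcb, ⟨x, hx, hs, hA⟩ => by
    obtain ⟨m, h1, h2, h3⟩ := hcov x hA.lt (hx.trans_le hcb) (by rintro h; simp [h] at hs)
    exact ⟨m, h1, h2, x, h3, hA.lt, hx, hs⟩
  | M + 1, c, s, hcb, ⟨x, hx, hs, hA⟩ => by
    obtain ⟨m', h1', h2', x', h3', hax', hx', hs'⟩ :=
      exists_index ht hcov hsgn (hx.le.trans hcb) hA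
    obtain ⟨m, h1, h2, h3⟩ := hcov x hA.lt (hx.trans_le hcb) (by rintro h; simp [h] at hs)
    refine ⟨m, ?_, h2, x, h3, hA.lt, hx, hs⟩
    have hle : m' ≤ m := by
      by_contra! hlt
      have := ht (m + 1) m' (by omega) hlt (by omega)
      linarith [h3.2, h3'.1]
    have hne : m' ≠ m := by
      rintro rfl
      have h0 := hsgn m' (by omega) h2 x' h3' x h3 hax' (hx.trans_le hcb)
      have := mul_pos hs hs'
      have hs2 : 0 ≤ s ^ 2 := sq_nonneg s
      nlinarith
    omega

end Alt

/-! ### Chains of derivatives and an inequality of Markov type -/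

/-- `v 0, …, v T` is a chain of derivatives with respect to the weights `q`: `v i` is a primitive
of `q i * v (i + 1)` for `i < T`. -/
def IsChain (T : ℕ) (q : ℕ → ℝ → ℝ) (a b : ℝ) (v : ℕ → ℝ → ℝ) : Prop :=
  ∀ i < T, IsPrimitive a b (v i) (fun x => q i x * v (i + 1) x)

/-- Weights bounded above and below by positive constants. -/
structure IsBoundedWeights (m M : ℝ) (q : ℕ → ℝ → ℝ) : Prop where
  m_pos : 0 < m
  lower : ∀ i x, m ≤ q i x
  upper : ∀ i x, q i x ≤ M
  cont : ∀ i, Continuous (q i)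

theorem IsBoundedWeights.pos {m M : ℝ} {q : ℕ → ℝ → ℝ} (h : IsBoundedWeights m M q) (i : ℕ)
    (x : ℝ) : 0 < q i x := h.m_pos.trans_le (h.lower i x)

variable {T : ℕ} {m M : ℝ} {Q v : ℕ → ℝ → ℝ} {D : ℝ}

theorem IsChain.mono {c d : ℝ} (h : IsChain T Q a b v) (hac : a ≤ c) (hcd : c ≤ d) (hdb : d ≤ b) :
    IsChain T Q c d v := fun i hi => (h i hi).mono hac hcd hdb

theorem IsChain.continuousOn_Ioo (h : IsChain T Q a b v) (hD : ∀ x ∈ Ioo a b, v T x = D) {i : ℕ}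
    (hi : i ≤ T) : ContinuousOn (v i) (Ioo a b) := by
  rcases hi.lt_or_eq with hi | rfl
  · exact (h i hi).continuousOn.mono Ioo_subset_Icc_self
  · exact continuousOn_const.congr hD

theorem IsChain.hasDerivAt (hQ : ∀ i, Continuous (Q i)) (h : IsChain T Q a b v)
    (hD : ∀ x ∈ Ioo a b, v T x = D) {i : ℕ} (hi : i < T) {x : ℝ} (hx : x ∈ Ioo a b) :
    HasDerivAt (v i) (Q i x * v (i + 1) x) x :=
  (h i hi).hasDerivAt ((hQ i).continuousOn.mul (h.continuousOn_Ioo hD hi)) hx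

/-- In every subinterval each member of the chain is small somewhere: by the mean value theorem
between two points where the previous member is small. -/
theorem IsChain.exists_small (T : ℕ) (hT : 0 < T) (m : ℝ) (hm : 0 < m) (i : ℕ) : ∃ C : ℝ, 0 < C ∧
    ∀ (M D c d : ℝ) (q v : ℕ → ℝ → ℝ), IsBoundedWeights m M q → IsChain T q c d v →
      (∀ x ∈ Ioo c d, v T x = D) → i ≤ T → ∀ c' d', c ≤ c' → c' < d' → d' ≤ d →
        ∃ z ∈ Ioo c' d', |v i z| * (d' - c') ^ (i + 1) ≤ C * ∫ x in c..d, |v 0 x| := by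
  induction i with
  | zero =>
    refine ⟨1, one_pos, fun M D c d q v hq hv hD _ c' d' hc hcd hd => ?_⟩
    have hcont : ContinuousOn (fun x => |v 0 x|) (Icc c d) := (hv 0 hT).continuousOn.abs
    have hint : IntervalIntegrable (fun x => |v 0 x|) volume c d :=
      hcont.intervalIntegrable_of_Icc (hc.trans (hcd.le.trans hd))
    have hsub : IntervalIntegrable (fun x => |v 0 x|) volume c' d' :=
      (hcont.mono (Icc_subset_Icc hc hd)).intervalIntegrable_of_Icc hcd.le
    have h1 : ∫ x in c'..d', |v 0 x| ≤ ∫ x in c..d, |v 0 x| :=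
      intervalIntegral.integral_mono_interval hc hcd.le hd (by filter_upwards; simp) hint
    have hP := IsPrimitive.integral hsub 0
    obtain ⟨z, hz, hz'⟩ := exists_hasDerivAt_eq_slope _ _ hcd hP.continuousOn
      (fun x hx => hP.hasDerivAt (hcont.mono fun y hy =>
        ⟨hc.trans hy.1.le, hy.2.le.trans hd⟩) hx)
    refine ⟨z, hz, ?_⟩
    rw [eq_div_iff (by linarith)] at hz'
    simp only [zero_add, intervalIntegral.integral_same, sub_zero] at hz'
    rw [zero_add, pow_one, hz']
    linarith
  | succ i ih =>
    obtain ⟨C, hC, H⟩ := ih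
    refine ⟨2 * C * 3 ^ (i + 2) / m, by positivity,
      fun M D c d q v hq hv hD hi c' d' hc hcd hd => ?_⟩
    -- the previous member is small at a point of each of the two outer thirds
    obtain ⟨z₁, hz₁, h1⟩ := H M D c d q v hq hv hD (by omega) c' (c' + (d' - c') / 3) hc
      (by linarith) (by linarith)
    obtain ⟨z₂, hz₂, h2⟩ := H M D c d q v hq hv hD (by omega) (d' - (d' - c') / 3) d'
      (by linarith) (by linarith) hd
    have h12 : z₁ < z₂ := by linarith [hz₁.2, hz₂.1]
    obtain ⟨z, hz, hz'⟩ := exists_hasDerivAt_eq_slope (v i) (fun x => q i x * v (i + 1) x) h12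
      ((hv i (by omega)).continuousOn.mono
        (Icc_subset_Icc (hc.trans hz₁.1.le) (hz₂.2.le.trans hd)))
      (fun x hx => hv.hasDerivAt hq.cont hD (by omega)
        ⟨(hc.trans_lt hz₁.1).trans hx.1, (hx.2.trans hz₂.2).trans_le hd⟩)
    refine ⟨z, ⟨hz₁.1.trans hz.1, hz.2.trans hz₂.2⟩, ?_⟩
    set A := ∫ x in c..d, |v 0 x|
    set l := (d' - c') / 3 with hl
    have hlpos : 0 < l := by rw [hl]; linarith
    have e1 : c' + l - c' = l := by ring
    have e2 : d' - (d' - l) = l := by ring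
    have e3 : d' - c' = 3 * l := by rw [hl]; ring
    rw [e1] at h1
    rw [e2] at h2
    rw [e3]
    rw [eq_div_iff (by linarith : z₂ - z₁ ≠ 0)] at hz'
    have hgap : l ≤ z₂ - z₁ := by linarith [hz₁.2, hz₂.1]
    have hb : m * |v (i + 1) z| * l ≤ |v i z₁| + |v i z₂| := by
      calc m * |v (i + 1) z| * l ≤ q i z * |v (i + 1) z| * (z₂ - z₁) := by
            gcongr
            · exact mul_nonneg (hq.pos i z).le (abs_nonneg _)
            · exact hq.lower i z
        _ = |q i z * v (i + 1) z * (z₂ - z₁)| := by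
            rw [abs_mul, abs_mul, abs_of_pos (hq.pos i z), abs_of_pos (by linarith : 0 < z₂ - z₁)]
        _ = |v i z₂ - v i z₁| := by rw [hz']
        _ ≤ |v i z₁| + |v i z₂| := by
            rw [add_comm]; exact abs_sub _ _
    have hb2 : m * |v (i + 1) z| * l * l ^ (i + 1) ≤ 2 * C * A := by
      calc _ ≤ (|v i z₁| + |v i z₂|) * l ^ (i + 1) := by gcongr
        _ ≤ _ := by linarith
    calc |v (i + 1) z| * (3 * l) ^ (i + 1 + 1)
        = 3 ^ (i + 2) / m * (m * |v (i + 1) z| * l * l ^ (i + 1)) := by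
          rw [show (3 * l) ^ (i + 1 + 1) = 3 ^ (i + 2) * (l * l ^ (i + 1)) by
            rw [mul_pow, ← pow_succ']]
          field_simp
      _ ≤ 3 ^ (i + 2) / m * (2 * C * A) := by gcongr
      _ = _ := by ring

/-- A Markov inequality: on an interval on which the top member of a chain is constant, all members
are controlled by the `L¹` norm of the lowest one. -/
theorem IsChain.markov (T : ℕ) (hT : 0 < T) (m M : ℝ) (hm : 0 < m) (hM : 0 < M) :
    ∃ C : ℝ, 0 < C ∧
      ∀ (D c d : ℝ) (q v : ℕ → ℝ → ℝ), c < d → IsBoundedWeights m M q → IsChain T q c d v →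
        (∀ x ∈ Ioo c d, v T x = D) → ∀ i ≤ T, ∀ x ∈ Ioo c d,
          |v i x| * (d - c) ^ (i + 1) ≤ C * ∫ x in c..d, |v 0 x| := by
  -- downward induction from the constant top member: `v i` is small at one point, and its
  -- derivative has been bounded before
  have key : ∀ j : ℕ, ∃ C : ℝ, 0 < C ∧
      ∀ (D c d : ℝ) (q v : ℕ → ℝ → ℝ), c < d → IsBoundedWeights m M q → IsChain T q c d v →
        (∀ x ∈ Ioo c d, v T x = D) → ∀ i, i + j = T → ∀ x ∈ Ioo c d,
          |v i x| * (d - c) ^ (i + 1) ≤ C * ∫ x in c..d, |v 0 x| := by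
    intro j
    induction j with
    | zero =>
      obtain ⟨C, hC, H⟩ := exists_small T hT m hm T
      refine ⟨C, hC, fun D c d q v hcd hq hv hD i hi x hx => ?_⟩
      obtain ⟨z, hz, h⟩ := H M D c d q v hq hv hD le_rfl c d le_rfl hcd le_rfl
      obtain rfl : i = T := by omega
      rwa [hD x hx, ← hD z hz]
    | succ j ih =>
      obtain ⟨C, hC, H⟩ := ih
      obtain ⟨C', hC', H'⟩ := exists_small T hT m hm (T - (j + 1))
      refine ⟨C' + M * C, by positivity, fun D c d q v hcd hq hv hD i hi x hx => ?_⟩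
      obtain rfl : i = T - (j + 1) := by omega
      set i := T - (j + 1)
      obtain ⟨z, hz, h⟩ := H' M D c d q v hq hv hD (by omega) c d le_rfl hcd le_rfl
      set A := ∫ x in c..d, |v 0 x|
      have hl : 0 < d - c := by linarith
      have hbound : ∀ y ∈ Ioo c d,
          ‖q i y * v (i + 1) y‖ ≤ M * (C * A / (d - c) ^ (i + 2)) := fun y hy => by
        have := H D c d q v hcd hq hv hD (i + 1) (by omega) y hy
        rw [norm_mul, Real.norm_eq_abs, Real.norm_eq_abs, abs_of_pos (hq.pos i y)]
        gcongr
        · exact hq.upper i y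
        · rw [le_div_iff₀ (by positivity)]
          exact this
      have hmv := (convex_Ioo c d).norm_image_sub_le_of_norm_hasDerivWithin_le
        (f := v i) (fun y hy => (hv.hasDerivAt hq.cont hD (by omega) hy).hasDerivWithinAt)
        hbound hz hx
      rw [Real.norm_eq_abs, Real.norm_eq_abs] at hmv
      have hxz : |x - z| ≤ d - c := by
        rw [abs_le]; constructor <;> linarith [hx.1, hx.2, hz.1, hz.2]
      have hA : 0 ≤ A := intervalIntegral.integral_nonneg hcd.le fun _ _ => abs_nonneg _
      have h3 : |v i x| ≤ |v i z| + M * (C * A / (d - c) ^ (i + 2)) * (d - c) := by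
        calc |v i x| ≤ |v i z| + |v i x - v i z| := by
              have := abs_add_le (v i z) (v i x - v i z); simpa using this
          _ ≤ |v i z| + M * (C * A / (d - c) ^ (i + 2)) * |x - z| := by gcongr
          _ ≤ _ := by gcongr
      calc |v i x| * (d - c) ^ (i + 1)
          ≤ (|v i z| + M * (C * A / (d - c) ^ (i + 2)) * (d - c)) * (d - c) ^ (i + 1) := by gcongr
        _ = |v i z| * (d - c) ^ (i + 1) + M * C * A := by
            have : (d - c) ^ (i + 2) = (d - c) * (d - c) ^ (i + 1) := by ring
            rw [this]; field_simp
        _ ≤ C' * A + M * C * A := by gcongr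
        _ = _ := by ring
  choose C hC H using key
  refine ⟨∑ j ∈ Finset.range (T + 1), C j,
    Finset.sum_pos (fun j _ => hC j) ⟨0, by simp⟩, fun D c d q v hcd hq hv hD i hi x hx => ?_⟩
  have hA : 0 ≤ ∫ x in c..d, |v 0 x| :=
    intervalIntegral.integral_nonneg hcd.le fun _ _ => abs_nonneg _
  refine (H (T - i) D c d q v hcd hq hv hD i (by omega) x hx).trans ?_
  gcongr
  exact Finset.single_le_sum (f := C) (fun j _ => (hC j).le) (by simp)

end

/-! ### Knot sequences -/

namespace IsKnots

variable {k n : ℕ} {a b : ℝ} {t : ℕ → ℝ}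

theorem mono_succ (h : IsKnots k n a b t) {i : ℕ} (hi : i < n + k) : t i ≤ t (i + 1) := by
  by_cases h1 : k ≤ i + 1
  · by_cases h2 : i ≤ n
    · exact (h.strict i h1 h2).le
    · rw [h.right i (by omega) (by omega), h.right (i + 1) (by omega) (by omega)]
  · rw [h.left i (by omega), h.left (i + 1) (by omega)]

theorem mono (h : IsKnots k n a b t) {i j : ℕ} (hij : i ≤ j) (hj : j ≤ n + k) : t i ≤ t j := by
  induction j, hij using Nat.le_induction with
  | base => exact le_rfl
  | succ j hij ih => exact (ih (by omega)).trans (h.mono_succ (by omega))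

theorem lt (h : IsKnots k n a b t) {i j : ℕ} (hij : i < j) (hj : j ≤ n + k) (hkj : k ≤ j)
    (hin : i ≤ n) : t i < t j := by
  have hl : t i ≤ t (max i (k - 1)) := h.mono (le_max_left _ _) (by have := h.le; omega)
  have hr : t (max i (k - 1) + 1) ≤ t j := h.mono (by omega) hj
  exact (hl.trans_lt (h.strict _ (by omega) (by have := h.le; omega))).trans_le hr

theorem ge_left (h : IsKnots k n a b t) (hk : 0 < k) {i : ℕ} (hi : i ≤ n + k) : a ≤ t i := by
  rw [← h.left 0 hk]; exact h.mono (by omega) hi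

theorem le_right (h : IsKnots k n a b t) (hk : 0 < k) {i : ℕ} (hi : i ≤ n + k) : t i ≤ b := by
  rw [← h.right (n + k) (by omega) le_rfl]; exact h.mono hi le_rfl

/-- The intervals `[t m, t (m + 1))`, `k - 1 ≤ m ≤ n`, cover `[a, b)`. -/
theorem exists_mem_Ico (h : IsKnots k n a b t) (hk : 0 < k) {x : ℝ} (ha : a ≤ x) (hb : x < b) :
    ∃ m, k ≤ m + 1 ∧ m ≤ n ∧ x ∈ Ico (t m) (t (m + 1)) := by
  classical
  have hex : ∃ i, x < t (i + 1) := ⟨n, by rwa [h.right (n + 1) (by omega) (by omega)]⟩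
  have hn : Nat.find hex ≤ n :=
    Nat.find_min' hex (by rwa [h.right (n + 1) (by omega) (by omega)])
  have hs := Nat.find_spec hex
  refine ⟨Nat.find hex, ?_, hn, ?_, hs⟩
  · by_contra hcon
    rw [h.left _ (by omega)] at hs
    linarith
  · rcases Nat.eq_zero_or_pos (Nat.find hex) with h0 | h0
    · rw [h0, h.left 0 hk]; exact ha
    · have := Nat.find_min hex (m := Nat.find hex - 1) (by omega)
      rw [Nat.sub_add_cancel h0] at this
      exact not_lt.1 this

end IsKnots

/-! ### B-splines as differences of distribution functions -/

/-- The distribution functions of the normalized B-splines. The B-spline of order `s + 1` with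
knots `t j, …, t (j + s + 1)` is the difference `bcdf s j - bcdf s (j + 1)`, and `bcdf (s + 1) j`
is its primitive with respect to the weight `W (k - s)`, divided by the total mass. If all knots
involved coincide with `a` or all with `b`, the B-spline is read as a point mass at `a` or `b`. -/
def bcdf (k n : ℕ) (a b : ℝ) (W : ℕ → ℝ → ℝ) (t : ℕ → ℝ) : ℕ → ℕ → ℝ → ℝ
  | 0, j => fun x => if t j ≤ x then 1 else 0
  | s + 1, j => fun x =>
      if k ≤ j + s + 1 ∧ j ≤ n then
        (∫ y in a..x, W (k - s) y * (bcdf k n a b W t s j y - bcdf k n a b W t s (j + 1) y)) /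
          ∫ y in a..b, W (k - s) y * (bcdf k n a b W t s j y - bcdf k n a b W t s (j + 1) y)
      else if j + s + 1 < k then 1 else 0

/-- The B-spline of order `s + 1` with knots `t j, …, t (j + s + 1)`, scaled to form a partition
of unity. -/
def bsp (k n : ℕ) (a b : ℝ) (W : ℕ → ℝ → ℝ) (t : ℕ → ℝ) (s j : ℕ) (x : ℝ) : ℝ :=
  bcdf k n a b W t s j x - bcdf k n a b W t s (j + 1) x

/-- The mass of a B-spline with respect to the next weight. -/
def bmass (k n : ℕ) (a b : ℝ) (W : ℕ → ℝ → ℝ) (t : ℕ → ℝ) (s j : ℕ) : ℝ :=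
  ∫ y in a..b, W (k - s) y * bsp k n a b W t s j y

/-- The `r`-th derivative of the B-spline `bsp s j`, with respect to the weights
`W (k + 1 - s), W (k + 2 - s), …`. -/
def bder (k n : ℕ) (a b : ℝ) (W : ℕ → ℝ → ℝ) (t : ℕ → ℝ) : ℕ → ℕ → ℕ → ℝ → ℝ
  | 0, s, j => bsp k n a b W t s j
  | _ + 1, 0, _ => fun _ => 0
  | r + 1, s + 1, j => fun x =>
      (if k ≤ j + s + 1 ∧ j ≤ n then bder k n a b W t r s j x / bmass k n a b W t s j else 0) -
      (if k ≤ j + 1 + s + 1 ∧ j + 1 ≤ n then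
        bder k n a b W t r s (j + 1) x / bmass k n a b W t s (j + 1) else 0)

/-- All B-splines of order at most `s` that do not degenerate to a point mass have positive mass. -/
def MassPos (k n : ℕ) (a b : ℝ) (W : ℕ → ℝ → ℝ) (t : ℕ → ℝ) (s : ℕ) : Prop :=
  ∀ i j, i < s → j + i + 1 ≤ n + k → k ≤ j + i + 1 → j ≤ n → 0 < bmass k n a b W t i j

theorem MassPos.mono {k n : ℕ} {a b : ℝ} {W : ℕ → ℝ → ℝ} {t : ℕ → ℝ} {s s' : ℕ}
    (h : MassPos k n a b W t s) (hs : s' ≤ s) : MassPos k n a b W t s' :=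
  fun i j hi => h i j (by omega)

section BSpline

variable {k n : ℕ} {a b : ℝ} {W : ℕ → ℝ → ℝ} {t : ℕ → ℝ} {s j r i : ℕ} {x m M L : ℝ}

local notation "cdf" => bcdf k n a b W t
local notation "bs" => bsp k n a b W t
local notation "mass" => bmass k n a b W t
local notation "der" => bder k n a b W t

theorem bcdf_succ (h : k ≤ j + s + 1 ∧ j ≤ n) (x : ℝ) :
    cdf (s + 1) j x = (∫ y in a..x, W (k - s) y * bs s j y) / mass s j := if_pos h

theorem bcdf_succ_of_not (h : ¬(k ≤ j + s + 1 ∧ j ≤ n)) (x : ℝ) :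
    cdf (s + 1) j x = if j + s + 1 < k then 1 else 0 := if_neg h

theorem bcdf_succ_left (h : j + s + 1 < k) (x : ℝ) : cdf (s + 1) j x = 1 := by
  rw [bcdf_succ_of_not (by omega), if_pos h]

theorem bcdf_succ_right (h : n < j) (h' : k ≤ j + s + 1) (x : ℝ) : cdf (s + 1) j x = 0 := by
  rw [bcdf_succ_of_not (by omega), if_neg (by omega)]

theorem bder_succ (r s j : ℕ) (x : ℝ) : der (r + 1) (s + 1) j x =
    (if k ≤ j + s + 1 ∧ j ≤ n then der r s j x / mass s j else 0) -
    (if k ≤ j + 1 + s + 1 ∧ j + 1 ≤ n then der r s (j + 1) x / mass s (j + 1) else 0) := rfl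

theorem intervalIntegrable_bcdf (hW : ∀ i, Continuous (W i)) (s j : ℕ) :
    IntervalIntegrable (cdf s j) volume a b := by
  induction s generalizing j with
  | zero =>
    refine Monotone.intervalIntegrable fun x y hxy => ?_
    simp only [bcdf]
    split_ifs with h1 h2 <;> first | exact absurd (h1.trans hxy) h2 | norm_num
  | succ s ih =>
    by_cases h : k ≤ j + s + 1 ∧ j ≤ n
    · have hi : IntervalIntegrable (fun y => W (k - s) y * bs s j y) volume a b :=
        ((ih j).sub (ih (j + 1))).continuousOn_mul (hW _).continuousOn
      have hc := intervalIntegral.continuousOn_primitive_interval' hi left_mem_uIcc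
      have : cdf (s + 1) j = fun x => (∫ y in a..x, W (k - s) y * bs s j y) / mass s j :=
        funext fun x => bcdf_succ h x
      rw [this]
      exact (hc.div_const _).intervalIntegrable
    · have : cdf (s + 1) j = fun _ => if j + s + 1 < k then 1 else 0 := by
        exact funext (bcdf_succ_of_not h)
      rw [this]
      exact intervalIntegrable_const

theorem intervalIntegrable_bsp (hW : ∀ i, Continuous (W i)) (s j : ℕ) :
    IntervalIntegrable (bs s j) volume a b :=
  (intervalIntegrable_bcdf hW s j).sub (intervalIntegrable_bcdf hW s (j + 1))

theorem isPrimitive_bcdf (hW : ∀ i, Continuous (W i)) (s j : ℕ) :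
    IsPrimitive a b (cdf (s + 1) j) (fun y => W (k - s) y *
      if k ≤ j + s + 1 ∧ j ≤ n then bs s j y / mass s j else 0) := by
  by_cases h : k ≤ j + s + 1 ∧ j ≤ n
  · have hi : IntervalIntegrable (fun y => W (k - s) y * bs s j y) volume a b :=
      (intervalIntegrable_bsp hW s j).continuousOn_mul (hW _).continuousOn
    have := (IsPrimitive.integral hi 0).const_mul (mass s j)⁻¹
    convert this using 1
    · funext x; rw [bcdf_succ h, zero_add, div_eq_inv_mul]
    · funext x; rw [if_pos h]; ring
  · have : cdf (s + 1) j = fun _ => if j + s + 1 < k then 1 else 0 := by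
      exact funext (bcdf_succ_of_not h)
    rw [this]
    simpa [h] using IsPrimitive.const _

theorem isPrimitive_bder (hW : ∀ i, Continuous (W i)) (hrs : r < s) (hs : s ≤ k) (j : ℕ) :
    IsPrimitive a b (der r s j) (fun x => W (k + 1 + r - s) x * der (r + 1) s j x) := by
  induction r generalizing s j with
  | zero =>
    obtain ⟨s, rfl⟩ : ∃ s', s = s' + 1 := ⟨s - 1, by omega⟩
    have key := (isPrimitive_bcdf (k := k) (n := n) (a := a) (b := b) (t := t) hW s j).sub
      (isPrimitive_bcdf (k := k) (n := n) (t := t) hW s (j + 1))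
    simp only [← mul_sub] at key
    rw [show k + 1 + 0 - (s + 1) = k - s by omega]
    exact key
  | succ r ih =>
    obtain ⟨s, rfl⟩ : ∃ s', s = s' + 1 := ⟨s - 1, by omega⟩
    have key : ∀ j, IsPrimitive a b
        (fun x => if k ≤ j + s + 1 ∧ j ≤ n then der r s j x / mass s j else 0)
        (fun x => W (k + 1 + r - s) x *
          if k ≤ j + s + 1 ∧ j ≤ n then der (r + 1) s j x / mass s j else 0) := by
      intro j
      split_ifs with h
      · convert (ih (s := s) (by omega) (by omega) j).const_mul (mass s j)⁻¹ using 1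
        · funext x; rw [div_eq_inv_mul]
        · funext x; ring
      · simpa using IsPrimitive.zero
    have key' := (key j).sub (key (j + 1))
    simp only [← mul_sub] at key'
    rw [show k + 1 + (r + 1) - (s + 1) = k + 1 + r - s by omega]
    exact key'

/-- A distribution function is `0` to the left and `1` to the right of its knots. -/
theorem bcdf_eq_zero_and_eq_one (ht : IsKnots k n a b t) (hk : 0 < k) (s : ℕ) :
    ∀ j, (∀ x, a ≤ x → j ≤ n + k → x < t j → cdf s j x = 0) ∧
      (MassPos k n a b W t s →
        ∀ x, a ≤ x → x < b → j + s ≤ n + k → t (j + s) ≤ x → cdf s j x = 1) := by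
  induction s with
  | zero =>
    refine fun j => ⟨fun x _ _ hx => ?_, fun _ x _ _ _ hx => ?_⟩
    · simp [bcdf, hx]
    · simpa [bcdf] using hx
  | succ s ih =>
    refine fun j => ⟨fun x hax hj hx => ?_, fun hmass x hax hxb hj hx => ?_⟩
    · by_cases h : k ≤ j + s + 1 ∧ j ≤ n
      · rw [bcdf_succ h, intervalIntegral.integral_congr (g := fun _ => 0)]
        · simp
        · intro y hy
          rw [uIcc_of_le hax] at hy
          have h1 := (ih j).1 y hy.1 hj (hy.2.trans_lt hx)
          have h2 := (ih (j + 1)).1 y hy.1 (by omega)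
            ((hy.2.trans_lt hx).trans_le (ht.mono_succ (by omega)))
          simp [bsp, h1, h2]
      · refine bcdf_succ_right (by_contra fun hn => ?_) (by_contra fun hn => ?_) x
        · rw [ht.left j (by omega)] at hx; linarith
        · rw [ht.left j (by omega)] at hx; linarith
    · by_cases h : k ≤ j + s + 1 ∧ j ≤ n
      · have hz := (hmass s j (by omega) hj h.1 h.2).ne'
        rw [bcdf_succ h, div_eq_one_iff_eq hz, bmass]
        by_cases hi : IntervalIntegrable (fun y => W (k - s) y * bs s j y) volume a b
        · have hP := IsPrimitive.integral hi 0
          have e := hP.integral_eq (x := x) (y := b) ⟨hax, hxb.le⟩ ⟨hax.trans hxb.le, le_rfl⟩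
          have e0 : ∫ y in x..b, W (k - s) y * bs s j y = 0 := by
            rw [intervalIntegral.integral_of_le hxb.le, integral_Ioc_eq_integral_Ioo]
            refine setIntegral_eq_zero_of_forall_eq_zero fun y hy => ?_
            have hm : MassPos k n a b W t s := hmass.mono (by omega)
            have h1 := (ih j).2 hm y (hax.trans hy.1.le) hy.2 (by omega)
              (((ht.mono_succ (i := j + s) (by omega)).trans hx).trans hy.1.le)
            have h2 := (ih (j + 1)).2 hm y (hax.trans hy.1.le) hy.2 (by omega)
              (by rw [show j + 1 + s = j + (s + 1) by ring]; exact hx.trans hy.1.le)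
            simp [bsp, h1, h2]
          rw [e0] at e
          linarith
        -- a non-integrable function would have the integral `0`, against the positive mass
        · exact absurd (intervalIntegral.integral_undef hi) hz
      · refine bcdf_succ_left (by_contra fun hn => ?_) x
        rw [ht.right (j + (s + 1)) (by omega) hj] at hx
        linarith

theorem bder_eq_zero (ht : IsKnots k n a b t) (hk : 0 < k) (hs : MassPos k n a b W t s)
    (hj : j + s + 1 ≤ n + k) {p : ℕ} (hpn : p ≤ n)
    (hx : x ∈ Ico (t p) (t (p + 1))) (hpj : p < j ∨ j + s < p) (r : ℕ) : der r s j x = 0 := by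
  have hax : a ≤ x := (ht.ge_left hk (by omega)).trans hx.1
  have hxb : x < b := hx.2.trans_le (ht.le_right hk (by omega))
  induction r generalizing s j with
  | zero =>
    rw [bder, bsp]
    have H := fun j => bcdf_eq_zero_and_eq_one (W := W) ht hk s j
    rcases hpj with h | h
    · have h1 := hx.2.trans_le (ht.mono (j := j) (by omega) (by omega))
      rw [(H j).1 x hax (by omega) h1, (H (j + 1)).1 x hax (by omega)
        (h1.trans_le (ht.mono_succ (by omega))), sub_zero]
    · have h1 := (ht.mono (i := j + s + 1) (j := p) (by omega) (by omega)).trans hx.1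
      rw [(H j).2 hs x hax hxb (by omega) ((ht.mono_succ (i := j + s) (by omega)).trans h1),
        (H (j + 1)).2 hs x hax hxb (by omega)
        (by rw [show j + 1 + s = j + s + 1 by ring]; exact h1), sub_self]
  | succ r ih =>
    cases s with
    | zero => rfl
    | succ s =>
      rw [bder_succ, ih (s := s) (j := j) (hs.mono (by omega)) (by omega) (by omega),
        ih (s := s) (j := j + 1) (hs.mono (by omega)) (by omega) (by omega)]
      simp

/-- Derivatives of a B-spline vanish at `a` up to the order that the multiplicity of the knot `a`
permits. -/
theorem bder_left_eq_zero (hrs : r < s) (hj : k + r ≤ s + j) : der r s j a = 0 := by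
  induction r generalizing s j with
  | zero =>
    obtain ⟨s, rfl⟩ : ∃ s', s = s' + 1 := ⟨s - 1, by omega⟩
    have key : ∀ j, k ≤ j + s + 1 → cdf (s + 1) j a = 0 := by
      intro j hj
      by_cases h : j ≤ n
      · rw [bcdf_succ ⟨hj, h⟩, intervalIntegral.integral_same, zero_div]
      · exact bcdf_succ_right (by omega) hj a
    rw [bder, bsp, key j (by omega), key (j + 1) (by omega), sub_zero]
  | succ r ih =>
    obtain ⟨s, rfl⟩ : ∃ s', s = s' + 1 := ⟨s - 1, by omega⟩
    rw [bder_succ, ih (s := s) (j := j) (by omega) (by omega),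
      ih (s := s) (j := j + 1) (by omega) (by omega)]
    simp

theorem bder_right_eq_zero (hs : MassPos k n a b W t s) (hjs : j + s + 1 ≤ n + k) (hrs : r < s)
    (hj : r + j < n) : der r s j b = 0 := by
  induction r generalizing s j with
  | zero =>
    obtain ⟨s, rfl⟩ : ∃ s', s = s' + 1 := ⟨s - 1, by omega⟩
    have key : ∀ j, j ≤ n → j + s + 1 ≤ n + k → cdf (s + 1) j b = 1 := by
      intro j hj hjs
      by_cases h : k ≤ j + s + 1
      · rw [bcdf_succ ⟨h, hj⟩]
        exact div_self (hs s j (by omega) (by omega) h hj).ne'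
      · exact bcdf_succ_left (by omega) b
    rw [bder, bsp, key j (by omega) (by omega), key (j + 1) (by omega) (by omega), sub_self]
  | succ r ih =>
    obtain ⟨s, rfl⟩ : ∃ s', s = s' + 1 := ⟨s - 1, by omega⟩
    rw [bder_succ, ih (s := s) (j := j) (hs.mono (by omega)) (by omega) (by omega) (by omega),
      ih (s := s) (j := j + 1) (hs.mono (by omega)) (by omega) (by omega) (by omega)]
    simp

theorem bsp_zero (ht : IsKnots k n a b t) (hj : j + 1 ≤ n + k) (x : ℝ) :
    bs 0 j x = if x ∈ Ico (t j) (t (j + 1)) then 1 else 0 := by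
  have := ht.mono_succ (i := j) (by omega)
  simp only [bsp, bcdf, mem_Ico]
  split_ifs <;> grind

/-- The top derivative of a B-spline is constant between the knots. -/
theorem exists_bder_top_eq (ht : IsKnots k n a b t) (hj : j + s + 1 ≤ n + k) {p : ℕ}
    (hpn : p ≤ n) : ∃ D, ∀ x ∈ Ico (t p) (t (p + 1)), der s s j x = D := by
  induction s generalizing j with
  | zero =>
    refine ⟨if p = j then 1 else 0, fun x hx => ?_⟩
    rw [bder, bsp_zero ht (by omega)]
    by_cases h : p = j
    · subst h; rw [if_pos hx, if_pos rfl]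
    · rw [if_neg h, if_neg]
      intro hx'
      rcases Nat.lt_or_gt_of_ne h with h | h
      · have := ht.mono (i := p + 1) (j := j) (by omega) (by omega)
        linarith [hx.2, hx'.1]
      · have := ht.mono (i := j + 1) (j := p) (by omega) (by omega)
        linarith [hx.1, hx'.2]
  | succ s ih =>
    obtain ⟨D₁, h₁⟩ := ih (j := j) (by omega)
    obtain ⟨D₂, h₂⟩ := ih (j := j + 1) (by omega)
    exact ⟨_, fun x hx => by rw [bder_succ, h₁ x hx, h₂ x hx]⟩

/-- The top derivative of a B-spline alternates in sign from one knot interval to the next. -/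
theorem bder_top_sign (ht : IsKnots k n a b t) (hs : MassPos k n a b W t s)
    (hj : j + s + 1 ≤ n + k) {p : ℕ} (hpn : p ≤ n)
    (hx : x ∈ Ico (t p) (t (p + 1))) : 0 ≤ (-1) ^ (p + j) * der s s j x := by
  induction s generalizing j with
  | zero =>
    rw [bder, bsp_zero ht (by omega)]
    split_ifs with h
    · have : p = j := by
        by_contra hne
        rcases Nat.lt_or_gt_of_ne hne with h' | h'
        · have := ht.mono (i := p + 1) (j := j) (by omega) (by omega)
          linarith [hx.2, h.1]
        · have := ht.mono (i := j + 1) (j := p) (by omega) (by omega)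
          linarith [hx.1, h.2]
      subst this
      simp [← two_mul]
    · simp
  | succ s ih =>
    have h1 := ih (j := j) (hs.mono (by omega)) (by omega)
    have h2 := ih (j := j + 1) (hs.mono (by omega)) (by omega)
    rw [bder_succ, mul_sub]
    refine add_nonneg ?_ ?_
    · split_ifs with h
      · rw [mul_div_assoc']
        exact div_nonneg h1 (hs s j (by omega) (by omega) h.1 h.2).le
      · simp
    · split_ifs with h
      · rw [← neg_mul, mul_div_assoc', ← mul_neg_one, ← pow_succ]
        exact div_nonneg h2 (hs s (j + 1) (by omega) (by omega) h.1 h.2).le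
      · simp

/-- The two terms of the recursion for the top derivative have opposite signs, and therefore do not
cancel in the difference. -/
theorem abs_bder_top_succ (ht : IsKnots k n a b t) (hs : MassPos k n a b W t (s + 1))
    (hj : j + s + 2 ≤ n + k) {p : ℕ} (hpn : p ≤ n)
    (hx : x ∈ Ico (t p) (t (p + 1))) :
    |der (s + 1) (s + 1) j x| =
      (if k ≤ j + s + 1 ∧ j ≤ n then |der s s j x| / mass s j else 0) +
      (if k ≤ j + 1 + s + 1 ∧ j + 1 ≤ n then |der s s (j + 1) x| / mass s (j + 1) else 0) := by
  have h1 := bder_top_sign (j := j) ht (hs.mono (s' := s) (by omega)) (by omega) hpn hx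
  have h2 := bder_top_sign (j := j + 1) ht (hs.mono (s' := s) (by omega)) (by omega) hpn hx
  rw [← add_assoc, pow_succ, mul_neg_one, neg_mul] at h2
  have habs : ∀ y : ℝ, |y| = |(-1) ^ (p + j) * y| := fun y => by
    rw [abs_mul, abs_neg_one_pow, one_mul]
  rw [bder_succ, habs (_ - _), habs (der s s j x), habs (der s s (j + 1) x), abs_of_nonneg h1,
    abs_of_nonpos (by linarith : (-1) ^ (p + j) * der s s (j + 1) x ≤ 0), abs_of_nonneg]
  · split_ifs <;> ring
  · have := bder_top_sign (j := j) ht hs (by omega) hpn hx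
    rwa [bder_succ] at this

theorem bder_top_ne_zero (ht : IsKnots k n a b t) (hs : MassPos k n a b W t s)
    (hj : j + s + 1 ≤ n + k) {p : ℕ} (hp : k ≤ p + 1) (hpn : p ≤ n)
    (hx : x ∈ Ico (t p) (t (p + 1))) (hjp : j ≤ p) (hpj : p ≤ j + s) :
    0 < |der s s j x| := by
  induction s generalizing j with
  | zero =>
    obtain rfl : p = j := by omega
    rw [bder, bsp_zero ht (by omega), if_pos hx]
    norm_num
  | succ s ih =>
    rw [abs_bder_top_succ ht hs (by omega) hpn hx]
    have hnn : ∀ j, j + s + 1 ≤ n + k →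
        0 ≤ if k ≤ j + s + 1 ∧ j ≤ n then |der s s j x| / mass s j else 0 := by
      intro j hj
      split_ifs with h
      · exact div_nonneg (abs_nonneg _) (hs s j (by omega) (by omega) h.1 h.2).le
      · exact le_rfl
    by_cases h : p ≤ j + s
    · refine add_pos_of_pos_of_nonneg ?_ (hnn (j + 1) (by omega))
      rw [if_pos ⟨by omega, by omega⟩]
      exact div_pos (ih (hs.mono (by omega)) (by omega) hjp h)
        (hs s j (by omega) (by omega) (by omega) (by omega))
    · refine add_pos_of_nonneg_of_pos (hnn j (by omega)) ?_
      rw [if_pos ⟨by omega, by omega⟩]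
      exact div_pos (ih (hs.mono (by omega)) (by omega) (by omega) (by omega))
        (hs s (j + 1) (by omega) (by omega) (by omega) (by omega))

/-- If `K` bounds the masses of the lower-order B-splines on the support of `bsp s j`, then the
derivatives of `bsp s j` are controlled, on each knot interval separately, by the value of the top
derivative on that interval. -/
theorem bder_bounds (ht : IsKnots k n a b t) (hs : MassPos k n a b W t s)
    (hj : j + s + 1 ≤ n + k) {K : ℝ} (hK0 : 0 ≤ K)
    (hK : ∀ i l, i < s → j ≤ l → l + i ≤ j + s → k ≤ l + i + 1 → l ≤ n → mass i l ≤ K)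
    (hle : ∀ i l, i ≤ s → l + i + 1 ≤ n + k → |bs i l x| ≤ 1) {p : ℕ} (hp : k ≤ p + 1)
    (hpn : p ≤ n) (hk : 0 < k) (hx : x ∈ Ico (t p) (t (p + 1))) (hjp : j ≤ p) (hpj : p ≤ j + s) :
    1 ≤ K ^ s * |der s s j x| ∧ ∀ r ≤ s, |der r s j x| ≤ K ^ (s - r) * |der s s j x| := by
  induction s generalizing j with
  | zero =>
    obtain rfl : p = j := by omega
    have : der 0 0 p x = 1 := by rw [bder, bsp_zero ht (by omega), if_pos hx]
    refine ⟨by simp [this], fun r hr => ?_⟩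
    obtain rfl : r = 0 := by omega
    simp
  | succ s ih =>
    have hs' : MassPos k n a b W t s := hs.mono (by omega)
    have IH := fun l (h1 : j ≤ l) (h2 : l ≤ j + 1) =>
      ih (j := l) hs' (by omega) (fun i l' hi h3 h4 => hK i l' (by omega) (by omega) (by omega))
        (fun i l hi => hle i l (by omega))
    have hpos : ∀ l, j ≤ l → l ≤ j + 1 → k ≤ l + s + 1 ∧ l ≤ n → 0 < mass s l := fun l h1 h2 h =>
      hs s l (by omega) (by omega) h.1 h.2
    have hKl : ∀ l, j ≤ l → l ≤ j + 1 → k ≤ l + s + 1 ∧ l ≤ n → mass s l ≤ K := fun l h1 h2 h =>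
      hK s l (by omega) h1 (by omega) h.1 h.2
    set A : ℕ → ℝ := fun l => if k ≤ l + s + 1 ∧ l ≤ n then |der s s l x| / mass s l else 0 with hA
    have hA0 : ∀ l, j ≤ l → l ≤ j + 1 → 0 ≤ A l := by
      intro l h1 h2
      simp only [hA]
      split_ifs with h
      · exact div_nonneg (abs_nonneg _) (hpos l h1 h2 h).le
      · exact le_rfl
    have htop : |der (s + 1) (s + 1) j x| = A j + A (j + 1) :=
      abs_bder_top_succ ht hs (by omega) hpn hx
    have hone : ∀ l, j ≤ l → l ≤ j + 1 → l ≤ p → p ≤ l + s → 1 ≤ K ^ (s + 1) * A l := by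
      intro l h1 h2 h3 h4
      have hc : k ≤ l + s + 1 ∧ l ≤ n := ⟨by omega, by omega⟩
      have h5 := (IH l h1 h2 h3 h4).1
      have h6 := hpos l h1 h2 hc
      simp only [hA, if_pos hc]
      rw [pow_succ, mul_div_assoc', le_div_iff₀ h6]
      calc 1 * mass s l ≤ (K ^ s * |der s s l x|) * K :=
            mul_le_mul h5 (hKl l h1 h2 hc) h6.le (zero_le_one.trans h5)
        _ = _ := by ring
    have h1 : 1 ≤ K ^ (s + 1) * |der (s + 1) (s + 1) j x| := by
      rw [htop, mul_add]
      have e1 := mul_nonneg (pow_nonneg hK0 (s + 1)) (hA0 j le_rfl (by omega))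
      have e2 := mul_nonneg (pow_nonneg hK0 (s + 1)) (hA0 (j + 1) (by omega) le_rfl)
      by_cases h : p ≤ j + s
      · linarith [hone j le_rfl (by omega) hjp h]
      · linarith [hone (j + 1) (by omega) le_rfl (by omega) (by omega)]
    refine ⟨h1, fun r hr => ?_⟩
    cases r with
    | zero => exact (hle (s + 1) j le_rfl hj).trans h1
    | succ r =>
      have hterm : ∀ l, j ≤ l → l ≤ j + 1 →
          |if k ≤ l + s + 1 ∧ l ≤ n then der r s l x / mass s l else 0| ≤ K ^ (s - r) * A l := by
        intro l h1 h2
        by_cases hc : k ≤ l + s + 1 ∧ l ≤ n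
        · have h6 := hpos l h1 h2 hc
          simp only [hA, if_pos hc]
          rw [abs_div, abs_of_pos h6, mul_div_assoc']
          gcongr
          by_cases hl : l ≤ p ∧ p ≤ l + s
          · exact (IH l h1 h2 hl.1 hl.2).2 r (by omega)
          · rw [bder_eq_zero ht hk hs' (by omega) hpn hx (by omega) r, abs_zero]
            positivity
        · simp [hA, if_neg hc]
      rw [bder_succ, htop, mul_add, show s + 1 - (r + 1) = s - r by omega]
      exact (abs_sub _ _).trans
        (add_le_add (hterm j le_rfl (by omega)) (hterm (j + 1) (by omega) le_rfl))

end BSpline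

theorem integral_eq_zero_of_Ioo {f : ℝ → ℝ} {c d : ℝ} (hcd : c ≤ d)
    (h : ∀ x ∈ Ioo c d, f x = 0) : ∫ x in c..d, f x = 0 := by
  rw [intervalIntegral.integral_of_le hcd, integral_Ioc_eq_integral_Ioo]
  exact setIntegral_eq_zero_of_forall_eq_zero h

theorem integral_eq_of_eq_zero_off {f : ℝ → ℝ} {a b c d : ℝ}
    (hf : IntervalIntegrable f volume a b) (hac : a ≤ c) (hcd : c ≤ d) (hdb : d ≤ b)
    (h₁ : ∀ x ∈ Ioo a c, f x = 0) (h₂ : ∀ x ∈ Ioo d b, f x = 0) :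
    ∫ x in a..b, f x = ∫ x in c..d, f x := by
  have hP := IsPrimitive.integral hf 0
  have ha : a ∈ Icc a b := ⟨le_rfl, hac.trans (hcd.trans hdb)⟩
  have hb : b ∈ Icc a b := ⟨hac.trans (hcd.trans hdb), le_rfl⟩
  have hc : c ∈ Icc a b := ⟨hac, hcd.trans hdb⟩
  have hd : d ∈ Icc a b := ⟨hac.trans hcd, hdb⟩
  have e1 := hP.integral_eq ha hc
  have e2 := hP.integral_eq hd hb
  have e3 := hP.integral_eq hc hd
  have e4 := hP.integral_eq ha hb
  have z1 := integral_eq_zero_of_Ioo hac h₁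
  have z2 := integral_eq_zero_of_Ioo hdb h₂
  simp only [zero_add, intervalIntegral.integral_same, sub_zero] at e1 e2 e3 e4
  linarith

section BSpline

variable {k n : ℕ} {a b : ℝ} {W : ℕ → ℝ → ℝ} {t : ℕ → ℝ} {s j r i : ℕ} {x m M L : ℝ}

local notation "cdf" => bcdf k n a b W t
local notation "bs" => bsp k n a b W t
local notation "mass" => bmass k n a b W t
local notation "der" => bder k n a b W t

theorem bder_eq_zero_off (ht : IsKnots k n a b t) (hk : 0 < k) (hs : MassPos k n a b W t s)
    (hj : j + s + 1 ≤ n + k) (hax : a ≤ x) (hxb : x < b) (hx : x ∉ Ico (t j) (t (j + s + 1)))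
    (r : ℕ) : der r s j x = 0 := by
  obtain ⟨p, hp, hpn, hxp⟩ := ht.exists_mem_Ico hk hax hxb
  refine bder_eq_zero ht hk hs hj hpn hxp ?_ r
  by_contra! hcon
  exact hx ⟨(ht.mono hcon.1 (by omega)).trans hxp.1,
    hxp.2.trans_le (ht.mono (by omega) (by omega))⟩

/-- B-splines are nonnegative: a negative value would, by Rolle's theorem applied to the successive
derivatives, force the top derivative to alternate on all knot intervals of the support with the
wrong sign. -/
theorem bsp_nonneg (ht : IsKnots k n a b t) (hk : 0 < k) (hW : ∀ i, Continuous (W i))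
    (hWpos : ∀ i x, 0 < W i x) (hsk : s ≤ k) (hs : MassPos k n a b W t s)
    (hj : j + s + 1 ≤ n + k) (h1 : k ≤ j + s + 1) (h2 : j ≤ n) (hax : a < x) (hxb : x < b) :
    0 ≤ bs s j x := by
  rcases Nat.eq_zero_or_pos s with rfl | hs0
  · rw [bsp_zero ht (by omega)]; split_ifs <;> norm_num
  by_contra! hneg
  have hkn := ht.le
  have hab : a < b := hax.trans hxb
  -- each step gains an alternation at `a` and one at `b` as long as the derivative vanishes there,
  -- and loses one to Rolle's theorem
  have key : ∀ r ≤ s, Alt (der r s j) a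
      ((min r (s + j + 1 - k) + min r (n - j) - r) + 1) b (-(-1) ^ min r (n - j)) := by
    intro r
    induction r with
    | zero => exact fun _ => ⟨x, hxb, by simpa [bder] using hneg, hax⟩
    | succ r ih =>
      intro hr
      have ih := ih (by omega)
      have hP := isPrimitive_bder (a := a) (b := b) (n := n) (t := t) hW (r := r) (s := s)
        (by omega) hsk j
      have hz : (if r < s + j + 1 - k then 1 else 0) = 0 ∨
          (if r < s + j + 1 - k then 1 else 0) = 1 ∧ der r s j a = 0 := by
        split_ifs with h
        · exact Or.inr ⟨rfl, bder_left_eq_zero (by omega) (by omega)⟩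
        · exact Or.inl rfl
      by_cases hb : r < n - j
      · have := ih.rolle_right hP (hWpos _) hz
          (bder_right_eq_zero hs hj (by omega) (by omega))
        rw [show min (r + 1) (n - j) = min r (n - j) + 1 by omega, pow_succ, mul_neg_one]
        convert this using 1
        split_ifs <;> omega
      · have := ih.rolle hP (hWpos _) hz
        rw [show min (r + 1) (n - j) = min r (n - j) by omega]
        convert this using 1
        split_ifs <;> omega
  obtain ⟨p, hp1, hp2, y, hy, hay, hyb, hsgn⟩ := Alt.exists_index (t := t) (lo := max j (k - 1))
    (hi := min (j + s) n) (b := b) (fun i j _ hij hj => ht.mono hij (by omega))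
    (fun x hax hxb hne => by
      obtain ⟨p, hp, hpn, hxp⟩ := ht.exists_mem_Ico hk hax.le hxb
      have : ¬(p < j ∨ j + s < p) := fun h => hne (bder_eq_zero ht hk hs hj hpn hxp h s)
      exact ⟨p, by omega, by omega, hxp⟩)
    (fun p hp1 hp2 x hx y hy _ _ => by
      obtain ⟨D, hD⟩ := exists_bder_top_eq (W := W) ht hj (p := p) (by omega)
      rw [hD x hx, hD y hy]
      exact mul_self_nonneg D) le_rfl (key s le_rfl)
  have hpar := bder_top_sign ht hs hj (p := p) (by omega) hy
  rw [show p + j = min s (n - j) + 2 * j by omega, pow_add, pow_mul, neg_one_sq, one_pow,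
    mul_one] at hpar
  linarith

/-- B-splines have positive mass: otherwise the Markov inequality would make the top derivative
vanish. -/
theorem bmass_pos (ht : IsKnots k n a b t) (hk : 0 < k) (hW : IsBoundedWeights m M W)
    (hsk : s ≤ k) (hs : MassPos k n a b W t s)
    (hj : j + s + 1 ≤ n + k) (h1 : k ≤ j + s + 1) (h2 : j ≤ n) : 0 < mass s j := by
  have hkn := ht.le
  set p := max j (k - 1) with hp
  have hlt : t p < t (p + 1) := ht.strict p (by omega) (by have := ht.le; omega)
  have hap : a ≤ t p := ht.ge_left hk (by have := ht.le; omega)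
  have hpb : t (p + 1) ≤ b := ht.le_right hk (by have := ht.le; omega)
  have hnn : ∀ x, a < x → x < b → 0 ≤ bs s j x := fun x =>
    bsp_nonneg ht hk hW.cont hW.pos hsk hs hj h1 h2
  have hint := intervalIntegrable_bsp (k := k) (n := n) (a := a) (b := b) (t := t) hW.cont s j
  have hWint : IntervalIntegrable (fun y => W (k - s) y * bs s j y) volume a b :=
    hint.continuousOn_mul (hW.cont _).continuousOn
  have hsub : uIcc (t p) (t (p + 1)) ⊆ uIcc a b := by
    rw [uIcc_of_le hlt.le, uIcc_of_le (hap.trans (hlt.le.trans hpb))]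
    exact Icc_subset_Icc hap hpb
  have hpos : 0 < ∫ x in t p..t (p + 1), |bs s j x| := by
    rcases Nat.eq_zero_or_pos s with rfl | hs0
    · have hpj : p = j := by omega
      have : ∫ x in t p..t (p + 1), |bs 0 j x| = ∫ x in t p..t (p + 1), 1 := by
        rw [intervalIntegral.integral_of_le hlt.le, intervalIntegral.integral_of_le hlt.le,
          integral_Ioc_eq_integral_Ioo, integral_Ioc_eq_integral_Ioo]
        refine setIntegral_congr_fun measurableSet_Ioo fun x hx => ?_
        simp only [bsp_zero ht (show j + 1 ≤ n + k by omega)]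
        rw [if_pos (hpj ▸ ⟨hx.1.le, hx.2⟩), abs_one]
      rw [this]
      simpa using hlt
    · obtain ⟨C, hC, H⟩ := IsChain.markov s hs0 m M hW.m_pos
        ((hW.pos 0 0).trans_le (hW.upper 0 0))
      obtain ⟨D, hD⟩ := exists_bder_top_eq (W := W) ht hj (p := p) (by omega)
      have hq : IsBoundedWeights m M (fun i => W (k + 1 + i - s)) :=
        ⟨hW.m_pos, fun i => hW.lower _, fun i => hW.upper _, fun i => hW.cont _⟩
      have hch : IsChain s (fun i => W (k + 1 + i - s)) a b (fun r => der r s j) :=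
        fun i hi => isPrimitive_bder hW.cont hi hsk j
      obtain ⟨y, hy⟩ := exists_between hlt
      have := H D _ _ _ _ hlt hq (hch.mono hap hlt.le hpb)
        (fun x hx => hD x ⟨hx.1.le, hx.2⟩) s le_rfl y hy
      have hne := bder_top_ne_zero (p := p) (x := y) ht hs hj (by omega) (by omega)
        ⟨hy.1.le, hy.2⟩ (by omega) (by omega)
      have h0 : 0 < |der s s j y| * (t (p + 1) - t p) ^ (s + 1) :=
        mul_pos hne (pow_pos (by linarith) _)
      exact pos_of_mul_pos_right (h0.trans_le this) hC.le
  calc 0 < m * ∫ x in t p..t (p + 1), |bs s j x| := mul_pos hW.m_pos hpos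
    _ = ∫ x in t p..t (p + 1), m * |bs s j x| := by rw [intervalIntegral.integral_const_mul]
    _ ≤ ∫ x in t p..t (p + 1), W (k - s) x * bs s j x := by
        refine intervalIntegral.integral_mono_on_of_le_Ioo hlt.le
          ((hint.mono_set hsub).abs.const_mul m) (hWint.mono_set hsub) fun x hx => ?_
        have := hnn x (hap.trans_lt hx.1) (hx.2.trans_le hpb)
        rw [abs_of_nonneg this]
        exact mul_le_mul_of_nonneg_right (hW.lower _ x) this
    _ ≤ mass s j := by
        refine intervalIntegral.integral_mono_interval hap hlt.le hpb ?_ hWint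
        rw [EventuallyLE, ae_restrict_iff' measurableSet_Ioc]
        have : ∀ᵐ s : ℝ, s ≠ b := by simp [ae_iff, measure_singleton]
        filter_upwards [this] with x hxb hx
        exact mul_nonneg (hW.pos _ x).le (hnn x hx.1 (lt_of_le_of_ne hx.2 hxb))

theorem massPos (ht : IsKnots k n a b t) (hk : 0 < k) (hW : IsBoundedWeights m M W) :
    MassPos k n a b W t (k + 1) := by
  have : ∀ s ≤ k + 1, MassPos k n a b W t s := by
    intro s
    induction s with
    | zero => intro _ i j hi; omega
    | succ s ih =>
      intro hs i j hi hj h1 h2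
      rcases Nat.lt_succ_iff_lt_or_eq.1 hi with h | rfl
      · exact ih (by omega) i j h hj h1 h2
      · exact bmass_pos ht hk hW (by omega) (ih (by omega)) hj h1 h2
  exact this _ le_rfl

theorem bcdf_mem (ht : IsKnots k n a b t) (hk : 0 < k) (hW : IsBoundedWeights m M W)
    (hsk : s ≤ k + 1) (hj : j + s ≤ n + k) (hx : x ∈ Icc a b) : cdf s j x ∈ Icc (0 : ℝ) 1 := by
  cases s with
  | zero => simp only [bcdf]; split_ifs <;> simp
  | succ s =>
    by_cases h : k ≤ j + s + 1 ∧ j ≤ n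
    · have hpos : 0 < mass s j := massPos ht hk hW s j (by omega) (by omega) h.1 h.2
      have hint : IntervalIntegrable (fun y => W (k - s) y * bs s j y) volume a b :=
        (intervalIntegrable_bsp hW.cont s j).continuousOn_mul (hW.cont _).continuousOn
      have hnn : ∀ᵐ y, y ∈ Ioc a b → 0 ≤ W (k - s) y * bs s j y := by
        have : ∀ᵐ s : ℝ, s ≠ b := by simp [ae_iff, measure_singleton]
        filter_upwards [this] with y hyb hy
        exact mul_nonneg (hW.pos _ y).le (bsp_nonneg ht hk hW.cont hW.pos (by omega)
          ((massPos ht hk hW).mono (by omega)) (by omega) h.1 h.2 hy.1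
          (lt_of_le_of_ne hy.2 hyb))
      rw [bcdf_succ h]
      refine ⟨div_nonneg ?_ hpos.le, (div_le_one hpos).2 ?_⟩
      · refine intervalIntegral.integral_nonneg_of_ae_restrict hx.1 ?_
        rw [EventuallyLE, ae_restrict_iff' measurableSet_Icc]
        have : ∀ᵐ s : ℝ, s ≠ a := by simp [ae_iff, measure_singleton]
        filter_upwards [hnn, this] with y hy hya hyx
        exact hy ⟨lt_of_le_of_ne hyx.1 (Ne.symm hya), hyx.2.trans hx.2⟩
      · refine intervalIntegral.integral_mono_interval le_rfl hx.1 hx.2 ?_ hint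
        rw [EventuallyLE, ae_restrict_iff' measurableSet_Ioc]
        exact hnn
    · rw [bcdf_succ_of_not h]; split_ifs <;> simp

theorem abs_bsp_le_one (ht : IsKnots k n a b t) (hk : 0 < k) (hW : IsBoundedWeights m M W)
    (hsk : s ≤ k + 1) (hj : j + s + 1 ≤ n + k) (hx : x ∈ Icc a b) : |bs s j x| ≤ 1 := by
  have h1 := bcdf_mem (j := j) ht hk hW hsk (by omega) hx
  have h2 := bcdf_mem (j := j + 1) ht hk hW hsk (by omega) hx
  rw [bsp, abs_le]
  constructor <;> linarith [h1.1, h1.2, h2.1, h2.2]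

/-- The mass of a B-spline is at most proportional to the length of its support. -/
theorem bmass_le (ht : IsKnots k n a b t) (hk : 0 < k) (hW : IsBoundedWeights m M W)
    (hsk : s ≤ k) (hj : j + s + 1 ≤ n + k) : mass s j ≤ M * (t (j + s + 1) - t j) := by
  have hint : IntervalIntegrable (fun y => W (k - s) y * bs s j y) volume a b :=
    (intervalIntegrable_bsp hW.cont s j).continuousOn_mul (hW.cont _).continuousOn
  have haj : a ≤ t j := ht.ge_left hk (by omega)
  have hjb : t (j + s + 1) ≤ b := ht.le_right hk (by omega)
  have hle : t j ≤ t (j + s + 1) := ht.mono (by omega) hj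
  have hzero : ∀ x, a ≤ x → x < b → x ∉ Ico (t j) (t (j + s + 1)) →
      W (k - s) x * bs s j x = 0 := fun x h1 h2 h3 => by
    have := bder_eq_zero_off ht hk ((massPos ht hk hW).mono (by omega)) hj h1 h2 h3 0
    rw [bder] at this
    rw [this, mul_zero]
  rw [bmass, integral_eq_of_eq_zero_off hint haj hle hjb
    (fun x hx => hzero x hx.1.le (hx.2.trans_le (hle.trans hjb)) fun h => by linarith [h.1, hx.2])
    (fun x hx => hzero x ((haj.trans hle).trans hx.1.le) hx.2 fun h => by linarith [h.2, hx.1])]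
  have hM : 0 < M := (hW.pos 0 0).trans_le (hW.upper 0 0)
  calc _ ≤ ∫ _ in t j..t (j + s + 1), M := by
        refine intervalIntegral.integral_mono_on hle (hint.mono_set ?_) (by simp) fun x hx => ?_
        · rw [uIcc_of_le hle, uIcc_of_le (haj.trans (hle.trans hjb))]
          exact Icc_subset_Icc haj hjb
        · have := abs_bsp_le_one ht hk hW (s := s) (by omega) hj
            (x := x) ⟨haj.trans hx.1, hx.2.trans hjb⟩
          calc W (k - s) x * bs s j x ≤ W (k - s) x * 1 :=
                mul_le_mul_of_nonneg_left ((le_abs_self _).trans this) (hW.pos _ x).le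
            _ ≤ M := by rw [mul_one]; exact hW.upper _ x
    _ = _ := by simp [mul_comm]

end BSpline

/-! ### Extended weights and the dual kernels -/

/-- The weights `w 1, …, w k`, extended from `[a, b]` to the real line by their values at the end
points; the irrelevant weights are replaced by `1`. -/
def extW (k : ℕ) (a b : ℝ) (w : ℕ → ℝ → ℝ) (i : ℕ) (x : ℝ) : ℝ :=
  if 1 ≤ i ∧ i ≤ k then w i (max a (min b x)) else 1

theorem extW_eq {k : ℕ} {a b : ℝ} {w : ℕ → ℝ → ℝ} {i : ℕ} (h1 : 1 ≤ i) (h2 : i ≤ k) {x : ℝ}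
    (hx : x ∈ Icc a b) : extW k a b w i x = w i x := by
  rw [extW, if_pos ⟨h1, h2⟩, min_eq_right hx.2, max_eq_right hx.1]

theorem exists_isBoundedWeights {k : ℕ} {a b : ℝ} (hab : a < b) {w : ℕ → ℝ → ℝ}
    (hw : IsWeights k a b w) : ∃ m M, IsBoundedWeights m M (extW k a b w) := by
  have hmem : ∀ x, max a (min b x) ∈ Icc a b := fun x =>
    ⟨le_max_left _ _, max_le hab.le (min_le_left _ _)⟩
  have hbd : ∀ i, ∃ m M, 0 < m ∧ ∀ x, m ≤ extW k a b w i x ∧ extW k a b w i x ≤ M := by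
    intro i
    by_cases h : 1 ≤ i ∧ i ≤ k
    · have hc : ContinuousOn (w i) (Icc a b) := (hw.smooth i h.1 h.2).continuousOn
      obtain ⟨y, hy, hmin⟩ := isCompact_Icc.exists_isMinOn (nonempty_Icc.2 hab.le) hc
      obtain ⟨z, hz, hmax⟩ := isCompact_Icc.exists_isMaxOn (nonempty_Icc.2 hab.le) hc
      refine ⟨w i y, w i z, hw.pos i h.1 h.2 y hy, fun x => ?_⟩
      rw [extW, if_pos h]
      exact ⟨hmin (hmem x), hmax (hmem x)⟩
    · exact ⟨1, 1, one_pos, fun x => by rw [extW, if_neg h]; simp⟩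
  choose m M hm hmM using hbd
  have hne : (Finset.range (k + 1)).Nonempty := Finset.nonempty_range_add_one
  have hred : ∀ i x, ∃ j ∈ Finset.range (k + 1), extW k a b w i x = extW k a b w j x := by
    intro i x
    by_cases h : i ≤ k
    · exact ⟨i, by simp; omega, rfl⟩
    · exact ⟨0, by simp, by simp [extW, h]⟩
  refine ⟨(Finset.range (k + 1)).inf' hne m, (Finset.range (k + 1)).sup' hne M,
    (Finset.lt_inf'_iff hne).2 fun i _ => hm i, fun i x => ?_, fun i x => ?_, fun i => ?_⟩
  · obtain ⟨j, hj, e⟩ := hred i x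
    rw [e]; exact (Finset.inf'_le m hj).trans (hmM j x).1
  · obtain ⟨j, hj, e⟩ := hred i x
    rw [e]; exact (hmM j x).2.trans (Finset.le_sup' M hj)
  · unfold extW
    split_ifs with h
    · exact (hw.smooth i h.1 h.2).continuousOn.comp_continuous (by fun_prop) hmem
    · exact continuous_const

theorem hInt_succ (W : ℕ → ℝ → ℝ) (y : ℝ) (p j : ℕ) (x : ℝ) :
    hInt W y p (j + 1) x = W p x * ∫ s in y..x, hInt W y (p + 1) j s := rfl

theorem continuous_hInt {W : ℕ → ℝ → ℝ} (hW : ∀ i, Continuous (W i)) (p j : ℕ) :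
    Continuous fun z : ℝ × ℝ => hInt W z.1 p j z.2 := by
  induction j generalizing p with
  | zero => exact (hW p).comp continuous_snd
  | succ j ih =>
    have h : ∀ z : ℝ × ℝ, hInt W z.1 p (j + 1) z.2 = W p z.2 *
        ((∫ s in 0..z.2, hInt W z.1 (p + 1) j s) - ∫ s in 0..z.1, hInt W z.1 (p + 1) j s) := by
      intro z
      have hi : ∀ c d : ℝ, IntervalIntegrable (fun s => hInt W z.1 (p + 1) j s) volume c d :=
        fun c d => ((ih (p + 1)).comp (by fun_prop : Continuous fun s : ℝ =>
          (z.1, s))).intervalIntegrable c d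
      rw [hInt_succ, intervalIntegral.integral_interval_sub_left (hi _ _) (hi _ _)]
    simp only [h]
    refine ((hW p).comp continuous_snd).mul (Continuous.sub ?_ ?_)
    · exact intervalIntegral.continuous_parametric_intervalIntegral_of_continuous
        (f := fun (z : ℝ × ℝ) s => hInt W z.1 (p + 1) j s)
        ((ih (p + 1)).comp (by fun_prop : Continuous fun q : (ℝ × ℝ) × ℝ => (q.1.1, q.2)))
        continuous_snd
    · exact intervalIntegral.continuous_parametric_intervalIntegral_of_continuous
        (f := fun (z : ℝ × ℝ) s => hInt W z.1 (p + 1) j s)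
        ((ih (p + 1)).comp (by fun_prop : Continuous fun q : (ℝ × ℝ) × ℝ => (q.1.1, q.2)))
        continuous_fst

/-- Fubini's theorem on the triangle `y ≤ r ≤ s ≤ x`. -/
theorem integral_triangle_swap {F : ℝ → ℝ → ℝ} (hF : Continuous fun z : ℝ × ℝ => F z.1 z.2)
    {x y : ℝ} (hyx : y ≤ x) :
    ∫ s in y..x, ∫ r in y..s, F s r = ∫ r in y..x, ∫ s in r..x, F s r := by
  have hint : Integrable (Function.uncurry fun s r : ℝ => if r ≤ s then F s r else 0)
      ((volume.restrict (uIoc y x)).prod (volume.restrict (uIoc y x))) := by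
    have h1 : IntegrableOn (fun z : ℝ × ℝ => F z.1 z.2) (uIoc y x ×ˢ uIoc y x)
        (volume.prod volume) :=
      (hF.continuousOn.integrableOn_compact (isCompact_uIcc.prod isCompact_uIcc)).mono_set
        (prod_mono uIoc_subset_uIcc uIoc_subset_uIcc)
    have hmeas : MeasurableSet {z : ℝ × ℝ | z.2 ≤ z.1} :=
      measurableSet_le measurable_snd measurable_fst
    rw [Measure.prod_restrict]
    refine (h1.indicator hmeas).congr (Eventually.of_forall fun z => ?_)
    simp only [indicator, mem_ofPred_eq, Function.uncurry]
  have hswap := intervalIntegral_integral_swap (a := y) (b := x)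
    (μ := volume.restrict (uIoc y x)) hint
  have e1 : ∫ s in y..x, ∫ r in y..s, F s r
      = ∫ s in y..x, ∫ r in uIoc y x, if r ≤ s then F s r else 0 := by
    refine intervalIntegral.integral_congr fun s hs => ?_
    rw [uIcc_of_le hyx] at hs
    rw [uIoc_of_le hyx, ← intervalIntegral.integral_of_le hyx,
      integral_eq_of_eq_zero_off (c := y) (d := s) ?_ le_rfl hs.1 hs.2 (by simp)
        (fun r hr => if_neg (not_le.2 hr.1))]
    · refine intervalIntegral.integral_congr fun r hr => ?_
      rw [uIcc_of_le hs.1] at hr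
      simp [hr.2]
    · have : (fun r => if r ≤ s then F s r else 0) = (Iic s).indicator (F s) := by
        funext r; simp [indicator]
      rw [this, intervalIntegrable_iff]
      exact ((intervalIntegrable_iff.1 ((hF.comp (by fun_prop : Continuous fun r : ℝ =>
        (s, r))).intervalIntegrable y x))).indicator measurableSet_Iic
  have e2 : ∫ r in y..x, ∫ s in r..x, F s r
      = ∫ r in uIoc y x, ∫ s in y..x, if r ≤ s then F s r else 0 := by
    rw [uIoc_of_le hyx, intervalIntegral.integral_of_le hyx]
    refine setIntegral_congr_fun measurableSet_Ioc fun r hr => ?_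
    rw [integral_eq_of_eq_zero_off (c := r) (d := x) ?_ hr.1.le hr.2 le_rfl
      (fun s hs => if_neg (not_le.2 hs.2)) (by simp)]
    · refine intervalIntegral.integral_congr fun s hs => ?_
      rw [uIcc_of_le hr.2] at hs
      simp [hs.1]
    · have : (fun s => if r ≤ s then F s r else 0) = (Ici r).indicator (fun s => F s r) := by
        funext s; simp [indicator]
      rw [this, intervalIntegrable_iff]
      exact ((intervalIntegrable_iff.1 ((hF.comp (by fun_prop : Continuous fun s : ℝ =>
        (s, r))).intervalIntegrable y x))).indicator measurableSet_Ici
  rw [e1, e2, hswap]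

/-- The iterated integral `hInt`, with the innermost integration performed last. -/
theorem hInt_succ_eq {W : ℕ → ℝ → ℝ} (hW : ∀ i, Continuous (W i)) (p j : ℕ) {x y : ℝ}
    (hyx : y ≤ x) :
    hInt W y p (j + 1) x = ∫ s in y..x, W (p + j + 1) s * hInt W s p j x := by
  induction j generalizing p x with
  | zero =>
    simp only [hInt, add_zero]
    rw [← intervalIntegral.integral_const_mul]
    exact intervalIntegral.integral_congr fun s _ => mul_comm _ _
  | succ j ih =>
    have hc := continuous_hInt hW (p + 1) j
    have hF : Continuous fun z : ℝ × ℝ => W (p + 1 + j + 1) z.2 * hInt W z.2 (p + 1) j z.1 :=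
      ((hW _).comp continuous_snd).mul
        (hc.comp (by fun_prop : Continuous fun z : ℝ × ℝ => (z.2, z.1)))
    rw [hInt_succ, intervalIntegral.integral_congr
      (g := fun s => ∫ r in y..s, W (p + 1 + j + 1) r * hInt W r (p + 1) j s)
      (fun s hs => ih (p + 1) (by rw [uIcc_of_le hyx] at hs; exact hs.1)),
      integral_triangle_swap hF hyx, ← intervalIntegral.integral_const_mul]
    refine intervalIntegral.integral_congr fun r _ => ?_
    rw [hInt_succ, intervalIntegral.integral_const_mul,
      show p + 1 + j + 1 = p + (j + 1) + 1 by ring]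
    ring

theorem hInt_congr {k : ℕ} {a b : ℝ} {w W : ℕ → ℝ → ℝ}
    (hwW : ∀ i, 1 ≤ i → i ≤ k → ∀ x ∈ Icc a b, W i x = w i x) {y : ℝ} (hy : y ∈ Icc a b)
    {p j : ℕ} (hp : 1 ≤ p) (hpj : p + j ≤ k) {x : ℝ} (hx : x ∈ Icc a b) :
    hInt W y p j x = hInt w y p j x := by
  induction j generalizing p x with
  | zero => exact hwW p hp (by omega) x hx
  | succ j ih =>
    rw [hInt_succ, hInt_succ, hwW p hp (by omega) x hx, intervalIntegral.integral_congr fun s hs =>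
      ih (by omega) (by omega) (x := s) ((uIcc_subset_Icc hy hx) hs)]

theorem dualInt_congr {k : ℕ} {a b : ℝ} {w W : ℕ → ℝ → ℝ}
    (hwW : ∀ i, 1 ≤ i → i ≤ k → ∀ x ∈ Icc a b, W i x = w i x)
    {p i : ℕ} (hi : i ≤ p) (hp : p ≤ k) {x : ℝ} (hx : x ∈ Icc a b) :
    dualInt W a p i x = dualInt w a p i x := by
  induction i generalizing p x with
  | zero => rfl
  | succ i ih =>
    have ha : a ∈ Icc a b := ⟨le_rfl, hx.1.trans hx.2⟩
    rw [dualInt, dualInt]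
    refine intervalIntegral.integral_congr fun s hs => ?_
    have hs' := (uIcc_subset_Icc ha hx) hs
    rw [hwW p (by omega) hp s hs', ih (by omega) (by omega) hs']

theorem continuous_dualInt {W : ℕ → ℝ → ℝ} (hW : ∀ i, Continuous (W i)) (a : ℝ) (p i : ℕ) :
    Continuous (dualInt W a p i) := by
  induction i generalizing p with
  | zero => exact continuous_const
  | succ i ih =>
    exact intervalIntegral.continuous_primitive
      (fun c d => ((hW p).mul (ih (p - 1))).intervalIntegrable c d) a

/-! ### Divided differences by recursion -/

/-- Generalized divided differences on the knots `t j, …, t (j + s)`, defined by the recursion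
that mirrors the one of `bcdf`; if all knots coincide, they are the derivative `LStar s`. -/
def gdd (k n : ℕ) (a b : ℝ) (w W : ℕ → ℝ → ℝ) (t : ℕ → ℝ) : ℕ → ℕ → (ℝ → ℝ) → ℝ
  | 0, j, f => f (t j)
  | s + 1, j, f =>
      if k ≤ j + s + 1 ∧ j ≤ n then
        (gdd k n a b w W t s (j + 1) f - gdd k n a b w W t s j f) / bmass k n a b W t s j
      else LStar k w a b (s + 1) f (t j)

section

variable {k n : ℕ} {a b : ℝ} {w W : ℕ → ℝ → ℝ} {t : ℕ → ℝ} {s j r S : ℕ} {x m M : ℝ}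
  {f : ℝ → ℝ} {u : ℕ → ℝ → ℝ}

local notation "cdf" => bcdf k n a b W t
local notation "bs" => bsp k n a b W t
local notation "mass" => bmass k n a b W t
local notation "dd" => gdd k n a b w W t

theorem gdd_succ (h : k ≤ j + s + 1 ∧ j ≤ n) (f : ℝ → ℝ) :
    dd (s + 1) j f = (dd s (j + 1) f - dd s j f) / mass s j := if_pos h

theorem gdd_succ_of_not (h : ¬(k ≤ j + s + 1 ∧ j ≤ n)) (f : ℝ → ℝ) :
    dd (s + 1) j f = LStar k w a b (s + 1) f (t j) := if_neg h

/-- The chain `u` of functions on `[a, b]` represents the derivatives `LStar r f` at the knots: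
at interior knots only the values of `f` matter. -/
structure Represents (k n : ℕ) (a b : ℝ) (w W : ℕ → ℝ → ℝ) (t : ℕ → ℝ) (S : ℕ) (f : ℝ → ℝ)
    (u : ℕ → ℝ → ℝ) : Prop where
  prim : ∀ r < S, IsPrimitive a b (u r) (fun x => W (k - r) x * u (r + 1) x)
  knots : ∀ i ≤ n + k, f (t i) = u 0 (t i)
  left : ∀ r ≤ S, LStar k w a b r f a = u r a
  right : ∀ r ≤ S, LStar k w a b r f b = u r b

theorem intervalIntegrable_bcdf_mul (hab : a ≤ b) (hW : ∀ i, Continuous (W i)) (s j : ℕ)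
    {g : ℝ → ℝ} (hg : IntervalIntegrable g volume a b) :
    IntervalIntegrable (fun y => cdf s j y * g y) volume a b := by
  cases s with
  | zero =>
    have hfun : (fun y => cdf 0 j y * g y) = (Ici (t j)).indicator g := by
      funext y
      by_cases h : t j ≤ y <;> simp [bcdf, indicator, h]
    rw [hfun, intervalIntegrable_iff]
    exact (intervalIntegrable_iff.1 hg).indicator measurableSet_Ici
  | succ s =>
    refine hg.continuousOn_mul ?_
    rw [uIcc_of_le hab]
    exact (isPrimitive_bcdf hW s j).continuousOn

/-- Peano representation of the divided differences, in terms of the distribution functions of the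
B-splines. -/
theorem integral_bcdf_mul (hab : a ≤ b) (ht : IsKnots k n a b t) (hk : 0 < k)
    (hW : IsBoundedWeights m M W) (hu : Represents k n a b w W t S f u) (hS : S ≤ k)
    (hs : s < S) (hj : j + s ≤ n + k) :
    ∫ y in a..b, cdf s j y * (W (k - s) y * u (s + 1) y) = u s b - dd s j f := by
  have ha : a ∈ Icc a b := left_mem_Icc.2 hab
  have hb : b ∈ Icc a b := right_mem_Icc.2 hab
  induction s generalizing j with
  | zero =>
    have hP := hu.prim 0 hs
    have hmem : t j ∈ Icc a b := ⟨ht.ge_left hk hj, ht.le_right hk hj⟩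
    have hint := intervalIntegrable_bcdf_mul (k := k) (n := n) (t := t) hab hW.cont 0 j
      hP.integrable
    rw [integral_eq_of_eq_zero_off hint hmem.1 hmem.2 le_rfl
      (fun y hy => by simp [bcdf, hy.2]) (by simp)]
    rw [intervalIntegral.integral_congr (g := fun y => W (k - 0) y * u (0 + 1) y)]
    · rw [hP.integral_eq hmem hb, gdd, hu.knots j hj]
    · intro y hy
      rw [uIcc_of_le hmem.2] at hy
      simp [bcdf, hy.1]
  | succ s ih =>
    have hP := hu.prim (s + 1) hs
    by_cases h : k ≤ j + s + 1 ∧ j ≤ n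
    · have hpos : 0 < mass s j := massPos ht hk hW s j (by omega) (by omega) h.1 h.2
      have hF := isPrimitive_bcdf (k := k) (n := n) (a := a) (b := b) (t := t) hW.cont s j
      simp only [if_pos h] at hF
      have hmul := hF.mul hP hab
      have e := hmul.integral_eq ha hb
      have hF0 : cdf (s + 1) j a = 0 := by
        rw [bcdf_succ h, intervalIntegral.integral_same, zero_div]
      have hF1 : cdf (s + 1) j b = 1 := by
        rw [bcdf_succ h]; exact div_self hpos.ne'
      have i1 : IntervalIntegrable (fun y => W (k - s) y * (bs s j y / mass s j) * u (s + 1) y)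
          volume a b := hF.integrable.mul_continuousOn (by
            rw [uIcc_of_le hab]; exact hP.continuousOn)
      have i2 : IntervalIntegrable
          (fun y => cdf (s + 1) j y * (W (k - (s + 1)) y * u (s + 1 + 1) y)) volume a b :=
        hP.integrable.continuousOn_mul (by rw [uIcc_of_le hab]; exact hF.continuousOn)
      rw [intervalIntegral.integral_add i1 i2, hF0, hF1] at e
      have i3 := fun j => intervalIntegrable_bcdf_mul (k := k) (n := n) (t := t) hab hW.cont s j
        (hu.prim s (by omega)).integrable
      have e1 : ∫ y in a..b, W (k - s) y * (bs s j y / mass s j) * u (s + 1) y =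
          (dd s (j + 1) f - dd s j f) / mass s j := by
        have : (fun y => W (k - s) y * (bs s j y / mass s j) * u (s + 1) y) = fun y =>
            (mass s j)⁻¹ * (cdf s j y * (W (k - s) y * u (s + 1) y) -
              cdf s (j + 1) y * (W (k - s) y * u (s + 1) y)) := by
          funext y; rw [bsp]; ring
        rw [this, intervalIntegral.integral_const_mul, intervalIntegral.integral_sub (i3 j)
          (i3 (j + 1)), ih (by omega) (by omega), ih (by omega) (by omega)]
        ring
      rw [e1] at e
      rw [gdd_succ h]
      linarith
    · have hz := gdd_succ_of_not (a := a) (b := b) (w := w) (W := W) (t := t) h f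
      by_cases h' : j + s + 1 < k
      · simp only [bcdf_succ_left h', one_mul]
        rw [hP.integral_eq ha hb, hz, ht.left j (by omega), hu.left (s + 1) hs.le]
      · have h0 : ∀ y, cdf (s + 1) j y = 0 := bcdf_succ_right (by omega) (by omega)
        simp only [h0, zero_mul]
        rw [hz, ht.right j (by omega) (by omega), hu.right (s + 1) hs.le]
        simp

/-- A divided difference is the mean value of the corresponding derivative against a B-spline. -/
theorem gdd_eq_integral (hab : a ≤ b) (ht : IsKnots k n a b t) (hk : 0 < k)
    (hW : IsBoundedWeights m M W) (hu : Represents k n a b w W t S f u) (hS : S ≤ k)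
    (hs : s < S) (h : k ≤ j + s + 1 ∧ j ≤ n) (hj : j + s + 1 ≤ n + k) :
    dd (s + 1) j f = (∫ y in a..b, bs s j y * (W (k - s) y * u (s + 1) y)) / mass s j := by
  have i3 := fun j => intervalIntegrable_bcdf_mul (k := k) (n := n) (t := t) hab hW.cont s j
    (hu.prim s hs).integrable
  simp only [bsp, sub_mul]
  rw [intervalIntegral.integral_sub (i3 j) (i3 (j + 1)),
    integral_bcdf_mul hab ht hk hW hu hS hs (by omega),
    integral_bcdf_mul hab ht hk hW hu hS hs (by omega), gdd_succ h]
  ring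

/-! ### The determinants as divided differences -/

theorem mult_left (ht : IsKnots k n a b t) (h : j + r < k) :
    mult (fun r => t (j + r)) r = r := by
  rw [mult, Finset.filter_true_of_mem, Finset.card_range]
  intro l hl
  rw [Finset.mem_range] at hl
  rw [ht.left _ (by omega), ht.left _ h]

theorem mult_right (ht : IsKnots k n a b t) (hj : j ≤ n) (hr : r ≤ k) (h : n + 1 ≤ j + r) :
    mult (fun r => t (j + r)) r = j + r - (n + 1) := by
  have : (Finset.range r).filter (fun l => t (j + l) = t (j + r)) = Finset.Ico (n + 1 - j) r := by
    ext l
    simp only [Finset.mem_filter, Finset.mem_range, Finset.mem_Ico]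
    constructor
    · rintro ⟨h1, h2⟩
      refine ⟨by_contra fun hcon => ?_, h1⟩
      have := ht.lt (i := j + l) (j := j + r) (by omega) (by omega) (by have := ht.le; omega)
        (by omega)
      linarith
    · rintro ⟨h1, h2⟩
      refine ⟨h2, ?_⟩
      rw [ht.right _ (by omega) (by omega), ht.right _ h (by omega)]
  rw [mult, this, Nat.card_Ico]
  omega

theorem mult_mid (ht : IsKnots k n a b t) (h1 : k ≤ j + r) (h2 : j + r ≤ n) :
    mult (fun r => t (j + r)) r = 0 := by
  rw [mult, Finset.card_eq_zero, Finset.filter_eq_empty_iff]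
  intro l hl
  rw [Finset.mem_range] at hl
  exact (ht.lt (i := j + l) (j := j + r) (by omega) (by omega) h1 (by omega)).ne

/-- The recursive divided differences are combinations of the rows of the collocation matrix. -/
theorem exists_gdd_eq_sum (ht : IsKnots k n a b t) (hj : j ≤ n) :
    ∀ s l, j ≤ l → l + s ≤ j + k → ∃ γ : Fin (k + 1) → ℝ, ∀ f, dd s l f =
      ∑ r : Fin (k + 1), γ r *
        LStar k w a b (mult (fun r => t (j + r)) r) f (t (j + r)) := by
  classical
  have single : ∀ (r s l : ℕ), r ≤ k → t (j + r) = t l → mult (fun r => t (j + r)) r = s →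
      ∃ γ : Fin (k + 1) → ℝ, ∀ f, LStar k w a b s f (t l) =
      ∑ r : Fin (k + 1), γ r *
        LStar k w a b (mult (fun r => t (j + r)) r) f (t (j + r)) := by
    intro r s l hr h1 h2
    refine ⟨Pi.single ⟨r, by omega⟩ 1, fun f => ?_⟩
    rw [Finset.sum_eq_single ⟨r, by omega⟩]
    · simp [h1, h2]
    · intro i _ hi
      simp [Pi.single_eq_of_ne hi]
    · simp
  have degen : ∀ s l, j ≤ l → l + s ≤ j + k → (l + s < k ∨ n < l) →
      ∃ γ : Fin (k + 1) → ℝ, ∀ f, LStar k w a b s f (t l) =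
      ∑ r : Fin (k + 1), γ r *
        LStar k w a b (mult (fun r => t (j + r)) r) f (t (j + r)) := by
    rintro s l h1 h2 (h3 | h3)
    · refine single s s l (by omega) ?_ (mult_left ht (by omega))
      rw [ht.left _ (by omega), ht.left _ (by omega)]
    · refine single (n + 1 - j + s) s l (by omega) ?_ ?_
      · rw [ht.right _ (by omega) (by omega), ht.right _ (by omega) (by omega)]
      · rw [mult_right ht hj (by omega) (by omega)]
        omega
  intro s
  induction s with
  | zero =>
    intro l h1 h2
    by_cases h : l + 0 < k ∨ n < l
    · exact degen 0 l h1 h2 h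
    · exact single (l - j) 0 l (by omega) (by rw [Nat.add_sub_cancel' h1])
        (mult_mid ht (by omega) (by omega))
  | succ s ih =>
    intro l h1 h2
    by_cases h : k ≤ l + s + 1 ∧ l ≤ n
    · obtain ⟨γ₁, H₁⟩ := ih l h1 (by omega)
      obtain ⟨γ₂, H₂⟩ := ih (l + 1) (by omega) (by omega)
      refine ⟨fun r => (γ₂ r - γ₁ r) / mass s l, fun f => ?_⟩
      rw [gdd_succ h, H₁, H₂, ← Finset.sum_sub_distrib, Finset.sum_div]
      exact Finset.sum_congr rfl fun r _ => by ring
    · obtain ⟨γ, H⟩ := degen (s + 1) l h1 h2 (by omega)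
      exact ⟨γ, fun f => by rw [gdd_succ_of_not h, H]⟩

/-- The chain of derivatives of the dual function `uStar (c + 1)`. -/
def dualChain (k : ℕ) (a : ℝ) (W : ℕ → ℝ → ℝ) (c r : ℕ) : ℝ → ℝ :=
  if r ≤ c then dualInt W a (k - r) (c - r) else fun _ => 0

theorem isPrimitive_dualChain (hW : ∀ i, Continuous (W i)) (c r : ℕ) :
    IsPrimitive a b (dualChain k a W c r) (fun x => W (k - r) x * dualChain k a W c (r + 1) x) := by
  rcases lt_trichotomy r c with h | rfl | h
  · have e : c - r = (c - (r + 1)) + 1 := by omega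
    rw [dualChain, dualChain, if_pos h.le, if_pos (by omega : r + 1 ≤ c), e]
    have := IsPrimitive.integral (a := a) (b := b) (((hW (k - r)).mul
      (continuous_dualInt hW a (k - (r + 1)) (c - (r + 1)))).intervalIntegrable a b) 0
    simp only [zero_add] at this
    exact this
  · rw [dualChain, dualChain, if_pos le_rfl, if_neg (by omega), Nat.sub_self]
    simpa [dualInt] using IsPrimitive.const (a := a) (b := b) 1
  · rw [dualChain, dualChain, if_neg (by omega), if_neg (by omega)]
    simpa using IsPrimitive.zero (a := a) (b := b)

theorem continuous_dualChain (hW : ∀ i, Continuous (W i)) (c r : ℕ) :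
    Continuous (dualChain k a W c r) := by
  unfold dualChain
  split_ifs
  · exact continuous_dualInt hW _ _ _
  · exact continuous_const

theorem LStar_succ (k : ℕ) (w : ℕ → ℝ → ℝ) (a b : ℝ) (r : ℕ) (f : ℝ → ℝ) (x : ℝ) :
    LStar k w a b (r + 1) f x =
      derivWithin (LStar k w a b r f) (Icc a b) x / w (k - r) x := rfl

theorem LStar_uStar (hab : a < b) (hW : IsBoundedWeights m M W)
    (hwW : ∀ i, 1 ≤ i → i ≤ k → ∀ x ∈ Icc a b, W i x = w i x) {c : ℕ} (hc : c ≤ k) (hr : r ≤ k)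
    (hx : x ∈ Icc a b) :
    LStar k w a b r (uStar k w a (c + 1)) x = dualChain k a W c r x := by
  induction r generalizing x with
  | zero =>
    rw [LStar, uStar, dualChain, if_pos (Nat.zero_le _)]
    exact (dualInt_congr hwW hc le_rfl hx).symm
  | succ r ih =>
    have hd := (isPrimitive_dualChain (k := k) (a := a) (b := b) hW.cont c r).hasDerivWithinAt
      ((hW.cont _).mul (continuous_dualChain hW.cont c (r + 1))).continuousOn hx
    rw [LStar_succ, derivWithin_congr (fun y hy => ih (by omega) hy) (ih (by omega) hx),
      hd.derivWithin (uniqueDiffOn_Icc hab x hx), ← hwW _ (by omega) (by omega) x hx,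
      mul_div_cancel_left₀ _ (hW.pos _ x).ne']

theorem represents_uStar (hab : a < b) (ht : IsKnots k n a b t) (hk : 0 < k)
    (hW : IsBoundedWeights m M W)
    (hwW : ∀ i, 1 ≤ i → i ≤ k → ∀ x ∈ Icc a b, W i x = w i x) {c : ℕ} (hc : c ≤ k) :
    Represents k n a b w W t k (uStar k w a (c + 1)) (dualChain k a W c) where
  prim r _ := isPrimitive_dualChain hW.cont c r
  knots i hi := LStar_uStar (r := 0) hab hW hwW hc (by omega)
    ⟨ht.ge_left hk hi, ht.le_right hk hi⟩
  left r hr := LStar_uStar hab hW hwW hc hr (left_mem_Icc.2 hab.le)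
  right r hr := LStar_uStar hab hW hwW hc hr (right_mem_Icc.2 hab.le)

/-- Divided differences reduce the dual system to triangular form. -/
theorem gdd_uStar (hab : a < b) (ht : IsKnots k n a b t) (hk : 0 < k)
    (hW : IsBoundedWeights m M W)
    (hwW : ∀ i, 1 ≤ i → i ≤ k → ∀ x ∈ Icc a b, W i x = w i x) {c : ℕ} (hc : c ≤ k)
    (hj : j ≤ n) (hs : s ≤ k) (hcs : c ≤ s) :
    dd s j (uStar k w a (c + 1)) = if c = s then 1 else 0 := by
  have hR := represents_uStar hab ht hk hW hwW hc
  cases s with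
  | zero =>
    obtain rfl : c = 0 := by omega
    rw [gdd, hR.knots j (by omega)]
    simp [dualChain, dualInt]
  | succ s =>
    have hu : dualChain k a W c (s + 1) = fun _ => if c = s + 1 then 1 else 0 := by
      unfold dualChain
      by_cases h : c = s + 1
      · subst h; simp [dualInt]
      · rw [if_neg (by omega), if_neg h]
    by_cases h : k ≤ j + s + 1 ∧ j ≤ n
    · have hpos : 0 < mass s j := massPos ht hk hW s j (by omega) (by omega) h.1 h.2
      rw [gdd_eq_integral hab.le ht hk hW hR le_rfl (by omega) h (by omega), hu]
      split_ifs with hc'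
      · rw [div_eq_one_iff_eq hpos.ne', bmass]
        exact intervalIntegral.integral_congr fun y _ => by ring
      · simp
    · rw [gdd_succ_of_not h, ht.left j (by omega), hR.left _ hs, hu]

/-- The quotient of determinants that defines the divided difference is computed by the recursion:
a matrix that expresses the recursion turns the collocation matrix into a unitriangular one. -/
theorem divDiff_eq_gdd (hab : a < b) (ht : IsKnots k n a b t) (hk : 0 < k)
    (hW : IsBoundedWeights m M W)
    (hwW : ∀ i, 1 ≤ i → i ≤ k → ∀ x ∈ Icc a b, W i x = w i x) (hj : j ≤ n) (f : ℝ → ℝ) :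
    divDiff k w a b (fun r => t (j + r)) f = dd k j f := by
  classical
  choose γ hγ using fun s : Fin (k + 1) =>
    exists_gdd_eq_sum (a := a) (b := b) (w := w) (W := W) ht hj s j le_rfl (by omega)
  have key : ∀ g : ℝ → ℝ, (Matrix.of γ).det * colloc k w a b (fun r => t (j + r))
      (fun c => if c = k then g else uStar k w a (c + 1)) = dd k j g := by
    intro g
    rw [colloc, ← Matrix.det_mul]
    have hmul : (Matrix.of γ * Matrix.of fun r c : Fin (k + 1) =>
        LStar k w a b (mult (fun r => t (j + r)) r)
          (if (c : ℕ) = k then g else uStar k w a (c + 1)) (t (j + r))) =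
        Matrix.of fun s c : Fin (k + 1) =>
          dd s j (if (c : ℕ) = k then g else uStar k w a (c + 1)) := by
      ext s c
      rw [Matrix.mul_apply, Matrix.of_apply, hγ s]
      rfl
    rw [hmul, Matrix.det_of_isUpperTriangular, Fin.prod_univ_castSucc]
    · have : ∀ i : Fin k, (Matrix.of fun s c : Fin (k + 1) =>
          dd s j (if (c : ℕ) = k then g else uStar k w a (c + 1))) i.castSucc i.castSucc = 1 := by
        intro i
        have hi := i.isLt
        rw [Matrix.of_apply, if_neg (by simp; omega),
          gdd_uStar hab ht hk hW hwW (by simp) hj (by simp) le_rfl, if_pos rfl]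
      simp [this]
    · intro s c hcs
      have h : (c : ℕ) < s := hcs
      have hs := s.isLt
      rw [Matrix.of_apply, if_neg (by omega),
        gdd_uStar hab ht hk hW hwW (by omega) hj (by omega) h.le, if_neg (by omega)]
  have h1 := key (uStar k w a (k + 1))
  rw [gdd_uStar hab ht hk hW hwW le_rfl hj le_rfl le_rfl, if_pos rfl] at h1
  have h2 : (fun c => if c = k then uStar k w a (k + 1) else uStar k w a (c + 1)) =
      fun c => uStar k w a (c + 1) := by
    funext c; split_ifs with h
    · rw [h]
    · rfl
  rw [h2] at h1
  have hΓ : (Matrix.of γ).det ≠ 0 := left_ne_zero_of_mul_eq_one h1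
  rw [divDiff, ← key f, eq_comm, eq_div_iff (right_ne_zero_of_mul_eq_one h1)]
  calc _ = ((Matrix.of γ).det * colloc k w a b (fun r => t (j + r))
        (fun c => uStar k w a (c + 1))) * colloc k w a b (fun r => t (j + r))
        (fun c => if c = k then f else uStar k w a (c + 1)) := by ring
    _ = _ := by rw [h1, one_mul]

end

/-! ### The B-splines of the statement -/

/-- The derivatives, with respect to the second variable, of the kernel `gKer`. -/
def kernelChain (k : ℕ) (W : ℕ → ℝ → ℝ) (x : ℝ) (r : ℕ) (y : ℝ) : ℝ :=
  if y ≤ x then (-1) ^ r * hInt W y 1 (k - 1 - r) x else 0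

section

variable {k n : ℕ} {a b : ℝ} {w W : ℕ → ℝ → ℝ} {t : ℕ → ℝ} {s j r S : ℕ} {x y m M : ℝ}

local notation "cdf" => bcdf k n a b W t
local notation "bs" => bsp k n a b W t
local notation "mass" => bmass k n a b W t
local notation "dd" => gdd k n a b w W t

/-- The cut-off integral is continuous across `x`, so that only its derivative jumps. -/
theorem isPrimitive_cut {h : ℝ → ℝ} (hh : Continuous h) (hx : x ∈ Icc a b) :
    IsPrimitive a b (fun y => if y ≤ x then ∫ s in y..x, h s else 0)
      (fun y => if y ≤ x then -h y else 0) := by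
  have hfun : (fun y => if y ≤ x then -h y else 0) = (Iic x).indicator (fun y => -h y) := by
    funext y; simp [indicator]
  have hint : ∀ c d, IntervalIntegrable (fun y => if y ≤ x then -h y else 0) volume c d := by
    intro c d
    rw [hfun, intervalIntegrable_iff]
    exact (intervalIntegrable_iff.1 (hh.neg.intervalIntegrable c d)).indicator measurableSet_Iic
  refine ⟨hint a b, fun y hy => ?_⟩
  have key : ∀ z, a ≤ z → z ≤ x → ∫ s in a..z, (if s ≤ x then -h s else 0)
      = - ∫ s in a..z, h s := by
    intro z h1 h2
    rw [← intervalIntegral.integral_neg]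
    refine intervalIntegral.integral_congr fun s hs => ?_
    rw [uIcc_of_le h1] at hs
    exact if_pos (hs.2.trans h2)
  have hi : ∀ c d, IntervalIntegrable h volume c d := fun c d => hh.intervalIntegrable c d
  rw [if_pos hx.1]
  by_cases hyx : y ≤ x
  · rw [if_pos hyx, key y hy.1 hyx, ← intervalIntegral.integral_add_adjacent_intervals
      (hi a y) (hi y x)]
    ring
  · rw [if_neg hyx, integral_eq_of_eq_zero_off (c := a) (d := x) (hint a y) le_rfl hx.1
      (not_le.1 hyx).le (by simp) (fun s hs => if_neg (not_le.2 hs.1)), key x hx.1 le_rfl]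
    ring

theorem kernelChain_eq (hW : ∀ i, Continuous (W i)) (hr : r + 1 < k) :
    kernelChain k W x r = fun y => (-1) ^ r *
      if y ≤ x then ∫ s in y..x, W (k - r) s * hInt W s 1 (k - 1 - (r + 1)) x else 0 := by
  funext y
  have e : k - 1 - r = k - 1 - (r + 1) + 1 := by omega
  by_cases h : y ≤ x
  · rw [kernelChain, if_pos h, if_pos h, e, hInt_succ_eq hW _ _ h,
      show 1 + (k - 1 - (r + 1)) + 1 = k - r by omega]
  · rw [kernelChain, if_neg h, if_neg h, mul_zero]

theorem continuous_kernel (hW : ∀ i, Continuous (W i)) (p q i : ℕ) (x : ℝ) :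
    Continuous fun s => W i s * hInt W s p q x :=
  (hW i).mul ((continuous_hInt hW p q).comp (by fun_prop : Continuous fun s : ℝ => (s, x)))

theorem isPrimitive_kernelChain (hW : ∀ i, Continuous (W i)) (hr : r + 1 < k)
    (hx : x ∈ Icc a b) : IsPrimitive a b (kernelChain k W x r)
      (fun y => W (k - r) y * kernelChain k W x (r + 1) y) := by
  rw [kernelChain_eq hW hr]
  convert (isPrimitive_cut (continuous_kernel hW 1 (k - 1 - (r + 1)) (k - r) x) hx).const_mul
    ((-1) ^ r) using 1
  funext y
  unfold kernelChain
  split_ifs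
  · rw [pow_succ]; ring
  · simp

theorem hasDerivAt_kernelChain (hW : ∀ i, Continuous (W i)) (hr : r + 1 < k) (hy : y ≠ x) :
    HasDerivAt (kernelChain k W x r) (W (k - r) y * kernelChain k W x (r + 1) y) y := by
  rw [kernelChain_eq hW hr]
  have hc := continuous_kernel hW 1 (k - 1 - (r + 1)) (k - r) x
  rcases lt_or_gt_of_ne hy with h | h
  · have hd := (intervalIntegral.integral_hasDerivAt_left (hc.intervalIntegrable y x)
      (hc.stronglyMeasurableAtFilter _ _) hc.continuousAt).const_mul ((-1 : ℝ) ^ r)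
    have hd' := hd.congr_of_eventuallyEq (f₁ := fun y => (-1) ^ r *
      if y ≤ x then ∫ s in y..x, W (k - r) s * hInt W s 1 (k - 1 - (r + 1)) x else 0) (by
        filter_upwards [Iio_mem_nhds h] with z hz
        rw [if_pos (le_of_lt hz)])
    have e : kernelChain k W x (r + 1) y =
      (-1) ^ (r + 1) * hInt W y 1 (k - 1 - (r + 1)) x := if_pos h.le
    rw [e, pow_succ]
    exact hd'.congr_deriv (by ring)
  · have hd' := (hasDerivAt_const y (0 : ℝ)).congr_of_eventuallyEq (f₁ := fun y => (-1) ^ r *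
      if y ≤ x then ∫ s in y..x, W (k - r) s * hInt W s 1 (k - 1 - (r + 1)) x else 0) (by
        filter_upwards [Ioi_mem_nhds h] with z hz
        rw [if_neg (not_le.2 hz), mul_zero])
    have e : kernelChain k W x (r + 1) y = 0 := if_neg (not_le.2 h)
    rwa [e, mul_zero]

theorem gKer_eq (hwW : ∀ i, 1 ≤ i → i ≤ k → ∀ x ∈ Icc a b, W i x = w i x) (hk : 0 < k)
    (hx : x ∈ Icc a b) (hy : y ∈ Icc a b) : gKer w k x y = kernelChain k W x 0 y := by
  rw [gKer, kernelChain, pow_zero, one_mul, Nat.sub_zero,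
    hInt_congr hwW hy le_rfl (by omega) hx]

/-- Away from the diagonal, where the kernel is smooth, its dual derivatives are the members of
`kernelChain`. -/
theorem LStar_gKer (hab : a < b) (hW : IsBoundedWeights m M W)
    (hwW : ∀ i, 1 ≤ i → i ≤ k → ∀ x ∈ Icc a b, W i x = w i x) (hx : x ∈ Icc a b)
    (hr : r < k) (hy : y ∈ Icc a b) (hyx : y ≠ x) :
    LStar k w a b r (gKer w k x) y = kernelChain k W x r y := by
  induction r generalizing y with
  | zero => exact gKer_eq hwW (by omega) hx hy
  | succ r ih =>
    have hev : LStar k w a b r (gKer w k x) =ᶠ[𝓝[Icc a b] y] kernelChain k W x r := by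
      filter_upwards [self_mem_nhdsWithin, mem_nhdsWithin_of_mem_nhds (isOpen_ne.mem_nhds hyx)]
        with z hz hzx using ih (by omega) hz hzx
    rw [LStar_succ, hev.derivWithin_eq (ih (by omega) hy hyx),
      ((hasDerivAt_kernelChain hW.cont hr hyx).hasDerivWithinAt).derivWithin
        (uniqueDiffOn_Icc hab y hy), ← hwW _ (by omega) (by omega) y hy,
      mul_div_cancel_left₀ _ (hW.pos _ y).ne']

theorem represents_gKer (hab : a < b) (ht : IsKnots k n a b t) (hk : 0 < k)
    (hW : IsBoundedWeights m M W)
    (hwW : ∀ i, 1 ≤ i → i ≤ k → ∀ x ∈ Icc a b, W i x = w i x) (hx : x ∈ Ioo a b) :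
    Represents k n a b w W t (k - 1) (gKer w k x) (kernelChain k W x) where
  prim r hr := isPrimitive_kernelChain hW.cont (by omega) (Ioo_subset_Icc_self hx)
  knots i hi := gKer_eq hwW hk (Ioo_subset_Icc_self hx) ⟨ht.ge_left hk hi, ht.le_right hk hi⟩
  left r hr := LStar_gKer hab hW hwW (Ioo_subset_Icc_self hx) (by omega)
    (left_mem_Icc.2 hab.le) hx.1.ne
  right r hr := LStar_gKer hab hW hwW (Ioo_subset_Icc_self hx) (by omega)
    (right_mem_Icc.2 hab.le) hx.2.ne'

/-- The divided difference of one order less, applied to the kernel, is the distribution function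
of a B-spline. -/
theorem gdd_gKer (hab : a < b) (ht : IsKnots k n a b t) (hk : 2 ≤ k)
    (hW : IsBoundedWeights m M W)
    (hwW : ∀ i, 1 ≤ i → i ≤ k → ∀ x ∈ Icc a b, W i x = w i x) (hx : x ∈ Ioo a b)
    (hj : j ≤ n + 1) :
    dd (k - 1) j (gKer w k x) = (-1) ^ (k - 1) * W 1 x * cdf (k - 1) j x := by
  have hR := represents_gKer hab ht (by omega) hW hwW hx
  obtain ⟨s, hs⟩ : ∃ s, k - 1 = s + 1 := ⟨k - 2, by omega⟩
  have hlast : ∀ y, kernelChain k W x (s + 1) y =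
      if y ≤ x then (-1) ^ (k - 1) * W 1 x else 0 := fun y => by
    rw [kernelChain, hs, Nat.sub_self]; rfl
  rw [hs] at hR ⊢
  by_cases h : k ≤ j + s + 1 ∧ j ≤ n
  · rw [gdd_eq_integral hab.le ht (by omega) hW hR (by omega) (by omega) h (by omega),
      bcdf_succ h, ← mul_div_assoc]
    congr 1
    have hint := intervalIntegrable_bcdf_mul (k := k) (n := n) (t := t) hab.le hW.cont s j
      (hR.prim s (by omega)).integrable
    have hint' := intervalIntegrable_bcdf_mul (k := k) (n := n) (t := t) hab.le hW.cont s (j + 1)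
      (hR.prim s (by omega)).integrable
    have hi : IntervalIntegrable
        (fun y => bs s j y * (W (k - s) y * kernelChain k W x (s + 1) y)) volume a b := by
      simpa only [bsp, sub_mul] using hint.sub hint'
    rw [integral_eq_of_eq_zero_off (c := a) (d := x) hi le_rfl hx.1.le hx.2.le (by simp)
      (fun y hy => by rw [hlast, if_neg (not_le.2 hy.1)]; ring),
      ← intervalIntegral.integral_const_mul]
    refine intervalIntegral.integral_congr fun y hy => ?_
    rw [uIcc_of_le hx.1.le] at hy
    simp only [hlast, if_pos hy.2, hs]
    ring
  · rw [gdd_succ_of_not h]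
    by_cases h' : j + s + 1 < k
    · rw [ht.left j (by omega), hR.left _ le_rfl, hlast, if_pos hx.1.le, bcdf_succ_left h',
        mul_one, hs]
    · rw [ht.right j (by omega) (by omega), hR.right _ le_rfl, hlast, if_neg (not_le.2 hx.2),
        bcdf_succ_right (by omega) (by omega), mul_zero]

/-- The B-spline of the statement is `w 1` times a positive multiple of the B-spline `bsp`. -/
theorem bspline_eq (hab : a < b) (ht : IsKnots k n a b t) (hk : 2 ≤ k)
    (hW : IsBoundedWeights m M W)
    (hwW : ∀ i, 1 ≤ i → i ≤ k → ∀ x ∈ Icc a b, W i x = w i x) (hx : x ∈ Ioo a b) (hj : j ≤ n) :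
    bspline k w a b t j x = W 1 x * bs (k - 1) j x / mass (k - 1) j := by
  rw [bspline, if_pos hx, bsplineRaw, divDiff_eq_gdd hab ht (by omega) hW hwW hj]
  obtain ⟨s, rfl⟩ : ∃ s, k = s + 1 := ⟨k - 1, by omega⟩
  have h1 := gdd_gKer (j := j) hab ht hk hW hwW hx (by omega)
  have h2 := gdd_gKer (j := j + 1) hab ht hk hW hwW hx (by omega)
  rw [Nat.add_sub_cancel] at h1 h2 ⊢
  rw [gdd_succ (by omega), h1, h2, bsp, mul_div_assoc', ← mul_sub, pow_succ]
  have : ((-1 : ℝ) ^ s) * (-1) ^ s = 1 := by rw [← mul_pow]; simp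
  linear_combination (W 1 x * (bcdf (s + 1) n a b W t s j x -
    bcdf (s + 1) n a b W t s (j + 1) x) / bmass (s + 1) n a b W t s j) * this

end

/-! ### Splines that vanish at the knots -/

/-- The chain of derivatives of a spline of order `2 k - 1` on the knots `t lo < ⋯ < t (hi + 1)`
that vanishes at the knots, together with its first `k - 2` derivatives at the two end knots. -/
structure IsNullSpline (k : ℕ) (q : ℕ → ℝ → ℝ) (t : ℕ → ℝ) (lo hi : ℕ) (v : ℕ → ℝ → ℝ) :
    Prop where
  le : lo ≤ hi
  strict : ∀ j, lo ≤ j → j ≤ hi → t j < t (j + 1)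
  chain : IsChain (2 * k - 2) q (t lo) (t (hi + 1)) v
  const : ∀ j, lo ≤ j → j ≤ hi → ∃ D, ∀ x ∈ Ico (t j) (t (j + 1)), v (2 * k - 2) x = D
  left : ∀ i, i + 2 ≤ k → v i (t lo) = 0
  right : ∀ i, i + 2 ≤ k → v i (t (hi + 1)) = 0
  zero : ∀ j, lo ≤ j → j ≤ hi + 1 → v 0 (t j) = 0

theorem Alt.congr_sign {g : ℝ → ℝ} {a : ℝ} : ∀ {M : ℕ} {c s s' : ℝ}, 0 < s * s' →
    Alt g a M c s → Alt g a M c s'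
  | 0, _, _, _, _, h => h
  | M + 1, c, s, s', hss, ⟨x, hx, h1, h2⟩ => by
    refine ⟨x, hx, ?_, h2.congr_sign (by linarith)⟩
    have := mul_pos hss h1
    have h3 : 0 ≤ s ^ 2 := sq_nonneg s
    nlinarith

theorem eq_zero_on_Icc {f : ℝ → ℝ} {c d : ℝ} (hcd : c < d) (hf : ContinuousOn f (Icc c d))
    (h : ∀ x ∈ Ioo c d, f x = 0) : ∀ x ∈ Icc c d, f x = 0 := by
  have h1 : EqOn f (fun _ => 0) (Ioo c d) := h
  have := h1.of_subset_closure hf continuousOn_const Ioo_subset_Icc_self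
    (closure_Ioo hcd.ne).symm.subset
  exact this

namespace IsNullSpline

variable {k lo hi j M : ℕ} {q v : ℕ → ℝ → ℝ} {t : ℕ → ℝ} {s m B x y y' : ℝ}

theorem mono_knots (h : IsNullSpline k q t lo hi v) {i j : ℕ} (hi' : lo ≤ i) (hij : i ≤ j)
    (hj : j ≤ hi + 1) : t i ≤ t j := by
  induction j, hij using Nat.le_induction with
  | base => exact le_rfl
  | succ j hij ih => exact (ih (by omega)).trans (h.strict j (by omega) (by omega)).le

/-- The pieces of the chain on a single knot interval. -/
theorem chain_piece (h : IsNullSpline k q t lo hi v) (h1 : lo ≤ j) (h2 : j ≤ hi) :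
    IsChain (2 * k - 2) q (t j) (t (j + 1)) v :=
  h.chain.mono (h.mono_knots le_rfl h1 (by omega)) (h.strict j h1 h2).le
    (h.mono_knots (by omega) (by omega) le_rfl)

/-- Repeated application of Rolle's theorem bounds the number of alternations of the first
derivative; if `v (k - 1)` vanishes at the left end, there is one less. -/
theorem alt_le (h : IsNullSpline k q t lo hi v) (hk : 2 ≤ k) (hq : ∀ i x, 0 < q i x)
    (hA : Alt (v 1) (t lo) (M + 1) (t (hi + 1)) s) {z : ℕ}
    (hz : z = 0 ∨ z = 1 ∧ v (k - 1) (t lo) = 0) : M + z ≤ hi - lo + 1 := by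
  -- up to `v (k - 2)` the zeros at both ends make up for the loss in Rolle's theorem, and add one
  have step1 : ∀ i, i + 2 ≤ k → ∃ s, Alt (v (i + 1)) (t lo) (M + i + 1) (t (hi + 1)) s := by
    intro i
    induction i with
    | zero => exact fun _ => ⟨s, hA⟩
    | succ i ih =>
      intro hi'
      obtain ⟨s, hs⟩ := ih (by omega)
      rw [show M + (i + 1) + 1 = M + i + 1 + 1 by omega]
      exact ⟨-s, hs.rolle_right (h.chain (i + 1) (by omega)) (hq _)
        (Or.inr ⟨rfl, h.left (i + 1) (by omega)⟩) (h.right (i + 1) (by omega))⟩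
  -- from here on the end conditions no longer help, and each step loses one alternation
  obtain ⟨s₁, hs₁⟩ := step1 (k - 2) (by omega)
  rw [show k - 2 + 1 = k - 1 by omega] at hs₁
  have step2 : ∀ i, i + 2 ≤ k →
      ∃ s, Alt (v (k + i)) (t lo) (M + z + (k - 2 - i)) (t (hi + 1)) s := by
    intro i
    induction i with
    | zero =>
      intro _
      have := hs₁.rolle (h.chain (k - 1) (by omega)) (hq _) hz
      rw [show k - 1 + 1 = k by omega] at this
      exact ⟨s₁, by rw [show M + z + (k - 2 - 0) = M + (k - 2) + z by omega]; exact this⟩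
    | succ i ih =>
      intro hi'
      obtain ⟨s, hs⟩ := ih (by omega)
      rw [show M + z + (k - 2 - i) = M + z + (k - 2 - (i + 1)) + 1 by omega] at hs
      exact ⟨s, hs.rolle (z := 0) (h.chain (k + i) (by omega)) (hq _) (Or.inl rfl)⟩
  obtain ⟨s₂, hs₂⟩ := step2 (k - 2) (by omega)
  rw [show k + (k - 2) = 2 * k - 2 by omega, Nat.sub_self, add_zero] at hs₂
  rcases Nat.eq_zero_or_pos (M + z) with h0 | h0
  · omega
  rw [show M + z = (M + z - 1) + 1 by omega] at hs₂
  obtain ⟨p, hp1, hp2, -⟩ := Alt.exists_index (t := t) (lo := lo) (hi := hi)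
    (fun i j h1 h2 h3 => h.mono_knots h1 h2 h3)
    (fun x hax hxb _ => by
      classical
      have hex : ∃ i, x < t (i + 1) ∧ lo ≤ i := ⟨hi, hxb, h.le⟩
      have hs := Nat.find_spec hex
      have hle : Nat.find hex ≤ hi := Nat.find_min' hex ⟨hxb, h.le⟩
      refine ⟨Nat.find hex, hs.2, hle, ?_, hs.1⟩
      rcases hs.2.eq_or_lt with h0 | h0
      · rw [← h0]; exact hax.le
      · have := Nat.find_min hex (m := Nat.find hex - 1) (by omega)
        rw [Nat.sub_add_cancel (by omega)] at this
        by_contra hcon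
        exact this ⟨not_le.1 hcon, by omega⟩)
    (fun p hp1 hp2 x hx y hy _ _ => by
      obtain ⟨D, hD⟩ := h.const p hp1 hp2
      rw [hD x hx, hD y hy]
      exact mul_self_nonneg D) le_rfl hs₂
  omega

theorem prim_zero (h : IsNullSpline k q t lo hi v) (hk : 2 ≤ k) :
    IsPrimitive (t lo) (t (hi + 1)) (v 0) (fun x => q 0 x * v 1 x) := h.chain 0 (by omega)

/-- Between two consecutive zeros with a nonzero value in between, the derivative takes both
signs. -/
theorem exists_signs (h : IsNullSpline k q t lo hi v) (hk : 2 ≤ k) (hq : ∀ i x, 0 < q i x)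
    (h1 : lo ≤ j) (h2 : j ≤ hi) (hy : y ∈ Ioo (t j) (t (j + 1))) (hne : v 0 y ≠ 0) :
    (∃ z ∈ Ioo (t j) y, 0 < v 0 y * v 1 z) ∧ ∃ z ∈ Ioo y (t (j + 1)), 0 < -v 0 y * v 1 z := by
  have ha := h.mono_knots le_rfl h1 (by omega)
  have hb := h.mono_knots (i := j + 1) (j := hi + 1) (by omega) (by omega) le_rfl
  have hsq : 0 < v 0 y * v 0 y := mul_self_pos.2 hne
  constructor
  · refine (h.prim_zero hk).exists_pos (hq 0) ha hy.1 (hy.2.le.trans hb) ?_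
    rw [h.zero j h1 (by omega)]; linarith
  · refine (h.prim_zero hk).exists_pos (hq 0) (ha.trans hy.1.le) hy.2 hb ?_
    rw [h.zero (j + 1) (by omega) (by omega)]; linarith

/-- A nonzero value of the sign expected from the alternations to the left yields one further
alternation of the derivative. -/
theorem alt_step (h : IsNullSpline k q t lo hi v) (hk : 2 ≤ k) (hq : ∀ i x, 0 < q i x)
    (h1 : lo ≤ j) (h2 : j ≤ hi) (hy : y ∈ Ioo (t j) (t (j + 1)))
    (hA : Alt (v 1) (t lo) M (t j) s) (hs : 0 < s * v 0 y) :
    Alt (v 1) (t lo) (M + 1) (t (j + 1)) (-v 0 y) := by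
  obtain ⟨-, z, hz, hz'⟩ := h.exists_signs hk hq h1 h2 hy (right_ne_zero_of_mul hs.ne')
  refine ⟨z, hz.2, hz', ?_⟩
  rw [neg_neg]
  exact (hA.congr_sign hs).mono (hy.1.trans hz.1).le

/-- A nonzero value of the unexpected sign yields two further alternations. -/
theorem alt_step_two (h : IsNullSpline k q t lo hi v) (hk : 2 ≤ k) (hq : ∀ i x, 0 < q i x)
    (h1 : lo ≤ j) (h2 : j ≤ hi) (hy : y ∈ Ioo (t j) (t (j + 1)))
    (hA : Alt (v 1) (t lo) M (t j) s) (hs : s * v 0 y < 0) :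
    Alt (v 1) (t lo) (M + 2) (t (j + 1)) (-v 0 y) := by
  obtain ⟨⟨z, hz, hz'⟩, z', hz1, hz2⟩ :=
    h.exists_signs hk hq h1 h2 hy (right_ne_zero_of_mul hs.ne)
  refine ⟨z', hz1.2, hz2, z, hz.2.trans hz1.1, by rwa [neg_neg], ?_⟩
  rw [neg_neg]
  exact (hA.congr_sign (by linarith)).mono hz.1.le

/-- The spline vanishes on no knot interval. -/
def Nondegenerate (t : ℕ → ℝ) (lo hi : ℕ) (v : ℕ → ℝ → ℝ) : Prop :=
  ∀ j, lo ≤ j → j ≤ hi → ∃ y ∈ Ioo (t j) (t (j + 1)), v 0 y ≠ 0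

theorem alt_succ (h : IsNullSpline k q t lo hi v) (hk : 2 ≤ k) (hq : ∀ i x, 0 < q i x)
    (h1 : lo ≤ j) (h2 : j ≤ hi) (hy : y ∈ Ioo (t j) (t (j + 1))) (hne : v 0 y ≠ 0)
    (hs : s ≠ 0) (hA : Alt (v 1) (t lo) M (t j) s) :
    Alt (v 1) (t lo) (M + 1) (t (j + 1)) (-v 0 y) := by
  rcases lt_or_gt_of_ne (mul_ne_zero hs hne) with h0 | h0
  · exact (h.alt_step_two hk hq h1 h2 hy hA h0).drop
  · exact h.alt_step hk hq h1 h2 hy hA h0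

/-- The zeros at the knots enforce one alternation of the derivative per knot interval, and one
more. -/
theorem alt_base (h : IsNullSpline k q t lo hi v) (hk : 2 ≤ k) (hq : ∀ i x, 0 < q i x)
    (hnd : Nondegenerate t lo hi v) (h1 : lo ≤ j) (h2 : j ≤ hi) :
    ∀ y ∈ Ioo (t j) (t (j + 1)), v 0 y ≠ 0 →
      Alt (v 1) (t lo) (j - lo + 2) (t (j + 1)) (-v 0 y) := by
  induction j, h1 using Nat.le_induction with
  | base =>
    intro y hy hne
    obtain ⟨⟨z, hz, hz'⟩, z', hz1, hz2⟩ := h.exists_signs hk hq le_rfl h2 hy hne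
    rw [Nat.sub_self]
    exact ⟨z', hz1.2, hz2, z, hz.2.trans hz1.1, by rwa [neg_neg], hz.1⟩
  | succ j hj ih =>
    intro y hy hne
    obtain ⟨y₀, hy₀, hne₀⟩ := hnd j hj (by omega)
    rw [show j + 1 - lo + 2 = j - lo + 2 + 1 by omega]
    exact h.alt_succ hk hq (by omega) h2 hy hne (neg_ne_zero.2 hne₀)
      (ih (by omega) y₀ hy₀ hne₀)

/-- There is no room for one more alternation than the knots enforce. -/
theorem not_alt (h : IsNullSpline k q t lo hi v) (hk : 2 ≤ k) (hq : ∀ i x, 0 < q i x)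
    (hnd : Nondegenerate t lo hi v) (h1 : lo ≤ j) (h2 : j ≤ hi) (hs : s ≠ 0) :
    ¬Alt (v 1) (t lo) (j - lo + 3) (t (j + 1)) s := by
  intro hA
  have key : ∀ i, j ≤ i → i ≤ hi → ∃ s, s ≠ 0 ∧ Alt (v 1) (t lo) (i - lo + 3) (t (i + 1)) s := by
    intro i hji
    induction i, hji using Nat.le_induction with
    | base => exact fun _ => ⟨s, hs, hA⟩
    | succ i hi' ih =>
      intro hle
      obtain ⟨s, hs, hA⟩ := ih (by omega)
      obtain ⟨y, hy, hne⟩ := hnd (i + 1) (by omega) hle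
      refine ⟨_, neg_ne_zero.2 hne, ?_⟩
      rw [show i + 1 - lo + 3 = i - lo + 3 + 1 by omega]
      exact h.alt_succ hk hq (by omega) hle hy hne hs hA
  obtain ⟨s, -, hA⟩ := key hi h2 le_rfl
  have := h.alt_le hk hq hA (Or.inl rfl)
  omega

/-- The additional zero costs one alternation, which is not to spare. -/
theorem not_nondegenerate (h : IsNullSpline k q t lo hi v) (hk : 2 ≤ k) (hq : ∀ i x, 0 < q i x)
    (hz : v (k - 1) (t lo) = 0) : ¬Nondegenerate t lo hi v := by
  intro hnd
  obtain ⟨y, hy, hne⟩ := hnd hi h.le le_rfl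
  have := h.alt_le hk hq (h.alt_base hk hq hnd h.le le_rfl y hy hne) (Or.inr ⟨rfl, hz⟩)
  omega

/-- Equal signs on adjacent knot intervals would produce an alternation too many. -/
theorem mul_nonpos_of_adjacent (h : IsNullSpline k q t lo hi v) (hk : 2 ≤ k)
    (hq : ∀ i x, 0 < q i x) (hnd : Nondegenerate t lo hi v) (h1 : lo ≤ j) (h2 : j + 1 ≤ hi)
    (hy : y ∈ Ioo (t j) (t (j + 1))) (hy' : y' ∈ Ioo (t (j + 1)) (t (j + 1 + 1))) :
    v 0 y * v 0 y' ≤ 0 := by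
  by_contra! hcon
  have hA := h.alt_base hk hq hnd h1 (by omega) y hy (left_ne_zero_of_mul hcon.ne')
  have := h.alt_step_two hk hq (by omega) h2 hy' hA (by linarith)
  rw [show j - lo + 2 + 2 = j + 1 - lo + 3 by omega] at this
  exact h.not_alt hk hq hnd (by omega) h2 (neg_ne_zero.2 (right_ne_zero_of_mul hcon.ne')) this

/-- Both signs on one knot interval would produce an alternation too many. -/
theorem mul_nonneg_of_same (h : IsNullSpline k q t lo hi v) (hk : 2 ≤ k)
    (hq : ∀ i x, 0 < q i x) (hnd : Nondegenerate t lo hi v) (h1 : lo ≤ j) (h2 : j ≤ hi)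
    (hy : y ∈ Ioo (t j) (t (j + 1))) (hy' : y' ∈ Ioo (t j) (t (j + 1))) :
    0 ≤ v 0 y * v 0 y' := by
  by_contra! hcon
  have hne := left_ne_zero_of_mul hcon.ne
  have hne' := right_ne_zero_of_mul hcon.ne
  -- on the first interval there are no alternations to the left to refer to, but a change of sign
  -- between the two end zeros gives three alternations of the derivative
  rcases h1.eq_or_lt with rfl | h1
  · wlog hlt : y < y' generalizing y y'
    · rcases (not_lt.1 hlt).eq_or_lt with rfl | h0
      · nlinarith
      · exact this (by rwa [mul_comm]) hne' hne hy' hy h0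
    obtain ⟨⟨z, hz, hz'⟩, -⟩ := h.exists_signs hk hq le_rfl h2 hy hne
    obtain ⟨-, z₂, hz₂, hz₂'⟩ := h.exists_signs hk hq le_rfl h2 hy' hne'
    obtain ⟨z₁, hz₁, hz₁'⟩ := (h.prim_zero hk).exists_pos (hq 0) hy.1.le hlt
      (hy'.2.le.trans (h.mono_knots (by omega) (by omega) le_rfl)) (s := v 0 y')
      (by have := mul_self_pos.2 hne'; linarith)
    refine h.not_alt hk hq hnd le_rfl h2 (s := -v 0 y') (neg_ne_zero.2 hne') ?_
    rw [Nat.sub_self]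
    refine ⟨z₂, hz₂.2, hz₂', z₁, hz₁.2.trans hz₂.1, by rwa [neg_neg], z, hz.2.trans hz₁.1,
      ?_, hz.1⟩
    rw [neg_neg]
    have h0 := mul_pos (neg_pos.2 hcon) hz'
    have h3 : 0 ≤ v 0 y ^ 2 := sq_nonneg _
    nlinarith
  · obtain ⟨i, rfl⟩ : ∃ i, j = i + 1 := ⟨j - 1, by omega⟩
    obtain ⟨y₀, hy₀, hne₀⟩ := hnd i (by omega) (by omega)
    have hA := h.alt_base hk hq hnd (j := i) (by omega) (by omega) y₀ hy₀ hne₀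
    have key : ∀ y ∈ Ioo (t (i + 1)) (t (i + 1 + 1)), v 0 y ≠ 0 → 0 ≤ -v 0 y₀ * v 0 y := by
      intro y hy hne
      by_contra! hlt
      have := h.alt_step_two hk hq (by omega) h2 hy hA hlt
      rw [show i - lo + 2 + 2 = i + 1 - lo + 3 by omega] at this
      exact h.not_alt hk hq hnd (by omega) h2 (neg_ne_zero.2 hne) this
    have e1 := key y hy hne
    have e2 := key y' hy' hne'
    have e3 : 0 < v 0 y₀ ^ 2 := by positivity
    nlinarith [mul_nonneg e1 e2]

/-- The sign of a null spline alternates from one knot interval to the next. -/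
theorem exists_sign (h : IsNullSpline k q t lo hi v) (hk : 2 ≤ k)
    (hq : ∀ i x, 0 < q i x) (hnd : Nondegenerate t lo hi v) :
    ∃ e : ℝ, |e| = 1 ∧ ∀ j, lo ≤ j → j ≤ hi → ∀ x ∈ Ioo (t j) (t (j + 1)),
      0 ≤ e * (-1) ^ j * v 0 x := by
  obtain ⟨y₀, hy₀, hne₀⟩ := hnd lo le_rfl h.le
  have key : ∀ j, lo ≤ j → j ≤ hi → ∀ x ∈ Ioo (t j) (t (j + 1)),
      0 ≤ v 0 y₀ * (-1) ^ (j - lo) * v 0 x := by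
    intro j hj
    induction j, hj using Nat.le_induction with
    | base =>
      intro h2 x hx
      rw [Nat.sub_self, pow_zero, mul_one]
      exact h.mul_nonneg_of_same hk hq hnd le_rfl h2 hy₀ hx
    | succ j hj ih =>
      intro h2 x hx
      obtain ⟨y, hy, hne⟩ := hnd j hj (by omega)
      have e1 := ih (by omega) y hy
      have e2 := h.mul_nonpos_of_adjacent hk hq hnd hj h2 hy hx
      rw [show j + 1 - lo = j - lo + 1 by omega, pow_succ]
      have e3 : 0 < v 0 y ^ 2 := by positivity
      have e4 := mul_nonneg e1 (neg_nonneg.2 e2)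
      have e5 : v 0 y₀ * (-1) ^ (j - lo) * v 0 y * -(v 0 y * v 0 x) =
        v 0 y ^ 2 * (v 0 y₀ * ((-1) ^ (j - lo) * -1) * v 0 x) := by ring
      rw [e5] at e4
      exact nonneg_of_mul_nonneg_right e4 e3
  refine ⟨v 0 y₀ / |v 0 y₀| * (-1) ^ lo, ?_, fun j h1 h2 x hx => ?_⟩
  · rw [abs_mul, abs_neg_one_pow, mul_one, abs_div, abs_abs, div_self (abs_ne_zero.2 hne₀)]
  · have e1 := key j h1 h2 x hx
    have e2 : (-1 : ℝ) ^ lo * (-1) ^ j = (-1) ^ (j - lo) := by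
      obtain ⟨i, rfl⟩ := Nat.exists_eq_add_of_le h1
      rw [Nat.add_sub_cancel_left, pow_add, ← mul_assoc, ← mul_pow]; simp
    rw [mul_assoc _ ((-1 : ℝ) ^ lo), e2, div_mul_eq_mul_div, div_mul_eq_mul_div]
    exact div_nonneg e1 (abs_nonneg _)

/-- A null spline that vanishes on a knot interval has all members of its chain zero there. -/
theorem eq_zero_of_piece (h : IsNullSpline k q t lo hi v)
    (hB : IsBoundedWeights m B q) (h1 : lo ≤ j) (h2 : j ≤ hi)
    (hj : ∀ x ∈ Ioo (t j) (t (j + 1)), v 0 x = 0) :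
    ∀ i ≤ 2 * k - 2, ∀ x ∈ Ioo (t j) (t (j + 1)), v i x = 0 := by
  obtain ⟨D, hD⟩ := h.const j h1 h2
  intro i
  induction i with
  | zero => exact fun _ => hj
  | succ i ih =>
    intro hi' x hx
    have hd := (h.chain_piece h1 h2).hasDerivAt hB.cont (fun x hx => hD x ⟨hx.1.le, hx.2⟩)
      (show i < 2 * k - 2 by omega) hx
    have h0 : HasDerivAt (v i) 0 x := (hasDerivAt_const x (0 : ℝ)).congr_of_eventuallyEq (by
      filter_upwards [Ioo_mem_nhds hx.1 hx.2] with y hy using ih (by omega) y hy)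
    exact (mul_eq_zero.1 (hd.unique h0)).resolve_left (hB.pos i x).ne'

/-- A null spline for which `v (k - 1)` vanishes at the left end is zero: it cannot be
nondegenerate, and where it vanishes on a knot interval, the pieces to both sides are null splines
of the same type on fewer knots. -/
theorem eq_zero (hk : 2 ≤ k) (hB : IsBoundedWeights m B q) :
    ∀ {N lo hi : ℕ} {v : ℕ → ℝ → ℝ}, hi - lo < N → IsNullSpline k q t lo hi v →
      v (k - 1) (t lo) = 0 → ∀ x ∈ Icc (t lo) (t (hi + 1)), v 0 x = 0
  | 0, _, _, _, hN, _, _ => by omega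
  | N + 1, lo, hi, v, hN, h, hz => by
    have hnd := h.not_nondegenerate hk hB.pos hz
    simp only [Nondegenerate, not_forall, not_exists, not_and, not_not] at hnd
    obtain ⟨j, h1, h2, hj⟩ := hnd
    have hch := h.chain_piece h1 h2
    have hlt := h.strict j h1 h2
    have hall := h.eq_zero_of_piece hB h1 h2 hj
    have hend : ∀ i < 2 * k - 2, ∀ x ∈ Icc (t j) (t (j + 1)), v i x = 0 := fun i hi' =>
      eq_zero_on_Icc hlt (hch i hi').continuousOn (hall i hi'.le)
    have hl : t j ∈ Icc (t j) (t (j + 1)) := left_mem_Icc.2 hlt.le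
    have hr : t (j + 1) ∈ Icc (t j) (t (j + 1)) := right_mem_Icc.2 hlt.le
    intro x hx
    by_cases hxj : x ∈ Icc (t j) (t (j + 1))
    · exact hend 0 (by omega) x hxj
    rcases lt_or_ge x (t j) with hlx | hlx
    · have hlo : lo < j := by
        rcases h1.eq_or_lt with rfl | h0
        · linarith [hx.1]
        · exact h0
      obtain ⟨i, rfl⟩ : ∃ i, j = i + 1 := ⟨j - 1, by omega⟩
      refine eq_zero hk hB (N := N) (lo := lo) (hi := i) (by omega) ⟨by omega,
        fun j h1 h2 => h.strict j h1 (by omega),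
        h.chain.mono le_rfl (h.mono_knots le_rfl (by omega) (by omega))
          (h.mono_knots (by omega) (by omega) le_rfl),
        fun j h1 h2 => h.const j h1 (by omega), h.left,
        fun i hi' => hend i (by omega) _ hl,
        fun j h1 h2 => h.zero j h1 (by omega)⟩ hz x ⟨hx.1, hlx.le⟩
    · have hxr : t (j + 1) < x := by
        by_contra hcon
        exact hxj ⟨hlx, not_lt.1 hcon⟩
      have hhi : j < hi := by
        rcases h2.eq_or_lt with rfl | h0
        · linarith [hx.2]
        · exact h0
      refine eq_zero hk hB (N := N) (lo := j + 1) (hi := hi) (by omega) ⟨by omega,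
        fun j h1 h2 => h.strict j (by omega) h2,
        h.chain.mono (h.mono_knots le_rfl (by omega) (by omega))
          (h.mono_knots (by omega) (by omega) le_rfl) le_rfl,
        fun j h1 h2 => h.const j (by omega) h2,
        fun i hi' => hend i (by omega) _ hr, h.right,
        fun j h1 h2 => h.zero j (by omega) h2⟩ (hend (k - 1) (by omega) _ hr) x ⟨hxr.le, hx.2⟩

end IsNullSpline

/-! ### The invariant of a null spline -/

namespace IsNullSpline

variable {k lo hi j : ℕ} {q v : ℕ → ℝ → ℝ} {t : ℕ → ℝ} {m B x : ℝ}

/-- The self-adjoint form of the chain: for symmetric weights, the alternating sum of the products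
`v i * v (2 k - 2 - i)` has zero derivative on each knot interval. -/
theorem sum_const (h : IsNullSpline k q t lo hi v) (hk : 2 ≤ k)
    (hsym : ∀ i, i ≤ 2 * k - 3 → q (2 * k - 3 - i) = q i) (h1 : lo ≤ j) (h2 : j ≤ hi) {D : ℝ}
    (hD : ∀ x ∈ Ioo (t j) (t (j + 1)), v (2 * k - 2) x = D) {x y : ℝ}
    (hx : x ∈ Icc (t j) (t (j + 1))) (hy : y ∈ Icc (t j) (t (j + 1))) :
    2 * D * v 0 x + ∑ i ∈ Finset.range (2 * k - 3),
        (-1) ^ (i + 1) * (v (i + 1) x * v (2 * k - 3 - i) x) =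
    2 * D * v 0 y + ∑ i ∈ Finset.range (2 * k - 3),
        (-1) ^ (i + 1) * (v (i + 1) y * v (2 * k - 3 - i) y) := by
  have hlt := h.strict j h1 h2
  have hch := h.chain_piece h1 h2
  obtain ⟨T, hT⟩ : ∃ T, 2 * k - 2 = T + 1 := ⟨2 * k - 3, by omega⟩
  obtain rfl : T = 2 * k - 3 := by omega
  set T := 2 * k - 3 with hTdef
  have hev : Even (T + 1) := ⟨k - 1, by omega⟩
  -- `v (2 k - 2)` is replaced by the constant `D`, which is also differentiable at the knots
  let u : ℕ → ℝ → ℝ := fun i x => if i < T + 1 then v i x else D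
  let g : ℕ → ℝ → ℝ := fun i x => if i < T + 1 then q i x * u (i + 1) x else 0
  have hu : ∀ i, IsPrimitive (t j) (t (j + 1)) (u i) (g i) := by
    intro i
    by_cases hi' : i < T + 1
    · have e1 : u i = v i := funext fun x => if_pos hi'
      rw [e1]
      refine (hch i (by omega)).congr hlt.le (fun _ _ => rfl) fun x hx => ?_
      simp only [g, u, hi', if_true]
      split_ifs with h0
      · rfl
      · rw [show i + 1 = 2 * k - 2 by omega, hD x hx]
    · have e1 : u i = fun _ => D := funext fun x => if_neg hi'
      have e2 : g i = fun _ => 0 := funext fun x => if_neg hi'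
      rw [e1, e2]
      exact IsPrimitive.const D
  have hsum := IsPrimitive.sum (s := Finset.range (T + 2)) fun i _ =>
    ((hu i).mul (hu (T + 1 - i)) hlt.le).const_mul ((-1) ^ i)
  have hzero : ∀ x, ∑ i ∈ Finset.range (T + 2),
      (-1 : ℝ) ^ i * (g i x * u (T + 1 - i) x + u i x * g (T + 1 - i) x) = 0 := by
    intro x
    simp only [mul_add, Finset.sum_add_distrib]
    rw [Finset.sum_range_succ, Finset.sum_range_succ' (fun i => (-1 : ℝ) ^ i * (u i x * _))]
    have e0 : g (T + 1) x = 0 := by simp [g]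
    simp only [e0, Nat.sub_zero, zero_mul, mul_zero, add_zero]
    rw [← Finset.sum_add_distrib]
    refine Finset.sum_eq_zero fun i hi' => ?_
    have hi2 := Finset.mem_range.1 hi'
    rw [show T + 1 - (i + 1) = T - i by omega]
    have e1 : g i x = q i x * u (i + 1) x := if_pos hi2
    have e2 : g (T - i) x = q i x * u (T + 1 - i) x := by
      simp only [g, show T - i < T + 1 by omega, if_true, hsym i (by omega)]
      rw [show T - i + 1 = T + 1 - i by omega]
    rw [e1, e2, pow_succ]; ring
  have key : ∀ x, ∑ i ∈ Finset.range (T + 2), (-1 : ℝ) ^ i * (u i x * u (T + 1 - i) x) =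
      2 * D * v 0 x + ∑ i ∈ Finset.range T, (-1) ^ (i + 1) * (v (i + 1) x * v (T - i) x) := by
    intro x
    have e1 : u (T + 1) x = D := by simp [u]
    have e2 : u 0 x = v 0 x := by simp [u]
    rw [Finset.sum_range_succ, Finset.sum_range_succ', Nat.sub_self, Nat.sub_zero, e1, e2,
      hev.neg_one_pow]
    have : ∀ i ∈ Finset.range T, (-1 : ℝ) ^ (i + 1) * (u (i + 1) x * u (T + 1 - (i + 1)) x) =
        (-1) ^ (i + 1) * (v (i + 1) x * v (T - i) x) := by
      intro i hi'
      have := Finset.mem_range.1 hi'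
      simp only [u, show i + 1 < T + 1 by omega, show T + 1 - (i + 1) = T - i by omega,
        show T - i < T + 1 by omega, if_true]
    rw [Finset.sum_congr rfl this]; ring
  have e := hsum.integral_eq hx hy
  simp only [hzero, intervalIntegral.integral_zero, key] at e
  linarith

/-- At the knots the invariant does not involve the discontinuous top member, so that it has the
same value on all knot intervals; at the left end only the middle term is nonzero. -/
theorem sum_knot (h : IsNullSpline k q t lo hi v) (hk : 2 ≤ k)
    (hsym : ∀ i, i ≤ 2 * k - 3 → q (2 * k - 3 - i) = q i) (h1 : lo ≤ j) (h2 : j ≤ hi + 1) :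
    ∑ i ∈ Finset.range (2 * k - 3), (-1) ^ (i + 1) * (v (i + 1) (t j) * v (2 * k - 3 - i) (t j)) =
      (-1) ^ (k - 1) * v (k - 1) (t lo) ^ 2 := by
  induction j, h1 using Nat.le_induction with
  | base =>
    rw [Finset.sum_eq_single (k - 2)]
    · rw [show k - 2 + 1 = k - 1 by omega, show 2 * k - 3 - (k - 2) = k - 1 by omega, sq]
    · intro i hi' hne
      have := Finset.mem_range.1 hi'
      rcases lt_or_gt_of_ne hne with h0 | h0
      · rw [h.left (i + 1) (by omega)]; ring
      · rw [h.left (2 * k - 3 - i) (by omega)]; ring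
    · intro h0
      exact absurd (Finset.mem_range.2 (by omega)) h0
  | succ j hj ih =>
    obtain ⟨D, hD⟩ := h.const j hj (by omega)
    have hlt := h.strict j hj (by omega)
    have := h.sum_const hk hsym hj (by omega) (fun x hx => hD x ⟨hx.1.le, hx.2⟩)
      (right_mem_Icc.2 hlt.le) (left_mem_Icc.2 hlt.le)
    rw [h.zero j hj (by omega), h.zero (j + 1) (by omega) h2] at this
    linarith [ih (by omega)]

theorem sum_eq (h : IsNullSpline k q t lo hi v) (hk : 2 ≤ k)
    (hsym : ∀ i, i ≤ 2 * k - 3 → q (2 * k - 3 - i) = q i) (h1 : lo ≤ j) (h2 : j ≤ hi)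
    (hx : x ∈ Ioo (t j) (t (j + 1))) :
    2 * v (2 * k - 2) x * v 0 x +
      ∑ i ∈ Finset.range (2 * k - 3), (-1) ^ (i + 1) * (v (i + 1) x * v (2 * k - 3 - i) x) =
      (-1) ^ (k - 1) * v (k - 1) (t lo) ^ 2 := by
  obtain ⟨D, hD⟩ := h.const j h1 h2
  have hlt := h.strict j h1 h2
  rw [hD x ⟨hx.1.le, hx.2⟩, h.sum_const hk hsym h1 h2 (fun x hx => hD x ⟨hx.1.le, hx.2⟩)
    (Ioo_subset_Icc_self hx) (left_mem_Icc.2 hlt.le), h.zero j h1 (by omega),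
    h.sum_knot hk hsym h1 (by omega)]
  ring

end IsNullSpline

/-- On every knot interval the integral of a null spline is bounded below by the value of
`v (k - 1)` at the left end: the invariant alternating sum equals the square of this value, and on
the other hand it is controlled by the integral through the Markov type inequality. -/
theorem exists_le_integral (k : ℕ) (hk : 2 ≤ k) (m B : ℝ) (hm : 0 < m) (hB : 0 < B) :
    ∃ C > 0, ∀ (q v : ℕ → ℝ → ℝ) (t : ℕ → ℝ) (lo hi j : ℕ), IsBoundedWeights m B q →
      (∀ i, i ≤ 2 * k - 3 → q (2 * k - 3 - i) = q i) → IsNullSpline k q t lo hi v →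
      lo ≤ j → j ≤ hi →
      |v (k - 1) (t lo)| * (t (j + 1) - t j) ^ k ≤ C * ∫ x in t j..t (j + 1), |v 0 x| := by
  obtain ⟨C, hC, hmar⟩ := IsChain.markov (2 * k - 2) (by omega) m B hm hB
  refine ⟨2 * k * C, by positivity, fun q v t lo hi j hq hsym h h1 h2 => ?_⟩
  have hlt := h.strict j h1 h2
  obtain ⟨D, hD⟩ := h.const j h1 h2
  have hmar := hmar D _ _ q v hlt hq (h.chain_piece h1 h2) fun x hx => hD x ⟨hx.1.le, hx.2⟩
  set A := ∫ x in t j..t (j + 1), |v 0 x| with hA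
  have hA0 : 0 ≤ A := intervalIntegral.integral_nonneg hlt.le fun _ _ => abs_nonneg _
  set d := t (j + 1) - t j with hd
  have hd0 : 0 < d := sub_pos.2 hlt
  obtain ⟨x, hx⟩ := nonempty_Ioo.2 hlt
  -- in each product the exponents of the lengths add up to `2 k`
  have hprod : ∀ i i', i + i' = 2 * k - 2 → |v i x * v i' x| * d ^ (2 * k) ≤ (C * A) ^ 2 := by
    intro i i' hii
    have e1 := hmar i (by omega) x hx
    have e2 := hmar i' (by omega) x hx
    calc |v i x * v i' x| * d ^ (2 * k) = (|v i x| * d ^ (i + 1)) * (|v i' x| * d ^ (i' + 1)) := by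
          rw [abs_mul, show 2 * k = (i + 1) + (i' + 1) by omega, pow_add]; ring
      _ ≤ (C * A) * (C * A) := by gcongr
      _ = _ := by ring
  have hsum := h.sum_eq hk hsym h1 h2 hx
  have e3 : |v (k - 1) (t lo)| ^ 2 ≤ 2 * |v (2 * k - 2) x * v 0 x| +
      ∑ i ∈ Finset.range (2 * k - 3), |v (i + 1) x * v (2 * k - 3 - i) x| := by
    have : |v (k - 1) (t lo)| ^ 2 = |(-1) ^ (k - 1) * v (k - 1) (t lo) ^ 2| := by
      rw [abs_mul, abs_neg_one_pow, one_mul, abs_pow]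
    rw [this, ← hsum, mul_assoc]
    refine (abs_add_le _ _).trans (add_le_add ?_ ?_)
    · rw [abs_mul, abs_two]
    · refine (Finset.abs_sum_le_sum_abs _ _).trans (Finset.sum_le_sum fun i _ => ?_)
      rw [abs_mul, abs_neg_one_pow, one_mul]
  have e4 : (|v (k - 1) (t lo)| * d ^ k) ^ 2 ≤ (2 * k * C * A) ^ 2 := by
    have hk1 : (1 : ℝ) ≤ k := by exact_mod_cast (by omega : 1 ≤ k)
    calc (|v (k - 1) (t lo)| * d ^ k) ^ 2 = |v (k - 1) (t lo)| ^ 2 * d ^ (2 * k) := by ring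
      _ ≤ (2 * |v (2 * k - 2) x * v 0 x| +
          ∑ i ∈ Finset.range (2 * k - 3), |v (i + 1) x * v (2 * k - 3 - i) x|) * d ^ (2 * k) := by
          gcongr
      _ = 2 * (|v (2 * k - 2) x * v 0 x| * d ^ (2 * k)) + ∑ i ∈ Finset.range (2 * k - 3),
          |v (i + 1) x * v (2 * k - 3 - i) x| * d ^ (2 * k) := by
          rw [add_mul, Finset.sum_mul]; ring
      _ ≤ 2 * (C * A) ^ 2 + ∑ i ∈ Finset.range (2 * k - 3), (C * A) ^ 2 := by
          refine add_le_add ?_ (Finset.sum_le_sum fun i hi' => hprod _ _ ?_)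
          · linarith [hprod (2 * k - 2) 0 rfl]
          · have := Finset.mem_range.1 hi'; omega
      _ ≤ 2 * k * (C * A) ^ 2 := by
          rw [Finset.sum_const, Finset.card_range, nsmul_eq_mul, ← add_mul]
          gcongr
          have : ((2 * k - 3 : ℕ) : ℝ) + 3 = 2 * k := by
            exact_mod_cast (by omega : 2 * k - 3 + 3 = 2 * k)
          linarith
      _ ≤ (2 * k) ^ 2 * (C * A) ^ 2 := by gcongr; nlinarith
      _ = _ := by ring
  calc _ ≤ 2 * k * C * A := abs_le_of_sq_le_sq' e4 (by positivity) |>.2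
    _ = _ := rfl

/-- A null spline with `v (k - 1)` nonzero at the left end vanishes on no knot interval. -/
theorem IsNullSpline.nondegenerate {k lo hi : ℕ} {q v : ℕ → ℝ → ℝ} {t : ℕ → ℝ} {m B : ℝ}
    (h : IsNullSpline k q t lo hi v) (hk : 2 ≤ k) (hq : IsBoundedWeights m B q)
    (hsym : ∀ i, i ≤ 2 * k - 3 → q (2 * k - 3 - i) = q i) (hne : v (k - 1) (t lo) ≠ 0) :
    Nondegenerate t lo hi v := by
  intro j h1 h2
  obtain ⟨C, hC, hle⟩ := exists_le_integral k hk m B hq.m_pos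
    ((hq.pos 0 0).trans_le (hq.upper 0 0))
  have hlt := h.strict j h1 h2
  by_contra! hcon
  have e := hle q v t lo hi j hq hsym h h1 h2
  have e0 : ∫ x in t j..t (j + 1), |v 0 x| = 0 :=
    integral_eq_zero_of_Ioo hlt.le fun x hx => by rw [hcon x hx, abs_zero]
  rw [e0, mul_zero] at e
  have : 0 < |v (k - 1) (t lo)| * (t (j + 1) - t j) ^ k :=
    mul_pos (abs_pos.2 hne) (pow_pos (sub_pos.2 hlt) _)
  linarith

/-! ### Existence and uniqueness of null splines -/

/-- The chain of iterated integrals with starting values `α i` at `a` and top member `g`, indexed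
by the number of integrations. -/
def chainOf (q : ℕ → ℝ → ℝ) (a : ℝ) (T : ℕ) (α : ℕ → ℝ) (g : ℝ → ℝ) : ℕ → ℝ → ℝ
  | 0 => g
  | r + 1 => fun x => α (T - (r + 1)) + ∫ s in a..x, q (T - (r + 1)) s * chainOf q a T α g r s

section

variable {q : ℕ → ℝ → ℝ} {a : ℝ} {T : ℕ} {α β : ℕ → ℝ} {g h : ℝ → ℝ}

theorem intervalIntegrable_chainOf (hq : ∀ i, Continuous (q i))
    (hg : ∀ x y, IntervalIntegrable g volume x y) :
    ∀ r x y, IntervalIntegrable (chainOf q a T α g r) volume x y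
  | 0 => hg
  | r + 1 => fun x y => (continuous_const.add (intervalIntegral.continuous_primitive
      (fun x y => (intervalIntegrable_chainOf hq hg r x y).continuousOn_mul
        (hq _).continuousOn) a)).intervalIntegrable x y

theorem isChain_chainOf (hq : ∀ i, Continuous (q i))
    (hg : ∀ x y, IntervalIntegrable g volume x y) (b : ℝ) :
    IsChain T q a b (fun i => chainOf q a T α g (T - i)) := by
  intro i hi
  obtain ⟨r, hr⟩ : ∃ r, T - i = r + 1 := ⟨T - i - 1, by omega⟩
  have h1 : T - (r + 1) = i := by omega
  have h2 : T - (i + 1) = r := by omega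
  simp only [hr, h2, chainOf, h1]
  exact IsPrimitive.integral ((intervalIntegrable_chainOf hq hg r a b).continuousOn_mul
    (hq i).continuousOn) _

theorem chainOf_left {i : ℕ} (hi : i < T) : chainOf q a T α g (T - i) a = α i := by
  obtain ⟨r, hr⟩ : ∃ r, T - i = r + 1 := ⟨T - i - 1, by omega⟩
  have h1 : T - (r + 1) = i := by omega
  simp [hr, chainOf, h1]

theorem chainOf_add (hq : ∀ i, Continuous (q i)) (hg : ∀ x y, IntervalIntegrable g volume x y)
    (hh : ∀ x y, IntervalIntegrable h volume x y) : ∀ r x,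
    chainOf q a T (α + β) (g + h) r x = chainOf q a T α g r x + chainOf q a T β h r x
  | 0, x => rfl
  | r + 1, x => by
    simp only [chainOf, chainOf_add hq hg hh r, mul_add]
    rw [intervalIntegral.integral_add
      ((intervalIntegrable_chainOf hq hg r a x).continuousOn_mul (hq _).continuousOn)
      ((intervalIntegrable_chainOf hq hh r a x).continuousOn_mul (hq _).continuousOn),
      Pi.add_apply]
    ring

theorem chainOf_smul (c : ℝ) : ∀ r x,
    chainOf q a T (c • α) (c • g) r x = c * chainOf q a T α g r x
  | 0, x => rfl
  | r + 1, x => by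
    simp only [chainOf, chainOf_smul c r, mul_left_comm _ c, intervalIntegral.integral_const_mul,
      Pi.smul_apply, smul_eq_mul, mul_add]

end

/-- The step function with the values `D 0, D 1, …` on the intervals `[t lo, t (lo + 1))`,
`[t (lo + 1), t (lo + 2))`, …. -/
def stepFun (t : ℕ → ℝ) (lo N : ℕ) (D : Fin N → ℝ) (x : ℝ) : ℝ :=
  ∑ l : Fin N, (Ico (t (lo + l)) (t (lo + l + 1))).indicator (fun _ => D l) x

theorem stepFun_eq {t : ℕ → ℝ} {lo N : ℕ} (ht : ∀ i j, lo ≤ i → i ≤ j → j ≤ lo + N → t i ≤ t j)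
    (D : Fin N → ℝ) (l : Fin N) {x : ℝ} (hx : x ∈ Ico (t (lo + l)) (t (lo + l + 1))) :
    stepFun t lo N D x = D l := by
  unfold stepFun
  rw [Finset.sum_eq_single l, indicator_of_mem hx]
  · intro l' _ hne
    refine indicator_of_notMem (fun hx' => ?_) _
    rcases lt_or_gt_of_ne (Fin.val_ne_of_ne hne) with h0 | h0
    · have := ht (lo + l' + 1) (lo + l) (by omega) (by omega) (by omega)
      linarith [hx.1, hx'.2]
    · have := ht (lo + l + 1) (lo + l') (by omega) (by omega) (by omega)
      linarith [hx.2, hx'.1]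
  · simp

theorem intervalIntegrable_stepFun (t : ℕ → ℝ) (lo N : ℕ) (D : Fin N → ℝ) (x y : ℝ) :
    IntervalIntegrable (stepFun t lo N D) volume x y := by
  have : stepFun t lo N D = fun x => ∑ l : Fin N,
      (Ico (t (lo + l)) (t (lo + l + 1))).indicator (fun _ => D l) x := rfl
  rw [this]
  have h1 : ∀ l : Fin N, Integrable
      ((Ico (t (lo + l)) (t (lo + l + 1))).indicator (fun _ => D l)) volume := fun l =>
    (integrable_indicator_iff measurableSet_Ico).2 (integrableOn_const (by simp) (by simp))
  exact (integrable_finsetSum _ fun l _ => h1 l).intervalIntegrable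

namespace IsNullSpline

variable {k lo hi j : ℕ} {q v u : ℕ → ℝ → ℝ} {t : ℕ → ℝ} {m B x : ℝ}

theorem sub (h : IsNullSpline k q t lo hi v) (h' : IsNullSpline k q t lo hi u) :
    IsNullSpline k q t lo hi (fun i x => v i x - u i x) where
  le := h.le
  strict := h.strict
  chain i hi' := by
    have := (h.chain i hi').sub (h'.chain i hi')
    simpa only [mul_sub] using this
  const j h1 h2 := by
    obtain ⟨D, hD⟩ := h.const j h1 h2
    obtain ⟨D', hD'⟩ := h'.const j h1 h2
    exact ⟨D - D', fun x hx => by rw [hD x hx, hD' x hx]⟩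
  left i hi' := by rw [h.left i hi', h'.left i hi', sub_zero]
  right i hi' := by rw [h.right i hi', h'.right i hi', sub_zero]
  zero j h1 h2 := by rw [h.zero j h1 h2, h'.zero j h1 h2, sub_zero]

/-- A null spline is determined by the value of `v (k - 1)` at the left end. -/
theorem unique (h : IsNullSpline k q t lo hi v) (h' : IsNullSpline k q t lo hi u) (hk : 2 ≤ k)
    (hB : IsBoundedWeights m B q) (he : v (k - 1) (t lo) = u (k - 1) (t lo)) :
    EqOn (v 0) (u 0) (Icc (t lo) (t (hi + 1))) := fun x hx =>
  sub_eq_zero.1 (eq_zero hk hB (Nat.lt_succ_self _) (h.sub h') (sub_eq_zero.2 he) x hx)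

/-- Null splines exist: they are given by as many parameters as there are conditions, and the
homogeneous conditions have only the trivial solution. -/
theorem exists_of_value (hk : 2 ≤ k) (hB : IsBoundedWeights m B q) (hle : lo ≤ hi)
    (ht : ∀ j, lo ≤ j → j ≤ hi → t j < t (j + 1)) (r : ℝ) :
    ∃ v, IsNullSpline k q t lo hi v ∧ v (k - 1) (t lo) = r := by
  obtain ⟨N, rfl⟩ : ∃ N, hi = lo + N := Nat.exists_eq_add_of_le hle
  obtain ⟨K, rfl⟩ : ∃ K, k = K + 2 := ⟨k - 2, by omega⟩
  have hmono : ∀ i j, lo ≤ i → i ≤ j → j ≤ lo + (N + 1) → t i ≤ t j := by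
    intro i j hi' hij
    induction j, hij using Nat.le_induction with
    | base => exact fun _ => le_rfl
    | succ j hij ih => exact fun h => (ih (by omega)).trans (ht j (by omega) (by omega)).le
  let T := 2 * (K + 2) - 2
  let ext : (Fin T → ℝ) → ℕ → ℝ := fun p i => if h : i < T then p ⟨i, h⟩ else 0
  have ext_add : ∀ p p', ext (p + p') = ext p + ext p' := by
    intro p p'; funext i; simp only [ext, Pi.add_apply]; split_ifs <;> simp
  have ext_smul : ∀ (c : ℝ) p, ext (c • p) = c • ext p := by
    intro c p; funext i; simp only [ext, Pi.smul_apply]; split_ifs <;> simp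
  have step_add : ∀ p p' : Fin (N + 1) → ℝ, stepFun t lo (N + 1) (p + p') =
      stepFun t lo (N + 1) p + stepFun t lo (N + 1) p' := by
    intro p p'; funext x
    simp only [stepFun, Pi.add_apply, ← Finset.sum_add_distrib]
    exact Finset.sum_congr rfl fun l _ => by simp only [indicator]; split_ifs <;> simp
  have step_smul : ∀ (c : ℝ) (p : Fin (N + 1) → ℝ), stepFun t lo (N + 1) (c • p) =
      c • stepFun t lo (N + 1) p := by
    intro c p; funext x
    simp only [stepFun, Pi.smul_apply, Finset.smul_sum]
    exact Finset.sum_congr rfl fun l _ => by simp only [indicator]; split_ifs <;> simp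
  -- the parameters: the values of `v 0, …, v (T - 1)` at the left end, and of the step function
  let V : (Fin T → ℝ) × (Fin (N + 1) → ℝ) → ℕ → ℝ → ℝ := fun p i =>
    chainOf q (t lo) T (ext p.1) (stepFun t lo (N + 1) p.2) (T - i)
  have V_add : ∀ p p' i x, V (p + p') i x = V p i x + V p' i x := fun p p' i x => by
    simp only [V, Prod.fst_add, Prod.snd_add, ext_add, step_add]
    exact chainOf_add hB.cont (intervalIntegrable_stepFun t lo _ _)
      (intervalIntegrable_stepFun t lo _ _) _ _
  have V_smul : ∀ (c : ℝ) p i x, V (c • p) i x = c * V p i x := fun c p i x => by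
    simp only [V, Prod.smul_fst, Prod.smul_snd, ext_smul, step_smul]
    exact chainOf_smul _ _ _
  have V_chain : ∀ p, IsChain T q (t lo) (t (lo + N + 1)) (V p) := fun p =>
    isChain_chainOf hB.cont (intervalIntegrable_stepFun t lo (N + 1) p.2) _
  have V_top : ∀ p (l : Fin (N + 1)), ∀ x ∈ Ico (t (lo + l)) (t (lo + l + 1)),
      V p T x = p.2 l := fun p l x hx => by
    simp only [V, Nat.sub_self, chainOf]
    exact stepFun_eq hmono p.2 l hx
  have V_left : ∀ p (i : Fin T), V p i (t lo) = p.1 i := fun p i => by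
    simp only [V]
    rw [chainOf_left i.2]
    simp [ext]
  -- the conditions: zeros at the knots, further zeros at the left and at the right end, and the
  -- value of `v (k - 1)` at the left end
  let Φ : (Fin T → ℝ) × (Fin (N + 1) → ℝ) →ₗ[ℝ]
      (Fin (N + 2) → ℝ) × (Fin K → ℝ) × (Fin K → ℝ) × ℝ :=
    { toFun := fun p => (fun l => V p 0 (t (lo + l)), fun i => V p (i + 1) (t lo),
        fun i => V p (i + 1) (t (lo + N + 1)), V p (K + 1) (t lo))
      map_add' := fun p p' => by
        simp only [V_add]; rfl
      map_smul' := fun c p => by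
        simp only [V_smul]; rfl }
  have hnull : ∀ p r, Φ p = (0, 0, 0, r) →
      IsNullSpline (K + 2) q t lo (lo + N) (V p) ∧ V p (K + 1) (t lo) = r := by
    intro p r hp
    simp only [Φ, LinearMap.coe_mk, AddHom.coe_mk, Prod.mk.injEq] at hp
    obtain ⟨e1, e2, e3, e4⟩ := hp
    have hz : ∀ j, lo ≤ j → j ≤ lo + N + 1 → V p 0 (t j) = 0 := by
      intro j h1 h2
      obtain ⟨l, rfl⟩ := Nat.exists_eq_add_of_le h1
      exact congrFun e1 ⟨l, by omega⟩
    refine ⟨⟨hle, ht, V_chain p, ?_, ?_, ?_, hz⟩, e4⟩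
    · intro j h1 h2
      obtain ⟨l, rfl⟩ := Nat.exists_eq_add_of_le h1
      exact ⟨_, V_top p ⟨l, by omega⟩⟩
    · intro i hi'
      rcases i with _ | i
      · exact hz lo le_rfl (by omega)
      · exact congrFun e2 ⟨i, by omega⟩
    · intro i hi'
      rcases i with _ | i
      · exact hz _ (by omega) (by omega)
      · exact congrFun e3 ⟨i, by omega⟩
  have hinj : Function.Injective Φ := by
    rw [injective_iff_map_eq_zero]
    intro p hp
    obtain ⟨hn, h0⟩ := hnull p 0 hp
    have hv0 := eq_zero (by omega) hB (Nat.lt_succ_self _) hn h0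
    have hall : ∀ j, lo ≤ j → j ≤ lo + N → ∀ i ≤ T, ∀ x ∈ Ioo (t j) (t (j + 1)), V p i x = 0 :=
      fun j h1 h2 => hn.eq_zero_of_piece hB h1 h2 fun x hx => hv0 x
        ⟨(hn.mono_knots le_rfl h1 (by omega)).trans hx.1.le,
          hx.2.le.trans (hn.mono_knots (by omega) (by omega) le_rfl)⟩
    refine Prod.ext (funext fun i => ?_) (funext fun l => ?_)
    · have hlt := ht lo le_rfl (by omega)
      rw [← V_left p i]
      exact eq_zero_on_Icc hlt (hn.chain_piece le_rfl hn.le i i.2).continuousOn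
        (hall lo le_rfl hn.le i i.2.le) _ (left_mem_Icc.2 hlt.le)
    · obtain ⟨x, hx⟩ := nonempty_Ioo.2 (ht (lo + l) (by omega) (by omega))
      rw [← V_top p l x ⟨hx.1.le, hx.2⟩]
      exact hall _ (by omega) (by omega) T le_rfl x hx
  have hsurj := (LinearMap.injective_iff_surjective_of_finrank_eq_finrank (by
    simp only [Module.finrank_prod, Module.finrank_fin_fun, Module.finrank_self, T]
    omega)).1 hinj
  obtain ⟨p, hp⟩ := hsurj (0, 0, 0, r)
  exact ⟨V p, hnull p r hp⟩

end IsNullSpline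

/-! ### The splines `σ` as null splines -/

/-- The weights of the chain `σ, D_{k+1} σ / w_k, …`: the continuous extensions of the weights
divided out by the operators that follow `D_{k+1}`. -/
def chainQ (k : ℕ) (a b : ℝ) (w : ℕ → ℝ → ℝ) (i : ℕ) : ℝ → ℝ :=
  chainWeight k (extW k a b w) (i + 2)

section

variable {k n : ℕ} {a b m B : ℝ} {w : ℕ → ℝ → ℝ} {t : ℕ → ℝ} {i : ℕ} {x : ℝ}

/-- The chain is formally self-adjoint. -/
theorem chainQ_symm (hk : 2 ≤ k) (hi : i ≤ 2 * k - 3) :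
    chainQ k a b w (2 * k - 3 - i) = chainQ k a b w i := by
  unfold chainQ chainWeight
  rw [if_neg (show ¬2 * k - 3 - i + 2 ≤ 1 by omega), if_neg (show ¬i + 2 ≤ 1 by omega)]
  split_ifs with h1 h2 h2
  · omega
  · rw [show k + 2 - (2 * k - 3 - i + 2) = i + 2 - k + 1 by omega]
  · rw [show 2 * k - 3 - i + 2 - k + 1 = k + 2 - (i + 2) by omega]
  · omega

theorem IsBoundedWeights.chainQ (h : IsBoundedWeights m B (extW k a b w)) :
    IsBoundedWeights m B (chainQ k a b w) := by
  have key : ∀ i, ∃ l, ChebSpline.chainQ k a b w i = extW k a b w l := by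
    intro i
    unfold ChebSpline.chainQ chainWeight
    rw [if_neg (by omega)]
    split_ifs
    · exact ⟨_, rfl⟩
    · exact ⟨_, rfl⟩
  refine ⟨h.m_pos, fun i x => ?_, fun i x => ?_, fun i => ?_⟩
  all_goals obtain ⟨l, hl⟩ := key i; rw [hl]
  · exact h.lower l x
  · exact h.upper l x
  · exact h.cont l

theorem chainQ_eq (hk : 2 ≤ k) (hi : i + 2 ≤ 2 * k - 1) (hx : x ∈ Icc a b) :
    chainQ k a b w i x = chainWeight k w (i + 2) x := by
  unfold chainQ chainWeight
  rw [if_neg (show ¬i + 2 ≤ 1 by omega), if_neg (show ¬i + 2 ≤ 1 by omega)]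
  split_ifs
  · exact extW_eq (by omega) (by omega) hx
  · exact extW_eq (by omega) (by omega) hx

theorem chainWeight_one : chainWeight k w 1 = fun _ => 1 := if_pos le_rfl

theorem chainWeight_pos (hw : IsWeights k a b w) (hk : 2 ≤ k) (hi : i ≤ 2 * k - 1)
    (hx : x ∈ Icc a b) : 0 < chainWeight k w i x := by
  unfold chainWeight
  split_ifs
  · exact one_pos
  · exact hw.pos _ (by omega) (by omega) x hx
  · exact hw.pos _ (by omega) (by omega) x hx

theorem continuousOn_chainWeight (hw : IsWeights k a b w) (hk : 2 ≤ k) (hi : i ≤ 2 * k - 1) :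
    ContinuousOn (chainWeight k w i) (Icc a b) := by
  unfold chainWeight
  split_ifs
  · exact continuousOn_const
  · exact (hw.smooth _ (by omega) (by omega)).continuousOn
  · exact (hw.smooth _ (by omega) (by omega)).continuousOn

/-- A continuous function that is differentiable off the knots is a primitive of its derivative. -/
theorem IsPrimitive.of_hasDerivAt_off_countable {f g : ℝ → ℝ} {s : Set ℝ} (hs : s.Countable)
    (hf : ContinuousOn f (Icc a b)) (hd : ∀ x ∈ Ioo a b \ s, HasDerivAt f (g x) x)
    (hg : IntervalIntegrable g volume a b) : IsPrimitive a b f g := by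
  refine ⟨hg, fun x hx => ?_⟩
  rw [integral_eq_of_hasDerivAt_off_countable_of_le f g hx.1 hs
    (hf.mono (Icc_subset_Icc_right hx.2))
    (fun y hy => hd y ⟨⟨hy.1.1, hy.1.2.trans_le hx.2⟩, hy.2⟩)
    (hg.mono_set ?_)]
  · ring
  · rw [uIcc_of_le hx.1, uIcc_of_le (hx.1.trans hx.2)]
    exact Icc_subset_Icc_right hx.2

/-- A spline `σ` is the bottom of the chain of a null spline. -/
theorem IsSigma.exists_isNullSpline {σ : ℝ → ℝ} (h : IsSigma k n w a b t σ) (hk : 2 ≤ k)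
    (hab : a < b) (hw : IsWeights k a b w) (ht : IsKnots k n a b t) :
    ∃ v, IsNullSpline k (chainQ k a b w) t (k - 1) n v ∧ v 0 = σ ∧ v (k - 1) a = 1 / w 2 a := by
  obtain ⟨m, B, hB⟩ := exists_isBoundedWeights hab hw
  have hQ := hB.chainQ
  have hta : t (k - 1) = a := ht.left _ (by omega)
  have htb : t (n + 1) = b := ht.right _ le_rfl (by omega)
  have hle := ht.le
  have hsub : ∀ j, k ≤ j + 1 → j ≤ n → Ioo (t j) (t (j + 1)) ⊆ Ioo a b := fun j h1 h2 =>
    Ioo_subset_Ioo (ht.ge_left (by omega) (by omega)) (ht.le_right (by omega) (by omega))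
  let c : ℕ → ℝ → ℝ := fun i x => SOp k w a b i σ x / chainWeight k w (i + 1) x
  have hS : ∀ i x, SOp k w a b (i + 1) σ x = derivWithin (c i) (Icc a b) x := fun _ _ => rfl
  have hSq : ∀ i, i + 2 ≤ 2 * k - 1 → ∀ x ∈ Icc a b,
      SOp k w a b (i + 1) σ x = chainQ k a b w i x * c (i + 1) x := by
    intro i hi x hx
    rw [chainQ_eq hk hi hx, mul_div_cancel₀ _ (chainWeight_pos hw hk hi hx).ne']
  have hder : ∀ i, i < 2 * k - 1 → ∀ j, k ≤ j + 1 → j ≤ n → ∀ x ∈ Ioo (t j) (t (j + 1)),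
      HasDerivAt (c i) (SOp k w a b (i + 1) σ x) x := by
    intro i hi j h1 h2 x hx
    have hx' := hsub j h1 h2 hx
    have hd := (h.diff j h1 h2 i hi).differentiableAt (Ioo_mem_nhds hx.1 hx.2)
    rw [hS, derivWithin_of_mem_nhds (Icc_mem_nhds hx'.1 hx'.2)]
    exact hd.hasDerivAt
  have hconst : ∀ j, k ≤ j + 1 → j ≤ n → ∃ D, ∀ x ∈ Ioo (t j) (t (j + 1)),
      c (2 * k - 2) x = D := by
    intro j h1 h2
    obtain ⟨y, hy⟩ := nonempty_Ioo.2 (ht.strict j h1 h2)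
    refine ⟨c (2 * k - 2) y, fun x hx => ?_⟩
    refine isOpen_Ioo.is_const_of_deriv_eq_zero isPreconnected_Ioo
      (h.diff j h1 h2 (2 * k - 2) (by omega)) (fun x hx => ?_) hx hy
    have := hder (2 * k - 2) (by omega) j h1 h2 x hx
    rw [show 2 * k - 2 + 1 = 2 * k - 1 by omega, h.ker j h1 h2 x hx] at this
    exact this.deriv
  have hD : ∀ l : Fin (n + 2 - k), ∃ D, ∀ x ∈ Ioo (t (k - 1 + l)) (t (k - 1 + l + 1)),
      c (2 * k - 2) x = D := fun l => hconst _ (by omega) (by omega)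
  choose D hD using hD
  let g := stepFun t (k - 1) (n + 2 - k) D
  have hg : ∀ l : Fin (n + 2 - k), ∀ x ∈ Ico (t (k - 1 + l)) (t (k - 1 + l + 1)), g x = D l :=
    fun l x hx => stepFun_eq (fun i j h1 h2 h3 => ht.mono h2 (by omega)) D l hx
  have hgc : ∀ j, k ≤ j + 1 → j ≤ n → ∀ x ∈ Ioo (t j) (t (j + 1)), c (2 * k - 2) x = g x := by
    intro j h1 h2 x hx
    obtain ⟨l, rfl⟩ := Nat.exists_eq_add_of_le (show k - 1 ≤ j by omega)
    rw [hD ⟨l, by omega⟩ x hx, hg ⟨l, by omega⟩ x ⟨hx.1.le, hx.2⟩]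
  let v : ℕ → ℝ → ℝ := fun i => if i = 2 * k - 2 then g else c i
  have hvc : ∀ i, i < 2 * k - 2 → v i = c i := fun i hi => if_neg hi.ne
  have hvT : v (2 * k - 2) = g := if_pos rfl
  have hc0 : c 0 = σ := by
    funext x
    simp only [c, chainWeight_one, zero_add, div_one]
    rfl
  have hcont : ∀ i, i ≤ 2 * k - 3 → ContinuousOn (c i) (Icc a b) := fun i hi =>
    (h.cont i hi).div (continuousOn_chainWeight hw hk (by omega))
      fun x hx => (chainWeight_pos hw hk (by omega) hx).ne'
  have hend : ∀ i, i + 2 ≤ k → c i a = 0 ∧ c i b = 0 := by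
    intro i hi
    rcases Nat.eq_zero_or_pos i with rfl | h0
    · rw [hc0, ← hta, h.zero _ (by omega) (by omega), ← htb, h.zero _ (by omega) le_rfl]
      exact ⟨rfl, rfl⟩
    · have := h.boundary (k + 2 - i) (by omega) (by omega)
      rw [show k + 2 - (k + 2 - i) = i by omega] at this
      simp only [c, this, zero_div, and_self]
  refine ⟨v, ⟨by omega, fun j h1 h2 => ht.strict j (by omega) h2, ?_, ?_, ?_, ?_, ?_⟩, ?_, ?_⟩
  · intro i hi
    rw [hta, htb, hvc i hi]
    rcases (show i + 1 ≤ 2 * k - 2 by omega).lt_or_eq with h1 | h1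
    · rw [hvc (i + 1) h1]
      refine (IsPrimitive.of_differentiableOn hab (h.diff_glob i (by omega))
        (h.cont (i + 1) (by omega))).congr hab.le (fun _ _ => rfl) fun x hx => ?_
      exact (hSq i (by omega) x (Ioo_subset_Icc_self hx)).symm
    -- the last primitive has a discontinuous derivative: only here the knots are exceptional points
    · rw [h1, hvT]
      refine IsPrimitive.of_hasDerivAt_off_countable
        (s := t '' Iic (n + k)) ((Set.finite_Iic _).image t).countable (hcont i (by omega))
        (fun x hx => ?_) ((intervalIntegrable_stepFun t _ _ D a b).continuousOn_mul
          (hQ.cont i).continuousOn)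
      obtain ⟨j, h2, h3, h4⟩ := ht.exists_mem_Ico (by omega) hx.1.1.le hx.1.2
      have h5 : x ∈ Ioo (t j) (t (j + 1)) := ⟨lt_of_le_of_ne h4.1 fun he =>
        hx.2 ⟨j, mem_Iic.2 (by omega), he⟩, h4.2⟩
      have := hder i (by omega) j h2 h3 x h5
      rwa [hSq i (by omega) x (Ioo_subset_Icc_self hx.1), h1, hgc j h2 h3 x h5] at this
  · intro j h1 h2
    obtain ⟨l, rfl⟩ := Nat.exists_eq_add_of_le h1
    rw [hvT]
    exact ⟨_, hg ⟨l, by omega⟩⟩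
  · intro i hi
    rw [hvc i (by omega), hta]
    exact (hend i hi).1
  · intro i hi
    rw [hvc i (by omega), htb]
    exact (hend i hi).2
  · intro j h1 h2
    rw [hvc 0 (by omega), hc0]
    exact h.zero j (by omega) h2
  · rw [hvc 0 (by omega), hc0]
  · rw [hvc _ (by omega)]
    simp only [c, h.normalized, show k - 1 + 1 = k by omega, chainWeight]
    rw [if_neg (by omega), if_pos le_rfl, show k + 2 - k = 2 by omega]

namespace IsNullSpline

variable {v : ℕ → ℝ → ℝ}

theorem sOp_eq (h : IsNullSpline k (chainQ k a b w) t (k - 1) n v) (hk : 2 ≤ k) (hab : a < b)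
    (hw : IsWeights k a b w) (ht : IsKnots k n a b t) : ∀ i, i ≤ 2 * k - 3 → ∀ x ∈ Icc a b,
      SOp k w a b i (v 0) x / chainWeight k w (i + 1) x = v i x := by
  obtain ⟨m, B, hB⟩ := exists_isBoundedWeights hab hw
  have hta : t (k - 1) = a := ht.left _ (by omega)
  have htb : t (n + 1) = b := ht.right _ le_rfl (by omega)
  intro i
  induction i with
  | zero => intro _ x _; rw [chainWeight_one, div_one]; rfl
  | succ i ih =>
    intro hi x hx
    have hc := h.chain i (by omega)
    have hc' := (h.chain (i + 1) (by omega)).continuousOn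
    rw [hta, htb] at hc hc'
    have hd := (hc.hasDerivWithinAt ((hB.chainQ.cont i).continuousOn.mul hc') hx).congr
      (fun y hy => ih (by omega) y hy) (ih (by omega) x hx)
    have e := hd.derivWithin (uniqueDiffOn_Icc hab x hx)
    have e' : SOp k w a b (i + 1) (v 0) x = chainQ k a b w i x * v (i + 1) x := e
    rw [e', chainQ_eq hk (by omega) hx,
      mul_div_cancel_left₀ _ (chainWeight_pos hw hk (by omega) hx).ne']

/-- Conversely, the bottom of the chain of a normalized null spline is a spline `σ`. -/
theorem isSigma (h : IsNullSpline k (chainQ k a b w) t (k - 1) n v) (hk : 2 ≤ k) (hab : a < b)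
    (hw : IsWeights k a b w) (ht : IsKnots k n a b t) (hv : v (k - 1) a = 1 / w 2 a) :
    IsSigma k n w a b t (v 0) := by
  obtain ⟨m, B, hB⟩ := exists_isBoundedWeights hab hw
  have hQ := hB.chainQ
  have hta : t (k - 1) = a := ht.left _ (by omega)
  have htb : t (n + 1) = b := ht.right _ le_rfl (by omega)
  have hle := ht.le
  have hsub : ∀ j, k ≤ j + 1 → j ≤ n → Ioo (t j) (t (j + 1)) ⊆ Ioo a b := fun j h1 h2 =>
    Ioo_subset_Ioo (ht.ge_left (by omega) (by omega)) (ht.le_right (by omega) (by omega))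
  have hS := h.sOp_eq hk hab hw ht
  have hS' : ∀ i, i ≤ 2 * k - 3 → ∀ x ∈ Icc a b,
      SOp k w a b i (v 0) x = v i x * chainWeight k w (i + 1) x := fun i hi x hx => by
    rw [← hS i hi x hx, div_mul_cancel₀ _ (chainWeight_pos hw hk (by omega) hx).ne']
  have hcont : ∀ i, i ≤ 2 * k - 3 → ContinuousOn (v i) (Icc a b) := fun i hi => by
    have := (h.chain i (by omega)).continuousOn
    rwa [hta, htb] at this
  have hder : ∀ i, i ≤ 2 * k - 3 → ∀ j, k ≤ j + 1 → j ≤ n → ∀ x ∈ Ioo (t j) (t (j + 1)),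
      HasDerivAt (fun y => SOp k w a b i (v 0) y / chainWeight k w (i + 1) y)
        (chainQ k a b w i x * v (i + 1) x) x := by
    intro i hi j h1 h2 x hx
    obtain ⟨D, hD⟩ := h.const j (by omega) h2
    refine ((h.chain_piece (by omega) h2).hasDerivAt hQ.cont
      (fun x hx => hD x ⟨hx.1.le, hx.2⟩) (by omega) hx).congr_of_eventuallyEq ?_
    filter_upwards [Ioo_mem_nhds hx.1 hx.2] with y hy
    exact hS i hi y (Ioo_subset_Icc_self (hsub j h1 h2 hy))
  have htop : ∀ j, k ≤ j + 1 → j ≤ n → ∀ x ∈ Ioo (t j) (t (j + 1)),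
      SOp k w a b (2 * k - 2) (v 0) x / chainWeight k w (2 * k - 2 + 1) x = v (2 * k - 2) x := by
    intro j h1 h2 x hx
    have hx' := hsub j h1 h2 hx
    have e := (hder (2 * k - 3) le_rfl j h1 h2 x hx).hasDerivWithinAt (s := Icc a b)
    have e' := e.derivWithin (uniqueDiffOn_Icc hab x (Ioo_subset_Icc_self hx'))
    rw [show 2 * k - 2 = 2 * k - 3 + 1 by omega]
    have e'' : SOp k w a b (2 * k - 3 + 1) (v 0) x =
      chainQ k a b w (2 * k - 3) x * v (2 * k - 3 + 1) x := e'
    rw [e'', chainQ_eq hk (by omega) (Ioo_subset_Icc_self hx'), mul_div_cancel_left₀ _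
      (chainWeight_pos hw hk (by omega) (Ioo_subset_Icc_self hx')).ne']
  have htopD : ∀ j, k ≤ j + 1 → j ≤ n → ∀ x ∈ Ioo (t j) (t (j + 1)), HasDerivAt
      (fun y => SOp k w a b (2 * k - 2) (v 0) y / chainWeight k w (2 * k - 2 + 1) y) 0 x := by
    intro j h1 h2 x hx
    obtain ⟨D, hD⟩ := h.const j (by omega) h2
    refine (hasDerivAt_const x D).congr_of_eventuallyEq ?_
    filter_upwards [Ioo_mem_nhds hx.1 hx.2] with y hy
    rw [htop j h1 h2 y hy, hD y ⟨hy.1.le, hy.2⟩]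
  refine ⟨fun j h1 h2 i hi => ?_, fun j h1 h2 x hx => ?_, fun i hi => ?_, fun i hi => ?_, ?_,
    fun i h1 h2 => ?_, fun j h1 h2 => h.zero j (by omega) h2⟩
  · rcases (show i ≤ 2 * k - 2 by omega).lt_or_eq with h0 | rfl
    · exact fun x hx => (hder i (by omega) j h1 h2 x hx).differentiableAt.differentiableWithinAt
    · exact fun x hx => (htopD j h1 h2 x hx).differentiableAt.differentiableWithinAt
  · have hx' := hsub j h1 h2 hx
    rw [show 2 * k - 1 = 2 * k - 2 + 1 by omega]
    exact (htopD j h1 h2 x hx).hasDerivWithinAt.derivWithin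
      (uniqueDiffOn_Icc hab x (Ioo_subset_Icc_self hx'))
  · have hc := h.chain i (by omega)
    rw [hta, htb] at hc
    exact fun x hx => ((hc.hasDerivWithinAt ((hQ.cont i).continuousOn.mul
      (hcont (i + 1) (by omega))) hx).congr (fun y hy => hS i (by omega) y hy)
      (hS i (by omega) x hx)).differentiableWithinAt
  · exact ((hcont i hi).mul (continuousOn_chainWeight hw hk (by omega))).congr (hS' i hi)
  · rw [hS' (k - 1) (by omega) a (left_mem_Icc.2 hab.le), hv, show k - 1 + 1 = k by omega]
    have : chainWeight k w k = w 2 := by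
      unfold chainWeight
      rw [if_neg (by omega), if_pos le_rfl, show k + 2 - k = 2 by omega]
    rw [this]
    exact one_div_mul_cancel (hw.pos 2 (by omega) (by omega) a (left_mem_Icc.2 hab.le)).ne'
  · have e1 := h.left (k + 2 - i) (by omega)
    have e2 := h.right (k + 2 - i) (by omega)
    rw [hta] at e1
    rw [htb] at e2
    rw [hS' _ (by omega) a (left_mem_Icc.2 hab.le), hS' _ (by omega) b (right_mem_Icc.2 hab.le),
      e1, e2, zero_mul, zero_mul]
    exact ⟨rfl, rfl⟩

/-- On `[a, b]` the spline `φ` is `w 1 * v (k - 1)`. -/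
theorem phi_eq (h : IsNullSpline k (chainQ k a b w) t (k - 1) n v) (hk : 2 ≤ k) (hab : a < b)
    (hw : IsWeights k a b w) (ht : IsKnots k n a b t) (hx : x ∈ Icc a b) :
    phi k w a b (v 0) x = w 1 x * v (k - 1) x := by
  have := h.sOp_eq hk hab hw ht (k - 1) (by omega) x hx
  rw [show k - 1 + 1 = k by omega] at this
  rw [← this, phi, chainWeight, if_neg (by omega), if_pos le_rfl, show k + 2 - k = 2 by omega]
  ring

end IsNullSpline

end

/-! ### Integration by parts against the B-splines -/

theorem IsPrimitive.integral_mul_eq_neg {a b : ℝ} {f g f' g' : ℝ → ℝ} (h : IsPrimitive a b f g)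
    (h' : IsPrimitive a b f' g') (hab : a ≤ b) (ha : f a = 0) (hb : f b = 0) :
    ∫ x in a..b, g x * f' x = -∫ x in a..b, f x * g' x := by
  have hu : uIcc a b = Icc a b := uIcc_of_le hab
  have e := (h.mul h' hab).integral_eq (left_mem_Icc.2 hab) (right_mem_Icc.2 hab)
  rw [intervalIntegral.integral_add
    (h.integrable.mul_continuousOn (hu ▸ h'.continuousOn))
    (h'.integrable.continuousOn_mul (hu ▸ h.continuousOn)), ha, hb] at e
  linarith

/-- Iterated integration by parts. The coefficients `ρ` depend only on the weights, the last one
is `w 1 ^ 2`, and they lose one derivative in each step. -/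
theorem exists_coeff_integral {k : ℕ} {a b : ℝ} {w : ℕ → ℝ → ℝ} (hab : a < b)
    (hw : IsWeights k a b w) : ∀ s, s + 1 ≤ k → ∃ ρ : ℕ → ℝ → ℝ,
      (∀ r ≤ s, ContDiffOn ℝ ((k - 1 - s : ℕ)) (ρ r) (Icc a b)) ∧
      (∀ x ∈ Icc a b, ρ s x = w 1 x ^ 2) ∧
      ∀ v u : ℕ → ℝ → ℝ,
        (∀ i, i + 2 ≤ k → IsPrimitive a b (v i) (fun x => extW k a b w (k - i) x * v (i + 1) x)) →
        (∀ r, r + 2 ≤ k → IsPrimitive a b (u r) (fun x => extW k a b w (r + 2) x * u (r + 1) x)) →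
        (∀ i, i + 2 ≤ k → v i a = 0 ∧ v i b = 0) →
        ∫ x in a..b, v (k - 1) x * (w 1 x ^ 2 * u 0 x) =
          (-1) ^ s * ∫ x in a..b, v (k - 1 - s) x * ∑ r ∈ Finset.range (s + 1), ρ r x * u r x := by
  intro s
  induction s with
  | zero =>
    intro hk
    refine ⟨fun _ x => w 1 x ^ 2, fun r _ => ?_, fun _ _ => rfl, fun v u _ _ _ => by simp⟩
    exact ((hw.smooth 1 le_rfl hk).of_le (by exact_mod_cast (by omega))).pow 2
  | succ s ih =>
    intro hk
    obtain ⟨ρ, hρ, hρs, hint⟩ := ih (by omega)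
    have hud : UniqueDiffOn ℝ (Icc a b) := uniqueDiffOn_Icc hab
    have hwne : ∀ x ∈ Icc a b, w (s + 2) x ≠ 0 := fun x hx =>
      (hw.pos (s + 2) (by omega) (by omega) x hx).ne'
    let f : ℕ → ℝ → ℝ := fun r x => ρ r x / w (s + 2) x
    have hf : ∀ r ≤ s, ContDiffOn ℝ ((k - 1 - s : ℕ)) (f r) (Icc a b) := fun r hr =>
      (hρ r hr).div ((hw.smooth (s + 2) (by omega) (by omega)).of_le
        (by exact_mod_cast (by omega))) hwne
    have hf' : ∀ r ≤ s, ContDiffOn ℝ ((k - 1 - (s + 1) : ℕ)) (derivWithin (f r) (Icc a b))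
        (Icc a b) := fun r hr => (hf r hr).derivWithin hud
          (by exact_mod_cast (by omega : k - 1 - (s + 1) + 1 ≤ k - 1 - s))
    have hfp : ∀ r ≤ s, IsPrimitive a b (f r) (derivWithin (f r) (Icc a b)) := fun r hr =>
      IsPrimitive.of_differentiableOn hab ((hf r hr).differentiableOn
        (by exact_mod_cast (by omega : k - 1 - s ≠ 0))) (hf' r hr).continuousOn
    -- the coefficients of `u r` after differentiating `∑ ρ r / w (s + 2) * u r`
    refine ⟨fun r x => (if r ≤ s then derivWithin (f r) (Icc a b) x else 0) +
      (if 1 ≤ r then f (r - 1) x * w (r + 1) x else 0), fun r hr => ?_, fun x hx => ?_,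
      fun v u hv hu hend => ?_⟩
    · refine ContDiffOn.add ?_ ?_
      · split_ifs with h
        · exact hf' r h
        · exact contDiffOn_const
      · split_ifs with h
        · exact ((hf (r - 1) (by omega)).of_le (by exact_mod_cast (by omega))).mul
            ((hw.smooth (r + 1) (by omega) (by omega)).of_le (by exact_mod_cast (by omega)))
        · exact contDiffOn_const
    · beta_reduce
      rw [if_neg (show ¬s + 1 ≤ s by omega), if_pos (show 1 ≤ s + 1 by omega), zero_add,
        Nat.add_sub_cancel]
      simp only [f]
      rw [hρs x hx, div_mul_cancel₀ _ (hwne x hx)]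
    · obtain ⟨i, hi⟩ : ∃ i, k - 1 - s = i + 1 := ⟨k - 1 - s - 1, by omega⟩
      have hi' : k - 1 - (s + 1) = i := by omega
      have hprod : IsPrimitive a b (fun x => ∑ r ∈ Finset.range (s + 1), f r x * u r x)
          (fun x => ∑ r ∈ Finset.range (s + 1), (derivWithin (f r) (Icc a b) x * u r x +
            f r x * (extW k a b w (r + 2) x * u (r + 1) x))) :=
        IsPrimitive.sum fun r hr => (hfp r (by have := Finset.mem_range.1 hr; omega)).mul
          (hu r (by have := Finset.mem_range.1 hr; omega)) hab.le
      have key := (hv i (by omega)).integral_mul_eq_neg hprod hab.le (hend i (by omega)).1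
        (hend i (by omega)).2
      rw [hint v u hv hu hend, hi, hi', pow_succ, mul_assoc, neg_one_mul]
      congr 1
      have hu' : uIcc a b = Icc a b := uIcc_of_le hab.le
      refine Eq.trans ?_ (key.trans (congrArg Neg.neg ?_))
      · refine intervalIntegral.integral_congr fun x hx => ?_
        rw [hu'] at hx
        simp only [f]
        rw [show k - i = s + 2 by omega, extW_eq (by omega) (by omega) hx, mul_right_comm,
          mul_comm, Finset.mul_sum]
        congr 1
        refine Finset.sum_congr rfl fun r _ => ?_
        have := hwne x hx
        field_simp
      · refine intervalIntegral.integral_congr fun x hx => ?_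
        rw [hu'] at hx
        simp only [add_mul, Finset.sum_add_distrib]
        congr 2
        · rw [Finset.sum_range_succ _ (s + 1), if_neg (show ¬s + 1 ≤ s by omega), zero_mul,
            add_zero]
          exact Finset.sum_congr rfl fun r hr => by
            rw [if_pos (by have := Finset.mem_range.1 hr; omega)]
        · rw [Finset.sum_range_succ' _ (s + 1), if_neg (by omega), zero_mul, add_zero]
          refine Finset.sum_congr rfl fun r hr => ?_
          have := Finset.mem_range.1 hr
          rw [if_pos (by omega), Nat.add_sub_cancel, extW_eq (by omega) (by omega) hx]
          ring

/-! ### The lower bound for the inner products -/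

theorem IsKnots.sub_le_mesh {k n : ℕ} {a b : ℝ} {t : ℕ → ℝ} {i : ℕ} (ht : IsKnots k n a b t)
    (hi : i < n + k) : t (i + 1) - t i ≤ mesh n t := by
  rcases le_or_gt i n with h | h
  · exact Finset.le_sup' (fun i => t (i + 1) - t i) (Finset.mem_range.2 (by omega))
  · rw [ht.right i (by omega) (by omega), ht.right (i + 1) (by omega) (by omega), sub_self]
    have hle := ht.le
    refine le_trans ?_ (Finset.le_sup' (fun i => t (i + 1) - t i)
      (Finset.mem_range.2 (Nat.lt_succ_self n)))
    exact sub_nonneg.2 (ht.strict n hle le_rfl).le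

theorem IsKnots.support_le {k n j : ℕ} {a b : ℝ} {t : ℕ → ℝ} (ht : IsKnots k n a b t)
    (hj : j ≤ n) : t (j + k) - t j ≤ k * mesh n t := by
  have e : ∑ i ∈ Finset.range k, (t (j + (i + 1)) - t (j + i)) = t (j + k) - t j := by
    rw [Finset.sum_range_sub (fun i => t (j + i)), add_zero]
  rw [← e, ← nsmul_eq_mul]
  refine (Finset.sum_le_card_nsmul _ _ (mesh n t) fun i hi => ?_).trans (by simp)
  have := Finset.mem_range.1 hi
  exact ht.sub_le_mesh (i := j + i) (by omega)

/-- Among the `k` knot intervals in the support of a B-spline, one has at least the average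
length; it is not degenerate. -/
theorem IsKnots.exists_long {k n j : ℕ} {a b : ℝ} {t : ℕ → ℝ} (ht : IsKnots k n a b t)
    (hk : 0 < k) (hj : j ≤ n) : ∃ p, j ≤ p ∧ p < j + k ∧ k ≤ p + 1 ∧ p ≤ n ∧
      (t (j + k) - t j) / k ≤ t (p + 1) - t p := by
  have e : ∑ i ∈ Finset.range k, (t (j + (i + 1)) - t (j + i)) = t (j + k) - t j := by
    rw [Finset.sum_range_sub (fun i => t (j + i)), add_zero]
  have hk' : (0 : ℝ) < k := by exact_mod_cast hk
  obtain ⟨i, hi, hle⟩ := Finset.exists_le_of_sum_le (s := Finset.range k)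
    (f := fun _ => (t (j + k) - t j) / k) (g := fun i => t (j + (i + 1)) - t (j + i))
    ⟨0, Finset.mem_range.2 hk⟩ (by
      rw [e, Finset.sum_const, Finset.card_range, nsmul_eq_mul, mul_div_cancel₀ _ hk'.ne'])
  have hi' := Finset.mem_range.1 hi
  have hpos : 0 < (t (j + k) - t j) / k :=
    div_pos (sub_pos.2 (ht.lt (by omega) (by omega) (by omega) hj)) hk'
  have hlt : t (j + i) < t (j + i + 1) := sub_pos.1 (hpos.trans_le hle)
  refine ⟨j + i, by omega, by omega, ?_, ?_, hle⟩
  · by_contra hcon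
    rw [ht.left _ (by omega), ht.left _ (by omega)] at hlt
    exact lt_irrefl _ hlt
  · by_contra hcon
    rw [ht.right _ (by omega) (by omega), ht.right _ (by omega) (by omega)] at hlt
    exact lt_irrefl _ hlt

section

variable {k n : ℕ} {a b : ℝ} {W : ℕ → ℝ → ℝ} {t : ℕ → ℝ} {j : ℕ} {x m B R : ℝ}

local notation "mass" => bmass k n a b W t
local notation "der" => bder k n a b W t

/-- If the support of a B-spline is short, its highest derivative dominates all lower ones, and
the sum `∑ ρ r * der r` takes the alternating sign of the highest derivative. -/
theorem dominant_sum (ht : IsKnots k n a b t) (hk : 2 ≤ k) (hW : IsBoundedWeights m B W)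
    (hj : j ≤ n) {ρ : ℕ → ℝ → ℝ} (hρ : ∀ r < k - 1, |ρ r x| ≤ R) (hρk : m ^ 2 ≤ ρ (k - 1) x)
    (hK1 : B * (t (j + k) - t j) ≤ 1) (hKR : k * R * (B * (t (j + k) - t j)) ≤ m ^ 2 / 2)
    {p : ℕ} (hp : k ≤ p + 1) (hpn : p ≤ n) (hx : x ∈ Ioo (t p) (t (p + 1)))
    (hjp : j ≤ p) (hpj : p < j + k) :
    1 ≤ (B * (t (j + k) - t j)) ^ (k - 1) * |der (k - 1) (k - 1) j x| ∧
      m ^ 2 / 2 * |der (k - 1) (k - 1) j x| ≤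
        (-1) ^ (p + j) * ∑ r ∈ Finset.range k, ρ r x * der r (k - 1) j x := by
  have hx' : x ∈ Ico (t p) (t (p + 1)) := ⟨hx.1.le, hx.2⟩
  have hxab : x ∈ Icc a b := ⟨(ht.ge_left (by omega) (by omega)).trans hx.1.le,
    hx.2.le.trans (ht.le_right (by omega) (by omega))⟩
  have hpos := massPos ht (by omega) hW
  have hB : 0 < B := (hW.pos 0 0).trans_le (hW.upper 0 0)
  have hL : 0 < t (j + k) - t j := sub_pos.2 (ht.lt (by omega) (by omega) (by omega) hj)
  set K := B * (t (j + k) - t j) with hKdef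
  have hK0 : 0 < K := mul_pos hB hL
  have hR : 0 ≤ R := (abs_nonneg _).trans (hρ 0 (by omega))
  have hs : MassPos k n a b W t (k - 1) := hpos.mono (by omega)
  obtain ⟨h1, h2⟩ := bder_bounds ht hs (s := k - 1) (j := j) (by omega) hK0.le
    (fun i l hi hjl hl hkl hln => (bmass_le ht (by omega) hW (by omega) (by omega)).trans
      (mul_le_mul_of_nonneg_left (sub_le_sub (ht.mono (by omega) (by omega))
        (ht.mono hjl (by omega))) hB.le))
    (fun i l hi hl => abs_bsp_le_one ht (by omega) hW (by omega) hl hxab)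
    hp hpn (by omega) hx' hjp (by omega)
  refine ⟨h1, ?_⟩
  have hsgn := bder_top_sign ht hs (s := k - 1) (j := j) (by omega) hpn hx'
  set d := |der (k - 1) (k - 1) j x| with hd
  have hd0 : 0 ≤ d := abs_nonneg _
  have htop : (-1) ^ (p + j) * der (k - 1) (k - 1) j x = d := by
    rw [← abs_of_nonneg hsgn, abs_mul, abs_neg_one_pow, one_mul]
  have hlow : |(-1) ^ (p + j) * ∑ r ∈ Finset.range (k - 1), ρ r x * der r (k - 1) j x| ≤
      m ^ 2 / 2 * d := by
    rw [abs_mul, abs_neg_one_pow, one_mul]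
    calc _ ≤ ∑ r ∈ Finset.range (k - 1), |ρ r x * der r (k - 1) j x| :=
          Finset.abs_sum_le_sum_abs _ _
      _ ≤ ∑ r ∈ Finset.range (k - 1), R * (K * d) := by
          refine Finset.sum_le_sum fun r hr => ?_
          have hr' := Finset.mem_range.1 hr
          rw [abs_mul]
          refine mul_le_mul (hρ r hr') ((h2 r hr'.le).trans ?_) (abs_nonneg _) hR
          refine mul_le_mul_of_nonneg_right ?_ hd0
          exact (pow_le_pow_of_le_one hK0.le hK1 (by omega : 1 ≤ k - 1 - r)).trans (pow_one K).le
      _ = (k - 1 : ℕ) * (R * (K * d)) := by simp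
      _ ≤ k * (R * (K * d)) := by
          refine mul_le_mul_of_nonneg_right ?_ (by positivity)
          exact_mod_cast Nat.sub_le k 1
      _ = k * R * K * d := by ring
      _ ≤ _ := by gcongr
  rw [show Finset.range k = Finset.range (k - 1 + 1) by rw [Nat.sub_add_cancel (by omega)],
    Finset.sum_range_succ, mul_add, mul_left_comm, htop]
  have := neg_le_of_abs_le hlow
  nlinarith [mul_le_mul_of_nonneg_right hρk hd0]

end

section

variable {k n : ℕ} {a b : ℝ} {w : ℕ → ℝ → ℝ} {t : ℕ → ℝ} {j : ℕ} {v : ℕ → ℝ → ℝ}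

local notation "mass" => bmass k n a b (extW k a b w) t
local notation "der" => bder k n a b (extW k a b w) t

theorem isPrimitive_bder_top {m B : ℝ} (hW : IsBoundedWeights m B (extW k a b w)) (r : ℕ)
    (hr : r + 2 ≤ k) :
    IsPrimitive a b (der r (k - 1) j)
      (fun x => extW k a b w (r + 2) x * der (r + 1) (k - 1) j x) := by
  have := isPrimitive_bder (k := k) (n := n) (a := a) (b := b) (t := t) hW.cont
    (show r < k - 1 by omega) (Nat.sub_le k 1) j
  rwa [show k + 1 + r - (k - 1) = r + 2 by omega] at this

theorem intervalIntegrable_bder_top {m B : ℝ} (hk : 2 ≤ k)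
    (hW : IsBoundedWeights m B (extW k a b w)) (hab : a < b) {r : ℕ} (hr : r < k) :
    IntervalIntegrable (der r (k - 1) j) volume a b := by
  rcases (show r + 1 ≤ k by omega).lt_or_eq with h | h
  · have := (isPrimitive_bder_top (n := n) (t := t) (j := j) hW r h).continuousOn
    exact this.intervalIntegrable_of_Icc hab.le
  · have h1 := (isPrimitive_bder_top (n := n) (t := t) (j := j) hW (k - 2) (by omega)).integrable
    rw [show k - 2 + 1 = r by omega] at h1
    have h2 := h1.continuousOn_mul
      ((hW.cont (k - 2 + 2)).inv₀ fun x => (hW.pos _ x).ne').continuousOn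
    simpa only [Pi.inv_apply, inv_mul_cancel_left₀ (hW.pos (k - 2 + 2) _).ne'] using h2

/-- The inner product of `φ` with a B-spline, up to the normalization of the latter. -/
theorem IsNullSpline.ip_eq (h : IsNullSpline k (chainQ k a b w) t (k - 1) n v) (hk : 2 ≤ k)
    (hab : a < b) (hw : IsWeights k a b w) (ht : IsKnots k n a b t) (hj : j ≤ n) :
    ip a b (phi k w a b (v 0)) (bspline k w a b t j) =
      (mass (k - 1) j)⁻¹ * ∫ x in a..b, v (k - 1) x * (w 1 x ^ 2 * der 0 (k - 1) j x) := by
  obtain ⟨m, B, hB⟩ := exists_isBoundedWeights hab hw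
  rw [ip, ← intervalIntegral.integral_const_mul, intervalIntegral.integral_of_le hab.le,
    intervalIntegral.integral_of_le hab.le, integral_Ioc_eq_integral_Ioo,
    integral_Ioc_eq_integral_Ioo]
  refine setIntegral_congr_fun measurableSet_Ioo fun x hx => ?_
  have hx' := Ioo_subset_Icc_self hx
  simp only [h.phi_eq hk hab hw ht hx', bspline_eq hab ht hk hB
    (fun i h1 h2 x hx => extW_eq h1 h2 hx) hx hj, extW_eq le_rfl (by omega : 1 ≤ k) hx', bder]
  ring

/-- For fine knots the inner products of `φ` with the B-splines alternate in sign and are bounded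
away from zero: after integration by parts the integrand is, up to one sign, nonnegative, and on
the longest knot interval in the support of the B-spline it is large enough. -/
theorem exists_le_ip (hk : 2 ≤ k) (hab : a < b) (hw : IsWeights k a b w) :
    ∃ ε > 0, ∃ c > 0, ∀ (n : ℕ) (t : ℕ → ℝ) (v : ℕ → ℝ → ℝ), IsKnots k n a b t →
      IsNullSpline k (chainQ k a b w) t (k - 1) n v → v (k - 1) a = 1 / w 2 a → mesh n t ≤ ε →
      ∃ e : ℝ, |e| = 1 ∧ ∀ j ≤ n,
        c ≤ e * (-1) ^ j * ip a b (phi k w a b (v 0)) (bspline k w a b t j) := by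
  obtain ⟨m, B, hW⟩ := exists_isBoundedWeights hab hw
  have hm := hW.m_pos
  have hB : 0 < B := (hW.pos 0 0).trans_le (hW.upper 0 0)
  obtain ⟨C, hC, hCle⟩ := exists_le_integral k hk m B hm hB
  obtain ⟨ρ, hρ, hρk, hparts⟩ := exists_coeff_integral hab hw (k - 1) (by omega)
  have hρc : ∀ r < k, ContinuousOn (ρ r) (Icc a b) := fun r hr => (hρ r (by omega)).continuousOn
  obtain ⟨R, hR, hρR⟩ : ∃ R > 0, ∀ r < k, ∀ x ∈ Icc a b, |ρ r x| ≤ R := by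
    have : ContinuousOn (fun x => ∑ r ∈ Finset.range k, |ρ r x|) (Icc a b) :=
      continuousOn_finsetSum _ fun r hr => (hρc r (Finset.mem_range.1 hr)).abs
    obtain ⟨R, hR⟩ := isCompact_Icc.exists_bound_of_continuousOn this
    refine ⟨max R 1, by positivity, fun r hr x hx => ?_⟩
    exact (Finset.single_le_sum (f := fun r => |ρ r x|) (fun i _ => abs_nonneg _)
      (Finset.mem_range.2 hr)).trans ((le_abs_self _).trans ((hR x hx).trans (le_max_left _ _)))
  have hw2 : 0 < w 2 a := hw.pos 2 (by omega) hk a (left_mem_Icc.2 hab.le)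
  have hk0 : (0 : ℝ) < k := by exact_mod_cast (by omega : 0 < k)
  -- the support has length at most `k * ε`, and the mass of a B-spline at most `B` times that: the
  -- first bound on `ε` makes it at most `1`, the second one makes lower derivatives negligible
  refine ⟨min (1 / (B * k)) (m ^ 2 / (2 * (k * R * (B * k)))), by positivity,
    m ^ 2 / 2 / (C * w 2 a * (B ^ k * k ^ k)), by positivity, fun n t v ht h hv hmesh => ?_⟩
  have hta : t (k - 1) = a := ht.left _ (by omega)
  have htb : t (n + 1) = b := ht.right _ le_rfl (by omega)
  have hQ := hW.chainQ
  have hsym : ∀ i, i ≤ 2 * k - 3 → chainQ k a b w (2 * k - 3 - i) = chainQ k a b w i :=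
    fun i hi => chainQ_symm hk hi
  have hva : v (k - 1) (t (k - 1)) ≠ 0 := by
    rw [hta, hv]; exact (one_div_pos.2 hw2).ne'
  obtain ⟨e, he, hsgn⟩ := h.exists_sign hk hQ.pos (h.nondegenerate hk hQ hsym hva)
  refine ⟨e * (-1) ^ (k - 1), by rw [abs_mul, he, abs_neg_one_pow, one_mul], fun j hj => ?_⟩
  have hlej := ht.le
  set L := t (j + k) - t j with hL
  have hL0 : 0 < L := sub_pos.2 (ht.lt (by omega) (by omega) (by omega) hj)
  have hLε := ht.support_le hj
  have hBk : 0 < B * k := mul_pos hB hk0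
  have hBL : B * L ≤ B * k * mesh n t := by
    rw [mul_assoc]; exact mul_le_mul_of_nonneg_left hLε hB.le
  have hK1 : B * L ≤ 1 := by
    have := (le_div_iff₀ hBk).1 (hmesh.trans (min_le_left _ _))
    linarith
  have hKR : k * R * (B * L) ≤ m ^ 2 / 2 := by
    have h1 := (le_div_iff₀ (by positivity)).1 (hmesh.trans (min_le_right _ _))
    have h2 : k * R * (B * L) ≤ k * R * (B * k * mesh n t) := by gcongr
    linarith
  have hdom : ∀ p, k ≤ p + 1 → p ≤ n → ∀ x ∈ Ioo (t p) (t (p + 1)), j ≤ p → p < j + k →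
      1 ≤ (B * L) ^ (k - 1) * |bder k n a b (extW k a b w) t (k - 1) (k - 1) j x| ∧
      m ^ 2 / 2 * |bder k n a b (extW k a b w) t (k - 1) (k - 1) j x| ≤
        (-1) ^ (p + j) * ∑ r ∈ Finset.range k,
          ρ r x * bder k n a b (extW k a b w) t r (k - 1) j x := by
    intro p hp hpn x hx hjp hpj
    have hxab : x ∈ Icc a b := ⟨(ht.ge_left (by omega) (by omega)).trans hx.1.le,
      hx.2.le.trans (ht.le_right (by omega) (by omega))⟩
    refine dominant_sum ht hk hW hj (fun r hr => hρR r (by omega) x hxab) ?_ hK1 hKR hp hpn hx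
      hjp hpj
    rw [hρk x hxab, ← extW_eq (w := w) le_rfl (by omega : 1 ≤ k) hxab]
    exact pow_le_pow_left₀ hm.le (hW.lower 1 x) 2
  set G : ℝ → ℝ := fun x => v 0 x * ∑ r ∈ Finset.range k,
    ρ r x * bder k n a b (extW k a b w) t r (k - 1) j x with hG
  have hint : IntervalIntegrable (fun x => e * (-1) ^ j * G x) volume a b := by
    have h1 := (h.prim_zero hk).continuousOn
    rw [hta, htb] at h1
    have hu : uIcc a b = Icc a b := uIcc_of_le hab.le
    refine IntervalIntegrable.const_mul ?_ _
    refine IntervalIntegrable.continuousOn_mul ?_ (hu ▸ h1)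
    have := IntervalIntegrable.sum (μ := volume) (a := a) (b := b) (Finset.range k)
      (f := fun r x => ρ r x * bder k n a b (extW k a b w) t r (k - 1) j x) fun r hr =>
      (intervalIntegrable_bder_top (n := n) (t := t) (j := j) hk hW hab
        (Finset.mem_range.1 hr)).continuousOn_mul (hu ▸ hρc r (Finset.mem_range.1 hr))
    simpa only [Finset.sum_fn] using this
  have hpt : ∀ p, k ≤ p + 1 → p ≤ n → ∀ x ∈ Ioo (t p) (t (p + 1)), j ≤ p → p < j + k →
      m ^ 2 / 2 * |bder k n a b (extW k a b w) t (k - 1) (k - 1) j x| * |v 0 x| ≤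
        e * (-1) ^ j * G x := by
    intro p hp hpn x hx hjp hpj
    have h1 := (hdom p hp hpn x hx hjp hpj).2
    have h2 := hsgn p (by omega) hpn x hx
    have h3 : |v 0 x| = e * (-1) ^ p * v 0 x := by
      rw [← abs_of_nonneg h2, abs_mul, abs_mul, he, abs_neg_one_pow, one_mul, one_mul]
    have h4 : ((-1 : ℝ) ^ p) * (-1) ^ p = 1 := by rw [← mul_pow]; simp
    calc _ ≤ ((-1) ^ (p + j) * ∑ r ∈ Finset.range k,
            ρ r x * bder k n a b (extW k a b w) t r (k - 1) j x) * |v 0 x| :=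
          mul_le_mul_of_nonneg_right h1 (abs_nonneg _)
      _ = (-1) ^ p * (-1) ^ p * (e * (-1) ^ j * G x) := by
          rw [h3, pow_add, hG]; ring
      _ = _ := by rw [h4, one_mul]
  have hnn : ∀ x ∈ Ioo a b, x ∉ t '' Iic (n + k) → 0 ≤ e * (-1) ^ j * G x := by
    intro x hx hxt
    obtain ⟨p, h2, h3, h4⟩ := ht.exists_mem_Ico (by omega) hx.1.le hx.2
    have h5 : x ∈ Ioo (t p) (t (p + 1)) := ⟨lt_of_le_of_ne h4.1 fun he =>
      hxt ⟨p, mem_Iic.2 (by omega), he⟩, h4.2⟩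
    by_cases h6 : j ≤ p ∧ p < j + k
    · exact le_trans (by positivity) (hpt p h2 h3 x h5 h6.1 h6.2)
    · have h7 : G x = 0 := by
        rw [hG]
        beta_reduce
        rw [Finset.sum_eq_zero, mul_zero]
        intro r _
        rw [bder_eq_zero ht (by omega) ((massPos ht (by omega) hW).mono (by omega : k - 1 ≤ k + 1))
          (by omega) h3 h4 (by omega), mul_zero]
      rw [h7, mul_zero]
  -- the lower bound comes from the longest knot interval in the support
  obtain ⟨p, hjp, hpj, hp, hpn, hlong⟩ := ht.exists_long (by omega) hj
  have hap := ht.ge_left (by omega) (show p ≤ n + k by omega)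
  have hpb := ht.le_right (by omega) (show p + 1 ≤ n + k by omega)
  have hlt := ht.strict p hp hpn
  set d := t (p + 1) - t p with hd
  have hd0 : 0 < d := sub_pos.2 hlt
  have hae : 0 ≤ᵐ[volume.restrict (Ioc a b)] fun x => e * (-1) ^ j * G x := by
    rw [EventuallyLE, ae_restrict_iff' measurableSet_Ioc]
    have hcount : (insert b (t '' Iic (n + k))).Countable :=
      (((Set.finite_Iic _).image t).insert b).countable
    filter_upwards [hcount.ae_notMem volume] with x hx hxab
    exact hnn x ⟨hxab.1, lt_of_le_of_ne hxab.2 fun he => hx (he ▸ mem_insert _ _)⟩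
      fun hx' => hx (mem_insert_of_mem _ hx')
  have hv0 : IntervalIntegrable (fun x => |v 0 x|) volume (t p) (t (p + 1)) :=
    ((h.chain_piece (by omega) hpn 0 (by omega)).continuousOn.abs).intervalIntegrable_of_Icc hlt.le
  have hlow : m ^ 2 / 2 / (B * L) ^ (k - 1) * (L ^ k / (k ^ k * C * w 2 a)) ≤
      ∫ x in a..b, e * (-1) ^ j * G x := by
    have hBLk : 0 < (B * L) ^ (k - 1) := by positivity
    calc _ ≤ m ^ 2 / 2 / (B * L) ^ (k - 1) * ∫ x in t p..t (p + 1), |v 0 x| := by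
          refine mul_le_mul_of_nonneg_left ?_ (by positivity)
          have h1 := hCle _ v t (k - 1) n p hQ hsym h (by omega) hpn
          rw [hta, hv, abs_of_pos (one_div_pos.2 hw2)] at h1
          have h2 : (L / k) ^ k ≤ d ^ k := pow_le_pow_left₀ (by positivity) hlong k
          rw [div_le_iff₀ (by positivity)]
          rw [div_pow, div_le_iff₀ (by positivity)] at h2
          rw [one_div, inv_mul_le_iff₀ hw2] at h1
          calc L ^ k ≤ d ^ k * k ^ k := h2
            _ ≤ (w 2 a * (C * ∫ x in t p..t (p + 1), |v 0 x|)) * k ^ k := by gcongr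
            _ = _ := by ring
      _ = ∫ x in t p..t (p + 1), m ^ 2 / 2 / (B * L) ^ (k - 1) * |v 0 x| := by
          rw [intervalIntegral.integral_const_mul]
      _ ≤ ∫ x in t p..t (p + 1), e * (-1) ^ j * G x := by
          refine intervalIntegral.integral_mono_on_of_le_Ioo hlt.le (hv0.const_mul _)
            (hint.mono_set ?_) fun x hx => ?_
          · rw [uIcc_of_le hlt.le, uIcc_of_le hab.le]
            exact Icc_subset_Icc hap hpb
          · refine le_trans ?_ (hpt p hp hpn x hx hjp hpj)
            refine mul_le_mul_of_nonneg_right ?_ (abs_nonneg _)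
            rw [div_le_iff₀ hBLk, mul_assoc]
            have := (hdom p hp hpn x hx hjp hpj).1
            rw [mul_comm] at this
            exact le_mul_of_one_le_right (by positivity) this
      _ ≤ _ := intervalIntegral.integral_mono_interval hap hlt.le hpb hae hint
  have hmpos : 0 < bmass k n a b (extW k a b w) t (k - 1) j :=
    massPos ht (by omega) hW (k - 1) j (by omega) (by omega) (by omega) hj
  have hmle : bmass k n a b (extW k a b w) t (k - 1) j ≤ B * L := by
    have := bmass_le ht (by omega) hW (s := k - 1) (j := j) (by omega) (by omega)
    rwa [show j + (k - 1) + 1 = j + k by omega] at this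
  have hchain : ∀ i, i + 2 ≤ k → IsPrimitive a b (v i)
      (fun x => extW k a b w (k - i) x * v (i + 1) x) := by
    intro i hi
    have h1 := h.chain i (by omega)
    have h2 : chainQ k a b w i = extW k a b w (k - i) := by
      rw [chainQ, chainWeight, if_neg (by omega), if_pos hi, show k + 2 - (i + 2) = k - i by omega]
    rwa [hta, htb, h2] at h1
  have hends : ∀ i, i + 2 ≤ k → v i a = 0 ∧ v i b = 0 := fun i hi =>
    ⟨hta ▸ h.left i hi, htb ▸ h.right i hi⟩
  have hip := hparts v (fun r => bder k n a b (extW k a b w) t r (k - 1) j) hchain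
    (fun r hr => isPrimitive_bder_top hW r hr) hends
  rw [Nat.sub_self, Nat.sub_add_cancel (by omega)] at hip
  have hneg : ((-1 : ℝ) ^ (k - 1)) * (-1) ^ (k - 1) = 1 := by rw [← mul_pow]; simp
  rw [h.ip_eq hk hab hw ht hj, hip]
  calc m ^ 2 / 2 / (C * w 2 a * (B ^ k * k ^ k))
      = (B * L)⁻¹ * (m ^ 2 / 2 / (B * L) ^ (k - 1) * (L ^ k / (k ^ k * C * w 2 a))) := by
        obtain ⟨K, hK⟩ : ∃ K, k = K + 1 := ⟨k - 1, by omega⟩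
        have hkk : (k : ℝ) ^ k ≠ 0 := by positivity
        have e1 : (B * L) ^ (k - 1) * (B * L) = B ^ k * L ^ k := by
          rw [← pow_succ, Nat.sub_add_cancel (by omega), mul_pow]
        have e2 : (B * L)⁻¹ * (m ^ 2 / 2 / (B * L) ^ (k - 1) * (L ^ k / (k ^ k * C * w 2 a))) =
          m ^ 2 / 2 * L ^ k / (((B * L) ^ (k - 1) * (B * L)) * (k ^ k * C * w 2 a)) := by
          field_simp
        rw [e2, e1]
        field_simp
    _ ≤ (bmass k n a b (extW k a b w) t (k - 1) j)⁻¹ * ∫ x in a..b, e * (-1) ^ j * G x := by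
        refine mul_le_mul ((inv_le_inv₀ (by positivity) hmpos).2 hmle) hlow (by positivity)
          (inv_nonneg.2 hmpos.le)
    _ = (-1) ^ (k - 1) * (-1) ^ (k - 1) *
          ((bmass k n a b (extW k a b w) t (k - 1) j)⁻¹ * ∫ x in a..b, e * (-1) ^ j * G x) := by
        rw [hneg, one_mul]
    _ = _ := by rw [intervalIntegral.integral_const_mul]; ring

end

end ChebSpline

end

theorem mainTheorem6 (k : ℕ) (hk : 2 ≤ k) (a b : ℝ) (hab : a < b) (w : ℕ → ℝ → ℝ)
    (hw : ChebSpline.IsWeights k a b w) :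
    ∃ ε : ℝ, 0 < ε ∧ ∃ c : ℝ, 0 < c ∧
      ∀ (n : ℕ) (t : ℕ → ℝ), ChebSpline.IsKnots k n a b t →
        ∃ σ : ℝ → ℝ, ChebSpline.IsSigma k n w a b t σ ∧
          (∀ τ : ℝ → ℝ, ChebSpline.IsSigma k n w a b t τ → Set.EqOn τ σ (Set.Icc a b)) ∧
          (ChebSpline.mesh n t ≤ ε →
            (∀ j, j < n →
              ChebSpline.ip a b (ChebSpline.phi k w a b σ) (ChebSpline.bspline k w a b t j) *
                ChebSpline.ip a b (ChebSpline.phi k w a b σ)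
                  (ChebSpline.bspline k w a b t (j + 1)) < 0) ∧
            (∀ j, j ≤ n →
              c ≤ |ChebSpline.ip a b (ChebSpline.phi k w a b σ)
                (ChebSpline.bspline k w a b t j)|)) := by
  obtain ⟨m, B, hW⟩ := ChebSpline.exists_isBoundedWeights hab hw
  obtain ⟨ε, hε, c, hc, hip⟩ := ChebSpline.exists_le_ip hk hab hw
  refine ⟨ε, hε, c, hc, fun n t ht => ?_⟩
  have hle := ht.le
  have hta : t (k - 1) = a := ht.left _ (by omega)
  have htb : t (n + 1) = b := ht.right _ le_rfl (by omega)
  obtain ⟨v, hv, hva⟩ := ChebSpline.IsNullSpline.exists_of_value hk hW.chainQ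
    (show k - 1 ≤ n by omega) (fun j h1 h2 => ht.strict j (by omega) h2) (1 / w 2 a)
  have hva' : v (k - 1) a = 1 / w 2 a := by rw [← hva, hta]
  refine ⟨v 0, hv.isSigma hk hab hw ht hva', fun τ hτ => ?_, fun hmesh => ?_⟩
  · obtain ⟨u, hu, rfl, hua⟩ := hτ.exists_isNullSpline hk hab hw ht
    have := hu.unique hv hk hW.chainQ (by rw [hva, hta, hua])
    rwa [hta, htb] at this
  · obtain ⟨e, he, hle⟩ := hip n t v ht hv hva' hmesh
    refine ⟨fun j hj => ?_, fun j hj => ?_⟩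
    · have h1 := hc.trans_le (hle j hj.le)
      have h2 := hc.trans_le (hle (j + 1) hj)
      have h3 : e ^ 2 = 1 := by rw [← sq_abs, he, one_pow]
      have h4 : ((-1 : ℝ) ^ j) ^ 2 = 1 := by rw [← pow_mul, mul_comm, pow_mul]; simp
      set x := ChebSpline.ip a b (ChebSpline.phi k w a b (v 0)) (ChebSpline.bspline k w a b t j)
      set y := ChebSpline.ip a b (ChebSpline.phi k w a b (v 0))
        (ChebSpline.bspline k w a b t (j + 1))
      have h5 : e * (-1) ^ j * x * (e * (-1) ^ (j + 1) * y) = -(x * y) := by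
        rw [pow_succ]
        linear_combination (-((-1 : ℝ) ^ j) ^ 2 * x * y) * h3 - x * y * h4
      have h6 := mul_pos h1 h2
      rw [h5] at h6
      linarith
    · refine (hle j hj).trans ((le_abs_self _).trans_eq ?_)
      rw [abs_mul, abs_mul, he, abs_neg_one_pow, one_mul, one_mul]
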